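/- Let $T$ be an unrooted tree (a finite connected acyclic graph) with $n\ge 1$ nodes whose edges are labeled by letters from an integer alphabet $\Sigma=\{0,\dots,\sigma-1\}$ of size $\sigma$ polynomial in $n$. Let $L(T)\subseteq\Sigma^*$ be the set of all words obtained by concatenating the labels along the simple paths of $T$, read from any node to any node (the empty path included). The set $\mathrm{MAW}(T)$ of minimal absent words of $T$ consists of all words $aub$ with $a,b\in\Sigma$ and $u\in\Sigma^*$ such that $au\in L(T)$ and $ub\in L(T)$ but $aub\notin L(T)$. There is a deterministic algorithm on the word RAM with $\Omega(\log n)$-bit words that, given $n$ and the list of the labeled edges of $T$ (in any order), outputs every element of $\mathrm{MAW}(T)$ exactly once in time $O(n^2+|\mathrm{MAW}(T)|)$, using $O(n^2)$ words of space in addition to the write-only output. Here a word $aub\in\mathrm{MAW}(T)$ is output in constant space as a triple $(x,y,b)$, where $x,y$ are nodes of $T$ such that the simple path from $x$ to $y$ spells $au$. Precisely: there is one program $P$ such that for every polynomial $q$ with coefficients in $\mathbb{N}$ there is a constant $C$ such that, for every such tree with $\sigma\le q(n)$ and every word length $w\ge C(\lfloor\log_2 n\rfloor+1)$, the program $P$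 on the $w$-bit word RAM produces such an output in at most $C(n^2+|\mathrm{MAW}(T)|)$ steps, using at most $Cn^2$ memory cells. -/

import Mathlib

/-! ### The word RAM

Words are bit vectors of a fixed width `w`; arithmetic is modulo `2 ^ w`. The machine has
registers, a random access memory whose addresses are words, and a write-only output stream.
A program is a fixed finite text: it cannot depend on the input or on `w`. Every elementary
instruction and every evaluation of a test costs one step. -/

namespace WordRAM

/-- The unit-cost binary operations on words (all comparisons and divisions are unsigned). -/
inductive Op where
  | add | sub | mul | div | mod | and | or | xor | shl | shr

/-- The value of an operation on two `w`-bit words. -/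
def Op.eval {w : ℕ} : Op → BitVec w → BitVec w → BitVec w
  | .add, x, y => x + y
  | .sub, x, y => x - y
  | .mul, x, y => x * y
  | .div, x, y => x / y
  | .mod, x, y => x % y
  | .and, x, y => x &&& y
  | .or, x, y => x ||| y
  | .xor, x, y => x ^^^ y
  | .shl, x, y => x <<< y
  | .shr, x, y => x >>> y

/-- The comparisons by which control flow can branch. -/
inductive Cmp where
  | eq | ne | lt | le

/-- The truth value of a comparison of two `w`-bit words. -/
def Cmp.Holds {w : ℕ} : Cmp → BitVec w → BitVec w → Prop
  | .eq, x, y => x = y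
  | .ne, x, y => x ≠ y
  | .lt, x, y => x.toNat < y.toNat
  | .le, x, y => x.toNat ≤ y.toNat

/-- Word RAM programs. Registers are named by natural numbers; a program names finitely many. -/
inductive Prog where
  /-- do nothing -/
  | skip : Prog
  /-- `r := k` -/
  | const (r k : ℕ) : Prog
  /-- `r := x o y` -/
  | op (o : Op) (r x y : ℕ) : Prog
  /-- `r := memory[x]` -/
  | load (r x : ℕ) : Prog
  /-- `memory[x] := y` -/
  | store (x y : ℕ) : Prog
  /-- append the content of register `x` to the output stream -/
  | output (x : ℕ) : Prog
  /-- run one program after the other -/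
  | seq (p q : Prog) : Prog
  /-- branch on a comparison of the registers `x` and `y` -/
  | ite (c : Cmp) (x y : ℕ) (p q : Prog) : Prog
  /-- loop as long as the comparison of the registers `x` and `y` holds -/
  | loop (c : Cmp) (x y : ℕ) (p : Prog) : Prog

/-- A configuration of the machine with `w`-bit words. -/
@[ext]
structure State (w : ℕ) where
  /-- contents of the registers -/
  reg : ℕ → BitVec w
  /-- contents of the memory cells -/
  mem : ℕ → BitVec w
  /-- everything written to the output stream so far, in order -/
  out : List (BitVec w)

/-- `Exec S p s t s'`: on a machine with `S` memory cells (with addresses `0, …, S - 1`), program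
`p` started in `s` terminates in `s'` after exactly `t` steps. An access to an address outside the
memory has no rule, so a terminating run accesses only the `S` cells. -/
inductive Exec {w : ℕ} (S : ℕ) : Prog → State w → ℕ → State w → Prop
  | skip (s : State w) : Exec S .skip s 1 s
  | const (r k : ℕ) (s : State w) :
      Exec S (.const r k) s 1 { s with reg := Function.update s.reg r (BitVec.ofNat w k) }
  | op (o : Op) (r x y : ℕ) (s : State w) :
      Exec S (.op o r x y) s 1
        { s with reg := Function.update s.reg r (o.eval (s.reg x) (s.reg y)) }
  | load (r x : ℕ) (s : State w) (h : (s.reg x).toNat < S) :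
      Exec S (.load r x) s 1 { s with reg := Function.update s.reg r (s.mem (s.reg x).toNat) }
  | store (x y : ℕ) (s : State w) (h : (s.reg x).toNat < S) :
      Exec S (.store x y) s 1 { s with mem := Function.update s.mem (s.reg x).toNat (s.reg y) }
  | output (x : ℕ) (s : State w) :
      Exec S (.output x) s 1 { s with out := s.out ++ [s.reg x] }
  | seq {p q : Prog} {s s₁ s₂ : State w} {t₁ t₂ : ℕ} (hp : Exec S p s t₁ s₁)
      (hq : Exec S q s₁ t₂ s₂) : Exec S (.seq p q) s (t₁ + t₂) s₂
  | ite_true {c : Cmp} {x y : ℕ} {p q : Prog} {s s' : State w} {t : ℕ}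
      (h : c.Holds (s.reg x) (s.reg y)) (hp : Exec S p s t s') :
      Exec S (.ite c x y p q) s (1 + t) s'
  | ite_false {c : Cmp} {x y : ℕ} {p q : Prog} {s s' : State w} {t : ℕ}
      (h : ¬ c.Holds (s.reg x) (s.reg y)) (hq : Exec S q s t s') :
      Exec S (.ite c x y p q) s (1 + t) s'
  | loop_true {c : Cmp} {x y : ℕ} {p : Prog} {s s₁ s₂ : State w} {t₁ t₂ : ℕ}
      (h : c.Holds (s.reg x) (s.reg y)) (hp : Exec S p s t₁ s₁)
      (hw : Exec S (.loop c x y p) s₁ t₂ s₂) :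
      Exec S (.loop c x y p) s (1 + t₁ + t₂) s₂
  | loop_false {c : Cmp} {x y : ℕ} {p : Prog} {s : State w}
      (h : ¬ c.Holds (s.reg x) (s.reg y)) : Exec S (.loop c x y p) s 1 s

/-- The initial configuration: the input stands at the beginning of the memory, one number per
cell; all other cells and all registers hold zero; nothing has been output. -/
def State.init (w : ℕ) (input : List ℕ) : State w where
  reg _ := 0
  mem i := BitVec.ofNat w (input.getD i 0)
  out := []

end WordRAM

/-! ### Minimal absent words -/

/-- The minimal absent words of a language `L` that is closed under taking factors: the words
`a u b`, with `a` and `b` letters, such that `a u` and `u b` but not `a u b` belong to `L`. -/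
def minimalAbsentWords {α : Type*} (L : Language α) : Set (List α) :=
  {z | ∃ (a : α) (u : List α) (b : α),
    z = a :: (u ++ [b]) ∧ a :: (u ++ [b]) ∉ L ∧ a :: u ∈ L ∧ u ++ [b] ∈ L}

/-- An unrooted tree with nodes `0, …, n - 1` and edges labeled by letters from the integer
alphabet `{0, …, σ - 1}`. -/
structure UnrootedTree (n σ : ℕ) where
  /-- the underlying graph -/
  graph : SimpleGraph (Fin n)
  isTree : graph.IsTree
  /-- the letter on an edge -/
  label : graph.edgeSet → Fin σ

namespace UnrootedTree

variable {n σ : ℕ} (T : UnrootedTree n σ)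

/-- The concatenation of the labels along a walk. -/
def walkWord : {x y : Fin n} → T.graph.Walk x y → List (Fin σ)
  | _, _, .nil => []
  | _, _, .cons h p => T.label ⟨s(_, _), h⟩ :: walkWord p

/-- The language `L(T)`: all words that are read along simple paths, from any node. -/
def language : Language (Fin σ) :=
  {z | ∃ (x y : Fin n) (p : T.graph.Walk x y), p.IsPath ∧ T.walkWord p = z}

/-- The set `MAW(T)`. -/
def maw : Set (List (Fin σ)) :=
  minimalAbsentWords T.language

/-- The simple path from `x` to `y`. -/
noncomputable def path (x y : Fin n) : T.graph.Walk x y :=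
  (T.isTree.existsUnique_path x y).choose

theorem path_isPath (x y : Fin n) : (T.path x y).IsPath :=
  (T.isTree.existsUnique_path x y).choose_spec.1

theorem eq_path {x y : Fin n} {p : T.graph.Walk x y} (hp : p.IsPath) : p = T.path x y :=
  (T.isTree.existsUnique_path x y).choose_spec.2 p hp

theorem length_walkWord {x y : Fin n} (p : T.graph.Walk x y) :
    (T.walkWord p).length = p.length := by
  induction p with
  | nil => rfl
  | cons h p ih => simp [walkWord, ih]

/-- `MAW(T)` is finite, so that its cardinality is `T.maw.ncard`. -/
theorem finite_maw : T.maw.Finite := by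
  refine (List.finite_length_le (Fin σ) (n + 1)).subset ?_
  rintro z ⟨a, u, b, rfl, -, ⟨x, y, p, hp, hu⟩, -⟩
  have h := hp.length_lt
  rw [← T.length_walkWord p, hu] at h
  simp only [Fintype.card_fin, List.length_cons] at h
  simp only [Set.mem_ofPred_eq, List.length_cons, List.length_append, List.length_nil]
  omega

/-- `es` lists every edge of the tree exactly once, in any order and each with any orientation. -/
def IsEdgeList (es : List T.graph.Dart) : Prop :=
  (es.map SimpleGraph.Dart.edge).Nodup ∧ ∀ e ∈ T.graph.edgeSet, e ∈ es.map SimpleGraph.Dart.edge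

/-- The input of the algorithm: the number of nodes, and then for every edge its two ends and its
label. -/
def encode (es : List T.graph.Dart) : List ℕ :=
  n :: es.flatMap fun d => [d.fst.val, d.snd.val, (T.label ⟨d.edge, d.edge_mem⟩).val]

/-- The word described by a triple `(x, y, b)` of two nodes and a letter: the word read along the
simple path from `x` to `y`, followed by `b`. -/
noncomputable def tripleWord (t : Fin n × Fin n × Fin σ) : List (Fin σ) :=
  T.walkWord (T.path t.1 t.2.1) ++ [t.2.2]

/-- The output stream is a sequence of triples of machine words that describes every minimal
absent word of `T` exactly once, and nothing else. -/
def ListsMAW {w : ℕ} (out : List (BitVec w)) : Prop :=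
  ∃ ts : List (Fin n × Fin n × Fin σ),
    out = ts.flatMap (fun t =>
      [BitVec.ofNat w t.1, BitVec.ofNat w t.2.1, BitVec.ofNat w t.2.2]) ∧
    (ts.map T.tripleWord).Nodup ∧
    ∀ z, z ∈ ts.map T.tripleWord ↔ z ∈ T.maw

end UnrootedTree

/-!
The words of `T` are closed under factors, and each of the `n²` paths spells one of them, so they
form a trie with at most `n²` nodes. The trie is built in breadth-first order: the class of a trie
node consists of the paths that spell its word, and running through the one-edge extensions of these
paths fills the classes of its children. All classes together have `n²` paths, and the degrees of
the end nodes of the paths with a given start add up to `2(n - 1)`, so this takes `O(n²)` steps. A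
letter is represented by the number of the first edge that bears it, which is less than `n`; hence
the children of one node can be looked up in a table indexed by letters. The table is never
cleared: since node numbers increase, an entry is valid if and only if it is at least the number of
the first child of the current node.

Deleting the first edge of a path with word `au` leads to the trie node of `u`, the suffix link of
`au`. The minimal absent words with longest proper prefix `au` are the `aub` for which `b` is the
letter of a child of `u` but not of `au`. Each child of `u` inspected in the search for them either
yields such a word or is matched by a child of `au`, so that the total time is proportional to the
size of the trie plus the number of minimal absent words.
-/

/-! ### A structured language on top of the word RAM -/

namespace WordRAM

/-- The variables of the structured language. -/
inductive Var where
  | nodes | edge | rank | src | dst | nbr | pair | pairPtr | dart | child | index | node | size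
  deriving DecidableEq

/-- The arrays of the structured language. -/
inductive Arr where
  | adjHead | adjNext | adjNode | adjRank | cls | next | head | first | start | letter | child
  | mark
  deriving DecidableEq

/-- The number of a variable, which determines its register. -/
def Var.idx : Var → ℕ
  | .nodes => 0 | .edge => 1 | .rank => 2 | .src => 3 | .dst => 4 | .nbr => 5 | .pair => 6
  | .pairPtr => 7 | .dart => 8 | .child => 9 | .index => 10 | .node => 11 | .size => 12

/-- The number of an array, which determines its residue class of memory cells modulo 16. -/
def Arr.idx : Arr → ℕ
  | .adjHead => 0 | .adjNext => 1 | .adjNode => 2 | .adjRank => 3 | .cls => 4 | .next => 5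
  | .head => 6 | .first => 7 | .start => 8 | .letter => 9 | .child => 10 | .mark => 11

theorem Var.idx_injective : Function.Injective Var.idx := by
  intro a b h
  cases a <;> cases b <;> first | rfl | exact absurd h (by decide)

theorem Arr.idx_injective : Function.Injective Arr.idx := by
  intro a b h
  cases a <;> cases b <;> first | rfl | exact absurd h (by decide)

theorem Arr.idx_lt (A : Arr) : A.idx < 16 := by
  cases A <;> decide

/-- Arithmetic operations on natural numbers. -/
inductive NatOp where
  | add | sub | mul | div | mod

/-- The machine operation that implements an arithmetic operation. -/
def NatOp.op : NatOp → Op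
  | .add => .add | .sub => .sub | .mul => .mul | .div => .div | .mod => .mod

/-- The value of an arithmetic operation. -/
def NatOp.eval : NatOp → ℕ → ℕ → ℕ
  | .add, x, y => x + y
  | .sub, x, y => x - y
  | .mul, x, y => x * y
  | .div, x, y => x / y
  | .mod, x, y => x % y

/-- An operation on numbers below `B` is carried out without overflow. -/
def NatOp.Safe (B : ℕ) : NatOp → ℕ → ℕ → Prop
  | .add, x, y => x + y < B
  | .sub, x, y => y ≤ x
  | .mul, x, y => x * y < B
  | .div, _, _ => True
  | .mod, _, _ => True

theorem NatOp.toNat_eval {w B : ℕ} (hB : B ≤ 2 ^ w) (o : NatOp) (x y : BitVec w)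
    (h : o.Safe B x.toNat y.toNat) : (o.op.eval x y).toNat = o.eval x.toNat y.toNat := by
  cases o <;> simp only [NatOp.op, Op.eval, NatOp.eval, NatOp.Safe] at *
  · rw [BitVec.toNat_add, Nat.mod_eq_of_lt (by omega)]
  · exact BitVec.toNat_sub_of_le (by simpa [BitVec.le_def] using h)
  · rw [BitVec.toNat_mul, Nat.mod_eq_of_lt (by omega)]
  · exact BitVec.toNat_udiv
  · exact BitVec.toNat_umod

/-- Expressions. -/
inductive Expr where
  | var (a : Var)
  | lit (k : ℕ)
  | bin (o : NatOp) (a b : Expr)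
  | inp (a : Expr)
  | get (A : Arr) (a : Expr)

/-- The state of a structured program: variables, arrays, output and elapsed time. -/
structure Env where
  var : Var → ℕ
  arr : Arr → ℕ → ℕ
  out : List ℕ
  time : ℕ

/-- The constant data of a run: the input, its length, the length of the arrays and a bound for
the results of arithmetic. -/
structure Ctx where
  inp : ℕ → ℕ
  base : ℕ
  len : ℕ
  bound : ℕ

/-- Assign a variable. -/
def Env.set (s : Env) (a : Var) (v : ℕ) : Env :=
  { s with var := Function.update s.var a v }

/-- Assign an array cell. -/
def Env.put (s : Env) (A : Arr) (i v : ℕ) : Env :=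
  { s with arr := Function.update s.arr A (Function.update (s.arr A) i v) }

/-- Append a number to the output. -/
def Env.emit (s : Env) (v : ℕ) : Env :=
  { s with out := s.out ++ [v] }

/-- Let time pass. -/
def Env.tick (s : Env) (t : ℕ) : Env :=
  { s with time := s.time + t }

section Env

variable (s : Env) (a : Var) (A : Arr) (i v t : ℕ)

@[simp] theorem Env.set_var : (s.set a v).var = Function.update s.var a v := rfl
@[simp] theorem Env.set_arr : (s.set a v).arr = s.arr := rfl
@[simp] theorem Env.set_out : (s.set a v).out = s.out := rfl
@[simp] theorem Env.set_time : (s.set a v).time = s.time := rfl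
@[simp] theorem Env.put_var : (s.put A i v).var = s.var := rfl
@[simp] theorem Env.put_arr :
    (s.put A i v).arr = Function.update s.arr A (Function.update (s.arr A) i v) := rfl
@[simp] theorem Env.put_time : (s.put A i v).time = s.time := rfl
@[simp] theorem Env.emit_var : (s.emit v).var = s.var := rfl
@[simp] theorem Env.emit_arr : (s.emit v).arr = s.arr := rfl
@[simp] theorem Env.emit_out : (s.emit v).out = s.out ++ [v] := rfl
@[simp] theorem Env.emit_time : (s.emit v).time = s.time := rfl
@[simp] theorem Env.tick_var : (s.tick t).var = s.var := rfl
@[simp] theorem Env.tick_arr : (s.tick t).arr = s.arr := rfl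
@[simp] theorem Env.tick_out : (s.tick t).out = s.out := rfl
@[simp] theorem Env.tick_time : (s.tick t).time = s.time + t := rfl

end Env

namespace Expr

/-- The value of an expression. -/
def eval (Γ : Ctx) (s : Env) : Expr → ℕ
  | var a => s.var a
  | lit k => k
  | bin o a b => o.eval (a.eval Γ s) (b.eval Γ s)
  | inp a => Γ.inp (a.eval Γ s)
  | get A a => s.arr A (a.eval Γ s)

/-- An expression is evaluated without overflow and without leaving the bounds of the arrays. -/
def Ok (Γ : Ctx) (s : Env) : Expr → Prop
  | var _ => True
  | lit k => k < Γ.bound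
  | bin o a b => a.Ok Γ s ∧ b.Ok Γ s ∧ o.Safe Γ.bound (a.eval Γ s) (b.eval Γ s)
  | inp a => a.Ok Γ s ∧ a.eval Γ s < Γ.base
  | get _ a => a.Ok Γ s ∧ a.eval Γ s < Γ.len

/-- The number of steps taken by the evaluation of an expression. -/
def cost : Expr → ℕ
  | var _ => 1
  | lit _ => 1
  | bin _ a b => a.cost + (b.cost + 1)
  | inp a => a.cost + 1
  | get _ a => a.cost + 6

/-- The machine code that turns an index in register `2 * d + 1` into an address of array `A`. -/
def addrCode (A : Arr) (d : ℕ) : Prog :=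
  .seq (.const (2 * d + 3) 16) (.seq (.op .mul (2 * d + 1) (2 * d + 1) (2 * d + 3))
    (.seq (.const (2 * d + 3) A.idx) (.seq (.op .add (2 * d + 1) (2 * d + 1) (2 * d + 3))
      (.op .add (2 * d + 1) (2 * d + 1) 1))))

/-- The machine code that evaluates an expression into register `2 * d + 1`. -/
def code : Expr → ℕ → Prog
  | var a, d => .op .or (2 * d + 1) (2 * a.idx) (2 * a.idx)
  | lit k, d => .const (2 * d + 1) k
  | bin o a b, d =>
    .seq (a.code d) (.seq (b.code (d + 1)) (.op o.op (2 * d + 1) (2 * d + 1) (2 * d + 3)))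
  | inp a, d => .seq (a.code d) (.load (2 * d + 1) (2 * d + 1))
  | get A a, d => .seq (a.code d) (.seq (addrCode A d) (.load (2 * d + 1) (2 * d + 1)))

end Expr

/-- The machine state `σ` represents the state `s` of a structured program. -/
structure Rep {w : ℕ} (Γ : Ctx) (σ : State w) (s : Env) : Prop where
  base : (σ.reg 1).toNat = Γ.base
  var : ∀ a : Var, (σ.reg (2 * a.idx)).toNat = s.var a
  inp : ∀ i < Γ.base, (σ.mem i).toNat = Γ.inp i
  arr : ∀ A : Arr, ∀ i < Γ.len, (σ.mem (16 * i + A.idx + Γ.base)).toNat = s.arr A i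
  out : σ.out = s.out.map (BitVec.ofNat w)

/-- The word length suffices for the addresses and the results of arithmetic. -/
structure Ctx.Fits (Γ : Ctx) (w : ℕ) : Prop where
  len : Γ.base + 16 * Γ.len < 2 ^ w
  bound : Γ.bound ≤ 2 ^ w

variable {w : ℕ} {Γ : Ctx} {σ : State w} {s : Env}

theorem Rep.updateReg (h : Rep Γ σ s) {d : ℕ} (hd : 1 ≤ d) (v : BitVec w) :
    Rep Γ { σ with reg := Function.update σ.reg (2 * d + 1) v } s where
  base := by simpa [Function.update_apply, show d ≠ 0 by omega] using h.base
  var a := by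
    simpa [Function.update_apply, show 2 * a.idx ≠ 2 * d + 1 by omega] using h.var a
  inp := h.inp
  arr := h.arr
  out := h.out

theorem Rep.tick (h : Rep Γ σ s) (t : ℕ) : Rep Γ σ (s.tick t) where
  base := h.base
  var := h.var
  inp := h.inp
  arr := h.arr
  out := h.out

theorem Rep.set (h : Rep Γ σ s) (a : Var) (v : BitVec w) :
    Rep Γ { σ with reg := Function.update σ.reg (2 * a.idx) v } (s.set a v.toNat) where
  base := by simpa [Function.update_apply, show 1 ≠ 2 * a.idx by omega] using h.base
  var b := by
    by_cases hb : b = a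
    · subst hb; simp
    · have : 2 * b.idx ≠ 2 * a.idx := fun hh => hb (Var.idx_injective (by omega))
      simpa [Function.update_apply, this, hb] using h.var b
  inp := h.inp
  arr := h.arr
  out := h.out

theorem Rep.put (h : Rep Γ σ s) (A : Arr) (i : ℕ) (v : BitVec w) :
    Rep Γ { σ with mem := Function.update σ.mem (16 * i + A.idx + Γ.base) v }
      (s.put A i v.toNat) where
  base := h.base
  var := h.var
  inp j hj := by
    simpa [Function.update_apply, show j ≠ 16 * i + A.idx + Γ.base by omega] using h.inp j hj
  arr A' j hj := by
    have h1 := A.idx_lt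
    have h2 := A'.idx_lt
    by_cases hA : A' = A
    · subst hA
      by_cases hij : j = i
      · subst hij; simp
      · simpa [Function.update_apply, hij] using h.arr A' j hj
    · have : A'.idx ≠ A.idx := fun hh => hA (Arr.idx_injective hh)
      have h3 : 16 * j + A'.idx ≠ 16 * i + A.idx := by omega
      simpa [Function.update_apply, h3, hA] using h.arr A' j hj
  out := h.out

theorem Rep.emit (h : Rep Γ σ s) (v : BitVec w) :
    Rep Γ { σ with out := σ.out ++ [v] } (s.emit v.toNat) where
  base := h.base
  var := h.var
  inp := h.inp
  arr := h.arr
  out := by simp [h.out]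

/-- The registers below `2 * d` of two machine states agree on the temporary values. -/
def SameTemps (d : ℕ) (σ σ' : State w) : Prop :=
  ∀ d', 1 ≤ d' → d' < d → σ'.reg (2 * d' + 1) = σ.reg (2 * d' + 1)

theorem SameTemps.updateReg {d : ℕ} {σ σ' : State w} (h : SameTemps d σ σ') (v : BitVec w) :
    SameTemps d σ { σ' with reg := Function.update σ'.reg (2 * d + 1) v } := by
  intro d' h1 h2
  simp only [Function.update_apply]
  rw [if_neg (by omega), h d' h1 h2]

theorem Expr.addrCode_exec (hΓ : Γ.Fits w) (h : Rep Γ σ s) (A : Arr) {d : ℕ} (hd : 1 ≤ d)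
    (hi : (σ.reg (2 * d + 1)).toNat < Γ.len) :
    ∃ σ' : State w, Exec (Γ.base + 16 * Γ.len) (addrCode A d) σ 5 σ' ∧ Rep Γ σ' s ∧
      (σ'.reg (2 * d + 1)).toNat = 16 * (σ.reg (2 * d + 1)).toNat + A.idx + Γ.base ∧
      SameTemps d σ σ' ∧ σ'.mem = σ.mem := by
  have hA := A.idx_lt
  have hl := hΓ.len
  refine ⟨_, .seq (t₁ := 1) (t₂ := 4) (.const _ _ _) (.seq (t₁ := 1) (t₂ := 3) (.op _ _ _ _ _)
    (.seq (t₁ := 1) (t₂ := 2) (.const _ _ _) (.seq (t₁ := 1) (t₂ := 1) (.op _ _ _ _ _)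
      (.op _ _ _ _ _)))), ?_, ?_, ?_, rfl⟩
  · exact ((((h.updateReg (d := d + 1) (by omega) _).updateReg hd _).updateReg (d := d + 1)
      (by omega) _).updateReg hd _).updateReg hd _
  · have e1 : (2 * d + 3 = 2 * d + 1) = False := by simp
    have e2 : (1 = 2 * d + 1) = False := by simp; omega
    have e3 : (1 = 2 * d + 3) = False := by simp
    simp only [Function.update_apply, Op.eval, e1, e2, e3, if_true, if_false, BitVec.toNat_add,
      BitVec.toNat_mul, BitVec.toNat_ofNat, h.base, show (2 * d + 1 = 2 * d + 3) = False by simp]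
    rw [Nat.mod_eq_of_lt (a := 16) (by omega), Nat.mod_eq_of_lt (a := A.idx) (by omega),
      Nat.mod_eq_of_lt (a := (σ.reg (2 * d + 1)).toNat * 16) (by omega),
      Nat.mod_eq_of_lt (a := (σ.reg (2 * d + 1)).toNat * 16 + A.idx) (by omega),
      Nat.mod_eq_of_lt (by omega)]
    ring
  · intro d' _ h2
    simp [Function.update_apply, show d' ≠ d by omega, show 2 * d' ≠ 2 * d + 2 by omega]

theorem Expr.code_exec (hΓ : Γ.Fits w) (e : Expr) :
    ∀ {σ : State w} {d : ℕ}, 1 ≤ d → Rep Γ σ s → e.Ok Γ s →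
    ∃ σ' : State w, Exec (Γ.base + 16 * Γ.len) (e.code d) σ e.cost σ' ∧ Rep Γ σ' s ∧
      (σ'.reg (2 * d + 1)).toNat = e.eval Γ s ∧ SameTemps d σ σ' := by
  induction e with
  | var a =>
    intro σ d hd h _
    refine ⟨_, .op _ _ _ _ _, h.updateReg hd _, ?_, .updateReg (fun _ _ _ => rfl) _⟩
    simp [Op.eval, Expr.eval, h.var]
  | lit k =>
    intro σ d hd h hk
    refine ⟨_, .const _ _ _, h.updateReg hd _, ?_, .updateReg (fun _ _ _ => rfl) _⟩
    have hkw : k < 2 ^ w := lt_of_lt_of_le hk hΓ.bound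
    simp [Expr.eval, Nat.mod_eq_of_lt hkw]
  | bin o a b iha ihb =>
    intro σ d hd h ⟨ha, hb, ho⟩
    obtain ⟨σ₁, e₁, r₁, v₁, t₁⟩ := iha hd h ha
    obtain ⟨σ₂, e₂, r₂, v₂, t₂⟩ := ihb (d := d + 1) (by omega) r₁ hb
    have v₁' : (σ₂.reg (2 * d + 1)).toNat = a.eval Γ s := by rw [t₂ d hd (by omega), v₁]
    have v₂' : (σ₂.reg (2 * d + 3)).toNat = b.eval Γ s := v₂
    refine ⟨_, .seq e₁ (.seq e₂ (.op _ _ _ _ _)), r₂.updateReg hd _, ?_,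
      .updateReg (fun d' h1 h2 => (t₂ d' h1 (by omega)).trans (t₁ d' h1 h2)) _⟩
    simp only [Function.update_self, Expr.eval, ← v₁', ← v₂']
    exact NatOp.toNat_eval hΓ.bound _ _ _ (by rw [v₁', v₂']; exact ho)
  | inp a iha =>
    intro σ d hd h ⟨ha, hi⟩
    obtain ⟨σ₁, e₁, r₁, v₁, t₁⟩ := iha hd h ha
    refine ⟨_, .seq e₁ (.load _ _ _ (by rw [v₁]; omega)), r₁.updateReg hd _, ?_, t₁.updateReg _⟩
    simp only [Function.update_self, Expr.eval, ← v₁]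
    exact r₁.inp _ (by rw [v₁]; exact hi)
  | get A a iha =>
    intro σ d hd h ⟨ha, hi⟩
    obtain ⟨σ₁, e₁, r₁, v₁, t₁⟩ := iha hd h ha
    obtain ⟨σ₂, e₂, r₂, v₂, t₂, m₂⟩ := addrCode_exec hΓ r₁ A hd (by rw [v₁]; exact hi)
    have hA := A.idx_lt
    rw [v₁] at v₂
    refine ⟨_, .seq e₁ (.seq e₂ (.load _ _ _ (by rw [v₂]; omega))), r₂.updateReg hd _, ?_,
      .updateReg (fun d' h1 h2 => (t₂ d' h1 h2).trans (t₁ d' h1 h2)) _⟩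
    simp only [Function.update_self, Expr.eval, v₂]
    exact r₂.arr _ _ hi

/-- The truth value of a comparison of natural numbers. -/
def Cmp.Test : Cmp → ℕ → ℕ → Prop
  | .eq, x, y => x = y
  | .ne, x, y => x ≠ y
  | .lt, x, y => x < y
  | .le, x, y => x ≤ y

theorem Cmp.holds_iff (c : Cmp) (x y : BitVec w) : c.Holds x y ↔ c.Test x.toNat y.toNat := by
  cases c <;> simp [Cmp.Holds, Cmp.Test, BitVec.toNat_eq]

/-- Structured programs. -/
inductive Cmd where
  | set (a : Var) (e : Expr)
  | put (A : Arr) (i e : Expr)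
  | emit (e : Expr)
  | skip
  | seq (p q : Cmd)
  | ite (c : Cmp) (a b : Expr) (p q : Cmd)
  | loop (c : Cmp) (a b : Expr) (p : Cmd)

namespace Cmd

/-- The machine code that evaluates the two sides of a comparison. -/
def testCode (a b : Expr) : Prog :=
  .seq (a.code 1) (b.code 2)

/-- The machine code of a structured program. -/
def code : Cmd → Prog
  | set a e => .seq (e.code 1) (.op .or (2 * a.idx) 3 3)
  | put A i e => .seq (i.code 1) (.seq (Expr.addrCode A 1) (.seq (e.code 2) (.store 3 5)))
  | emit e => .seq (e.code 1) (.output 3)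
  | skip => .skip
  | seq p q => .seq p.code q.code
  | ite c a b p q => .seq (testCode a b) (.ite c 3 5 p.code q.code)
  | loop c a b p => .seq (testCode a b) (.loop c 3 5 (.seq p.code (testCode a b)))

/-- The weakest precondition of a structured program, with invariants and a measure for loops. -/
def wp (Γ : Ctx) : Cmd → (Env → Prop) → Env → Prop
  | set a e, Q, s => e.Ok Γ s ∧ Q ((s.set a (e.eval Γ s)).tick (e.cost + 1))
  | put A i e, Q, s => i.Ok Γ s ∧ i.eval Γ s < Γ.len ∧ e.Ok Γ s ∧
      Q ((s.put A (i.eval Γ s) (e.eval Γ s)).tick (i.cost + e.cost + 6))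
  | emit e, Q, s => e.Ok Γ s ∧ Q ((s.emit (e.eval Γ s)).tick (e.cost + 1))
  | skip, Q, s => Q (s.tick 1)
  | seq p q, Q, s => p.wp Γ (q.wp Γ Q) s
  | ite c a b p q, Q, s => a.Ok Γ s ∧ b.Ok Γ s ∧
      (c.Test (a.eval Γ s) (b.eval Γ s) → p.wp Γ Q (s.tick (a.cost + b.cost + 1))) ∧
      (¬ c.Test (a.eval Γ s) (b.eval Γ s) → q.wp Γ Q (s.tick (a.cost + b.cost + 1)))
  | loop c a b p, Q, s => ∃ (I : Env → Prop) (μ : Env → ℕ), I s ∧ ∀ s, I s →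
      a.Ok Γ s ∧ b.Ok Γ s ∧
      (c.Test (a.eval Γ s) (b.eval Γ s) →
        p.wp Γ (fun s' => I s' ∧ μ s' < μ s) (s.tick (a.cost + b.cost + 1))) ∧
      (¬ c.Test (a.eval Γ s) (b.eval Γ s) → Q (s.tick (a.cost + b.cost + 1)))

@[simp] theorem wp_set (a : Var) (e : Expr) (Q : Env → Prop) (s : Env) :
    (set a e).wp Γ Q s ↔ e.Ok Γ s ∧ Q ((s.set a (e.eval Γ s)).tick (e.cost + 1)) := Iff.rfl

@[simp] theorem wp_put (A : Arr) (i e : Expr) (Q : Env → Prop) (s : Env) :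
    (put A i e).wp Γ Q s ↔ i.Ok Γ s ∧ i.eval Γ s < Γ.len ∧ e.Ok Γ s ∧
      Q ((s.put A (i.eval Γ s) (e.eval Γ s)).tick (i.cost + e.cost + 6)) := Iff.rfl

@[simp] theorem wp_emit (e : Expr) (Q : Env → Prop) (s : Env) :
    (emit e).wp Γ Q s ↔ e.Ok Γ s ∧ Q ((s.emit (e.eval Γ s)).tick (e.cost + 1)) := Iff.rfl

@[simp] theorem wp_skip (Q : Env → Prop) (s : Env) : skip.wp Γ Q s ↔ Q (s.tick 1) := Iff.rfl

@[simp] theorem wp_seq (p q : Cmd) (Q : Env → Prop) (s : Env) :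
    (seq p q).wp Γ Q s ↔ p.wp Γ (q.wp Γ Q) s := Iff.rfl

@[simp] theorem wp_ite (c : Cmp) (a b : Expr) (p q : Cmd) (Q : Env → Prop) (s : Env) :
    (ite c a b p q).wp Γ Q s ↔ a.Ok Γ s ∧ b.Ok Γ s ∧
      (c.Test (a.eval Γ s) (b.eval Γ s) → p.wp Γ Q (s.tick (a.cost + b.cost + 1))) ∧
      (¬ c.Test (a.eval Γ s) (b.eval Γ s) → q.wp Γ Q (s.tick (a.cost + b.cost + 1))) := Iff.rfl

theorem wp_mono {c : Cmd} {Q Q' : Env → Prop} (hQ : ∀ s, Q s → Q' s) :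
    ∀ {s}, c.wp Γ Q s → c.wp Γ Q' s := by
  induction c generalizing Q Q' with
  | set a e => exact fun h => ⟨h.1, hQ _ h.2⟩
  | put A i e => exact fun h => ⟨h.1, h.2.1, h.2.2.1, hQ _ h.2.2.2⟩
  | emit e => exact fun h => ⟨h.1, hQ _ h.2⟩
  | skip => exact fun h => hQ _ h
  | seq p q ihp ihq => exact fun h => ihp (fun _ => ihq hQ) h
  | ite c a b p q ihp ihq =>
    exact fun h => ⟨h.1, h.2.1, fun hc => ihp hQ (h.2.2.1 hc), fun hc => ihq hQ (h.2.2.2 hc)⟩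
  | loop c a b p =>
    rintro s ⟨I, μ, hs, h⟩
    exact ⟨I, μ, hs, fun s hI => ⟨(h s hI).1, (h s hI).2.1, (h s hI).2.2.1,
      fun hc => hQ _ ((h s hI).2.2.2 hc)⟩⟩

/-- The loop rule with an invariant that depends on a decreasing number. -/
theorem loop_wp {c : Cmp} {a b : Expr} {p : Cmd} {Q : Env → Prop} (I : ℕ → Env → Prop) {k : ℕ}
    {s : Env} (h0 : I k s) (h : ∀ k s, I k s → a.Ok Γ s ∧ b.Ok Γ s ∧
      (c.Test (a.eval Γ s) (b.eval Γ s) →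
        p.wp Γ (fun s' => ∃ k' < k, I k' s') (s.tick (a.cost + b.cost + 1))) ∧
      (¬ c.Test (a.eval Γ s) (b.eval Γ s) → Q (s.tick (a.cost + b.cost + 1)))) :
    (loop c a b p).wp Γ Q s := by
  refine ⟨fun s => ∃ k, I k s, fun s => sInf {k | I k s}, ⟨k, h0⟩, fun s hs => ?_⟩
  obtain ⟨h1, h2, h3, h4⟩ := h _ s (Nat.sInf_mem hs)
  refine ⟨h1, h2, fun hc => wp_mono ?_ (h3 hc), h4⟩
  rintro s' ⟨k', hk', hI⟩
  exact ⟨⟨k', hI⟩, lt_of_le_of_lt (Nat.sInf_le hI) hk'⟩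

theorem testCode_exec (hΓ : Γ.Fits w) (h : Rep Γ σ s) {a b : Expr} (ha : a.Ok Γ s)
    (hb : b.Ok Γ s) (c : Cmp) :
    ∃ σ' : State w, Exec (Γ.base + 16 * Γ.len) (testCode a b) σ (a.cost + b.cost) σ' ∧
      Rep Γ σ' s ∧ (c.Holds (σ'.reg 3) (σ'.reg 5) ↔ c.Test (a.eval Γ s) (b.eval Γ s)) := by
  obtain ⟨σ₁, e₁, r₁, v₁, -⟩ := Expr.code_exec hΓ a (d := 1) le_rfl h ha
  obtain ⟨σ₂, e₂, r₂, v₂, t₂⟩ := Expr.code_exec hΓ b (d := 2) (by omega) r₁ hb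
  have t₃ := t₂ 1 le_rfl (by omega)
  simp only [Nat.reduceMul, Nat.reduceAdd] at v₁ v₂ t₃
  exact ⟨σ₂, .seq e₁ e₂, r₂, by rw [Cmp.holds_iff, v₂, t₃, v₁]⟩

/-- The machine code of `p` simulates `p`: it ends in a state that represents an outcome of `p`,
after the number of steps by which the clock of `p` has advanced. -/
def Simulated (Γ : Ctx) (w : ℕ) (p : Cmd) : Prop :=
  ∀ {Q : Env → Prop} {s : Env} {σ : State w}, Rep Γ σ s → p.wp Γ Q s →
    ∃ (t : ℕ) (σ' : State w) (s' : Env), Exec (Γ.base + 16 * Γ.len) p.code σ t σ' ∧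
      Rep Γ σ' s' ∧ s'.time = s.time + t ∧ Q s'

theorem simulated_set (hΓ : Γ.Fits w) (a : Var) (e : Expr) : (set a e).Simulated Γ w := by
  rintro Q s σ h ⟨he, hq⟩
  obtain ⟨σ₁, e₁, r₁, v₁, -⟩ := Expr.code_exec hΓ e (d := 1) le_rfl h he
  refine ⟨_, _, _, .seq e₁ (.op _ _ _ _ _), (r₁.set _ _).tick _, rfl, ?_⟩
  simpa [Op.eval, v₁] using hq

theorem simulated_put (hΓ : Γ.Fits w) (A : Arr) (i e : Expr) : (put A i e).Simulated Γ w := by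
  rintro Q s σ h ⟨hi, hlt, he, hq⟩
  obtain ⟨σ₁, e₁, r₁, v₁, -⟩ := Expr.code_exec hΓ i (d := 1) le_rfl h hi
  obtain ⟨σ₂, e₂, r₂, v₂, -⟩ := Expr.addrCode_exec hΓ r₁ A le_rfl (by rwa [v₁])
  obtain ⟨σ₃, e₃, r₃, v₃, t₃⟩ := Expr.code_exec hΓ e (d := 2) (by omega) r₂ he
  have hA := A.idx_lt
  have haddr : (σ₃.reg 3).toNat = 16 * i.eval Γ s + A.idx + Γ.base := by
    rw [← v₁, ← v₂]
    exact congrArg _ (t₃ 1 le_rfl (by omega))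
  refine ⟨_, _, _, .seq e₁ (.seq e₂ (.seq e₃ (.store _ _ _ (by omega)))), ?_, ?_, hq⟩
  · have hrep := (r₃.put A (i.eval Γ s) (σ₃.reg 5)).tick (i.cost + e.cost + 6)
    rw [haddr]
    rwa [show (σ₃.reg 5).toNat = e.eval Γ s from v₃] at hrep
  · simp only [Env.tick_time, Env.put_time]
    omega

theorem simulated_emit (hΓ : Γ.Fits w) (e : Expr) : (emit e).Simulated Γ w := by
  rintro Q s σ h ⟨he, hq⟩
  obtain ⟨σ₁, e₁, r₁, v₁, -⟩ := Expr.code_exec hΓ e (d := 1) le_rfl h he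
  refine ⟨_, _, _, .seq e₁ (.output _ _), (r₁.emit _).tick _, rfl, ?_⟩
  simpa [v₁] using hq

theorem simulated_skip : skip.Simulated Γ w :=
  fun h hq => ⟨_, _, _, .skip _, h.tick 1, rfl, hq⟩

theorem Simulated.seq {p q : Cmd} (hp : p.Simulated Γ w) (hq : q.Simulated Γ w) :
    (seq p q).Simulated Γ w := by
  intro Q s σ h hwp
  obtain ⟨t₁, σ₁, s₁, e₁, r₁, ht₁, hq₁⟩ := hp h hwp
  obtain ⟨t₂, σ₂, s₂, e₂, r₂, ht₂, hq₂⟩ := hq r₁ hq₁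
  exact ⟨_, _, _, .seq e₁ e₂, r₂, by omega, hq₂⟩

theorem Simulated.ite (hΓ : Γ.Fits w) {p q : Cmd} (hp : p.Simulated Γ w) (hq : q.Simulated Γ w)
    (c : Cmp) (a b : Expr) : (ite c a b p q).Simulated Γ w := by
  rintro Q s σ h ⟨ha, hb, hpos, hneg⟩
  obtain ⟨σ₁, e₁, r₁, hc⟩ := testCode_exec hΓ h ha hb c
  by_cases htest : c.Test (a.eval Γ s) (b.eval Γ s)
  · obtain ⟨t₂, σ₂, s₂, e₂, r₂, ht₂, hq₂⟩ := hp (r₁.tick _) (hpos htest)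
    rw [Env.tick_time] at ht₂
    exact ⟨_, _, _, .seq e₁ (.ite_true (hc.2 htest) e₂), r₂, by omega, hq₂⟩
  · obtain ⟨t₂, σ₂, s₂, e₂, r₂, ht₂, hq₂⟩ := hq (r₁.tick _) (hneg htest)
    rw [Env.tick_time] at ht₂
    exact ⟨_, _, _, .seq e₁ (.ite_false (mt hc.1 htest) e₂), r₂, by omega, hq₂⟩

theorem Simulated.loop (hΓ : Γ.Fits w) {p : Cmd} (hp : p.Simulated Γ w) (c : Cmp) (a b : Expr) :
    (loop c a b p).Simulated Γ w := by
  rintro Q s σ h ⟨I, μ, hI, hstep⟩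
  suffices hloop : ∀ (N : ℕ) (s : Env) (σ₁ : State w), μ s < N → I s → Rep Γ σ₁ s →
      (c.Holds (σ₁.reg 3) (σ₁.reg 5) ↔ c.Test (a.eval Γ s) (b.eval Γ s)) →
      ∃ (t : ℕ) (σ' : State w) (s' : Env), Exec (Γ.base + 16 * Γ.len)
        (.loop c 3 5 (.seq p.code (testCode a b))) σ₁ t σ' ∧
        Rep Γ σ' s' ∧ s'.time = s.time + (a.cost + b.cost) + t ∧ Q s' by
    obtain ⟨σ₁, e₁, r₁, hc⟩ := testCode_exec hΓ h (hstep s hI).1 (hstep s hI).2.1 c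
    obtain ⟨t, σ', s', e', r', ht, hq⟩ := hloop _ s σ₁ (Nat.lt_succ_self _) hI r₁ hc
    exact ⟨_, _, _, .seq e₁ e', r', by omega, hq⟩
  intro N
  induction N with
  | zero => exact fun s σ₁ hμ => absurd hμ (Nat.not_lt_zero _)
  | succ N ih =>
    intro s σ₁ hμ hI r₁ hc
    obtain ⟨-, -, hbody, hexit⟩ := hstep s hI
    by_cases htest : c.Test (a.eval Γ s) (b.eval Γ s)
    · obtain ⟨t₂, σ₂, s₂, e₂, r₂, ht₂, hI₂, hμ₂⟩ := hp (r₁.tick _) (hbody htest)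
      obtain ⟨σ₃, e₃, r₃, hc₃⟩ := testCode_exec hΓ r₂ (hstep s₂ hI₂).1 (hstep s₂ hI₂).2.1 c
      obtain ⟨t₄, σ₄, s₄, e₄, r₄, ht₄, hq₄⟩ := ih s₂ σ₃ (by omega) hI₂ r₃ hc₃
      rw [Env.tick_time] at ht₂
      exact ⟨_, _, _, .loop_true (hc.2 htest) (.seq e₂ e₃) e₄, r₄, by omega, hq₄⟩
    · exact ⟨_, _, _, .loop_false (mt hc.1 htest), r₁.tick _, by rw [Env.tick_time]; omega,
        hexit htest⟩

theorem simulated (hΓ : Γ.Fits w) (p : Cmd) : p.Simulated Γ w := by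
  induction p with
  | set a e => exact simulated_set hΓ a e
  | put A i e => exact simulated_put hΓ A i e
  | emit e => exact simulated_emit hΓ e
  | skip => exact simulated_skip
  | seq p q hp hq => exact hp.seq hq
  | ite c a b p q hp hq => exact hp.ite hΓ hq c a b
  | loop c a b p hp => exact hp.loop hΓ c a b

/-! ### Reasoning about structured programs -/

/-- The program contains an assignment to a variable. -/
def assigns (a : Var) : Cmd → Bool
  | set b _ => decide (b = a)
  | seq p q => p.assigns a || q.assigns a
  | ite _ _ _ p q => p.assigns a || q.assigns a
  | loop _ _ _ p => p.assigns a
  | _ => false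

/-- The program contains an assignment to a cell of an array. -/
def writes (A : Arr) : Cmd → Bool
  | put B _ _ => decide (B = A)
  | seq p q => p.writes A || q.writes A
  | ite _ _ _ p q => p.writes A || q.writes A
  | loop _ _ _ p => p.writes A
  | _ => false

/-- The program contains an output command. -/
def emits : Cmd → Bool
  | emit _ => true
  | seq p q => p.emits || q.emits
  | ite _ _ _ p q => p.emits || q.emits
  | loop _ _ _ p => p.emits
  | _ => false

/-- Two states agree on everything that does not occur on a left-hand side in the program. It
frees the specifications from listing what stays the same. -/
structure Frame (p : Cmd) (s s' : Env) : Prop where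
  var : ∀ a, p.assigns a = false → s'.var a = s.var a
  arr : ∀ A, p.writes A = false → s'.arr A = s.arr A
  out : p.emits = false → s'.out = s.out

theorem Frame.trans {p : Cmd} {s s₁ s₂ : Env} (h : p.Frame s s₁) (h' : p.Frame s₁ s₂) :
    p.Frame s s₂ where
  var a ha := (h'.var a ha).trans (h.var a ha)
  arr A hA := (h'.arr A hA).trans (h.arr A hA)
  out ho := (h'.out ho).trans (h.out ho)

theorem Frame.tick (s : Env) (t : ℕ) : skip.Frame s (s.tick t) :=
  ⟨fun _ _ => rfl, fun _ _ => rfl, fun _ => rfl⟩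

theorem Frame.mono {p q : Cmd} {s s' : Env} {t : ℕ} (h : p.Frame (s.tick t) s')
    (hvar : ∀ a, q.assigns a = false → p.assigns a = false)
    (harr : ∀ A, q.writes A = false → p.writes A = false)
    (hout : q.emits = false → p.emits = false) : q.Frame s s' where
  var a ha := h.var a (hvar a ha)
  arr A hA := h.arr A (harr A hA)
  out ho := h.out (hout ho)

theorem wp_frame {p : Cmd} {Q : Env → Prop} {s : Env} (h : p.wp Γ Q s) :
    p.wp Γ (fun s' => p.Frame s s' ∧ Q s') s := by
  induction p generalizing Q s with
  | set a e =>
    refine ⟨h.1, ⟨fun b hb => ?_, fun _ _ => rfl, fun _ => rfl⟩, h.2⟩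
    exact Function.update_of_ne (Ne.symm (of_decide_eq_false hb)) _ _
  | put A i e =>
    refine ⟨h.1, h.2.1, h.2.2.1, ⟨fun _ _ => rfl, fun B hB => ?_, fun _ => rfl⟩, h.2.2.2⟩
    exact Function.update_of_ne (Ne.symm (of_decide_eq_false hB)) _ _
  | emit e => exact ⟨h.1, ⟨fun _ _ => rfl, fun _ _ => rfl, nofun⟩, h.2⟩
  | skip => exact ⟨⟨fun _ _ => rfl, fun _ _ => rfl, fun _ => rfl⟩, h⟩
  | seq p q ihp ihq =>
    refine wp_mono (fun s₁ h₁ => wp_mono (fun s₂ h₂ => ⟨?_, h₂.2⟩) (ihq h₁.2)) (ihp h)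
    exact .trans (h₁.1.mono (t := 0) (by simp_all [assigns]) (by simp_all [writes])
      (by simp_all [emits])) (h₂.1.mono (t := 0) (by simp_all [assigns]) (by simp_all [writes])
      (by simp_all [emits]))
  | ite c a b p q ihp ihq =>
    refine ⟨h.1, h.2.1, fun hc => ?_, fun hc => ?_⟩
    · refine wp_mono (fun s₁ h₁ => ⟨h₁.1.mono ?_ ?_ ?_, h₁.2⟩) (ihp (h.2.2.1 hc)) <;>
        simp_all [assigns, writes, emits]
    · refine wp_mono (fun s₁ h₁ => ⟨h₁.1.mono ?_ ?_ ?_, h₁.2⟩) (ihq (h.2.2.2 hc)) <;>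
        simp_all [assigns, writes, emits]
  | loop c a b p ih =>
    obtain ⟨I, μ, hI, hstep⟩ := h
    refine ⟨fun s₁ => (loop c a b p).Frame s s₁ ∧ I s₁, μ,
      ⟨⟨fun _ _ => rfl, fun _ _ => rfl, fun _ => rfl⟩, hI⟩, fun s₁ ⟨hf, hI₁⟩ => ?_⟩
    obtain ⟨ha, hb, hbody, hexit⟩ := hstep s₁ hI₁
    refine ⟨ha, hb, fun hc => ?_, fun hc => ⟨⟨hf.var, hf.arr, hf.out⟩, hexit hc⟩⟩
    exact wp_mono (fun s₂ h₂ => ⟨⟨hf.trans (h₂.1.mono (fun _ => id) (fun _ => id) id), h₂.2.1⟩,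
      h₂.2.2⟩) (ih (hbody hc))

theorem wp_conseq {p : Cmd} {Q Q' : Env → Prop} {s : Env} (h : p.wp Γ Q s)
    (hQ : ∀ s', p.Frame s s' → Q s' → Q' s') : p.wp Γ Q' s :=
  wp_mono (fun s' h' => hQ s' h'.1 h'.2) (wp_frame h)

theorem wp_then {p q : Cmd} {Q Q' : Env → Prop} {s : Env} (h : p.wp Γ Q s)
    (hq : ∀ s', p.Frame s s' → Q s' → q.wp Γ Q' s') : (seq p q).wp Γ Q' s :=
  (wp_seq p q _ s).2 (wp_conseq h hq)

theorem wp_for {a b : Expr} {p : Cmd} {Q : Env → Prop} {s : Env} {lo hi : ℕ}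
    (I : ℕ → Env → Prop) (hlo : lo ≤ hi) (h0 : I lo s)
    (htest : ∀ k s', p.Frame s s' → I k s' → k ≤ hi →
      a.Ok Γ s' ∧ b.Ok Γ s' ∧ a.eval Γ s' = k ∧ b.eval Γ s' = hi)
    (hbody : ∀ k s', p.Frame s s' → I k s' → k < hi →
      p.wp Γ (I (k + 1)) (s'.tick (a.cost + b.cost + 1)))
    (hexit : ∀ s', p.Frame s s' → I hi s' → Q (s'.tick (a.cost + b.cost + 1))) :
    (loop .lt a b p).wp Γ Q s := by
  refine loop_wp (fun r s' => ∃ k ≤ hi, r = hi - k ∧ p.Frame s s' ∧ I k s') (k := hi - lo)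
    ⟨lo, hlo, rfl, ⟨fun _ _ => rfl, fun _ _ => rfl, fun _ => rfl⟩, h0⟩ ?_
  rintro _ s₁ ⟨k, hk, rfl, f, hI⟩
  obtain ⟨ha, hb, ea, eb⟩ := htest k s₁ f hI hk
  refine ⟨ha, hb, fun hc => ?_, fun hc => ?_⟩ <;> rw [ea, eb] at hc
  · exact wp_conseq (hbody k s₁ f hI hc) fun s₂ f₂ hs₂ =>
      ⟨_, Nat.sub_lt_sub_left hc k.lt_succ_self, _, hc, rfl,
        f.trans (f₂.mono (fun _ => id) (fun _ => id) id), hs₂⟩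
  · obtain rfl : k = hi := le_antisymm hk (not_lt.1 hc)
    exact hexit s₁ f hI

end Cmd

attribute [simp] NatOp.eval NatOp.Safe Expr.eval Expr.Ok Expr.cost Cmp.Test

end WordRAM

/-! ### Words along the paths of a tree -/

namespace UnrootedTree

variable {n σ : ℕ} (T : UnrootedTree n σ)

/-- The word read along the simple path from `x` to `y`, as a list of natural numbers. -/
noncomputable def natWord (x y : Fin n) : List ℕ :=
  (T.walkWord (T.path x y)).map Fin.val

open Classical in
/-- The label of the edge between two adjacent nodes, as a natural number. -/
noncomputable def natLabel (x y : Fin n) : ℕ :=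
  if h : T.graph.Adj x y then (T.label ⟨s(x, y), h⟩).val else 0

theorem natLabel_of_adj {x y : Fin n} (h : T.graph.Adj x y) :
    T.natLabel x y = (T.label ⟨s(x, y), h⟩).val :=
  dif_pos h

theorem natLabel_comm (x y : Fin n) : T.natLabel x y = T.natLabel y x := by
  by_cases h : T.graph.Adj x y
  · rw [natLabel_of_adj T h, natLabel_of_adj T h.symm]
    congr 3
    exact Sym2.eq_swap
  · rw [natLabel, natLabel, dif_neg h, dif_neg (fun h' => h h'.symm)]

/-- The simple path from `x` to `z` consists of the one to `y` and an edge from `y` to `z`. -/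
def Extends (x y z : Fin n) : Prop :=
  ∃ h : T.graph.Adj y z, T.path x z = (T.path x y).concat h

/-- The first node after `x` on the simple path from `x` to `y` is `f`. -/
def FirstStep (x y f : Fin n) : Prop :=
  ∃ h : T.graph.Adj x f, T.path x y = .cons h (T.path f y)

theorem path_self (x : Fin n) : T.path x x = .nil :=
  (T.eq_path SimpleGraph.Walk.IsPath.nil).symm

theorem walkWord_append {x y z : Fin n} (p : T.graph.Walk x y) (q : T.graph.Walk y z) :
    T.walkWord (p.append q) = T.walkWord p ++ T.walkWord q := by
  induction p with
  | nil => rfl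
  | cons h p ih => simp [walkWord, ih]

theorem natWord_self (x : Fin n) : T.natWord x x = [] := by
  simp [natWord, path_self, walkWord]

theorem path_of_adj {x y : Fin n} (h : T.graph.Adj x y) :
    T.path x y = .cons h .nil :=
  (T.eq_path (by simpa using h.ne)).symm

theorem extends_or_extends (x : Fin n) {y z : Fin n} (h : T.graph.Adj y z) :
    T.Extends x y z ∨ T.Extends x z y := by
  by_cases hz : z ∈ (T.path x y).support
  · right
    refine ⟨h.symm, ?_⟩
    have h1 := T.eq_path ((T.path_isPath x y).takeUntil hz)
    have h2 := T.eq_path ((T.path_isPath x y).dropUntil hz)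
    rw [T.path_of_adj h.symm] at h2
    rw [← h1, SimpleGraph.Walk.concat_eq_append, ← h2]
    exact ((T.path x y).take_spec hz).symm
  · left
    exact ⟨h, (T.eq_path ((T.path_isPath x y).concat hz h)).symm⟩

variable {T}

theorem Extends.natWord {x y z : Fin n} (h : T.Extends x y z) :
    T.natWord x z = T.natWord x y ++ [T.natLabel y z] := by
  obtain ⟨h, e⟩ := h
  rw [UnrootedTree.natWord, e, SimpleGraph.Walk.concat_eq_append, walkWord_append,
    natLabel_of_adj T h]
  simp [walkWord, UnrootedTree.natWord]

theorem FirstStep.natWord {x y f : Fin n} (h : T.FirstStep x y f) :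
    T.natWord x y = T.natLabel x f :: T.natWord f y := by
  obtain ⟨h, e⟩ := h
  rw [UnrootedTree.natWord, e, walkWord, natLabel_of_adj T h]
  rfl

theorem FirstStep.of_adj {x y : Fin n} (h : T.graph.Adj x y) : T.FirstStep x y y :=
  ⟨h, by rw [T.path_of_adj h, path_self]⟩

theorem FirstStep.extend {x y f z : Fin n} (hf : T.FirstStep x y f) (h : T.Extends x y z) :
    T.FirstStep x z f := by
  obtain ⟨hxf, e⟩ := hf
  obtain ⟨hyz, e'⟩ := h
  refine ⟨hxf, ?_⟩
  have hp := T.path_isPath x z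
  rw [e', e, SimpleGraph.Walk.concat_cons] at hp
  rw [e', e, SimpleGraph.Walk.concat_cons, T.eq_path hp.of_cons]

theorem Extends.left_unique {x y y' z : Fin n} (h : T.Extends x y z) (h' : T.Extends x y' z) :
    y = y' := by
  obtain ⟨_, e⟩ := h
  obtain ⟨_, e'⟩ := h'
  simpa using congrArg SimpleGraph.Walk.penultimate (e.symm.trans e')

theorem Extends.ne {x y z : Fin n} (h : T.Extends x y z) : x ≠ z := by
  rintro rfl
  obtain ⟨h, e⟩ := h
  have hlength := congrArg SimpleGraph.Walk.length e
  simp [path_self] at hlength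

variable (T)

theorem mem_language_iff {z : List (Fin σ)} :
    z ∈ T.language ↔ ∃ x y, T.walkWord (T.path x y) = z := by
  constructor
  · rintro ⟨x, y, p, hp, e⟩
    exact ⟨x, y, by rw [← T.eq_path hp, e]⟩
  · rintro ⟨x, y, e⟩
    exact ⟨x, y, T.path x y, T.path_isPath x y, e⟩

theorem of_adj_closed {S : Fin n → Prop} (x : Fin n) (hx : S x)
    (h : ∀ y z, T.graph.Adj y z → S y → S z) (y : Fin n) : S y := by
  have key : ∀ {a b : Fin n}, T.graph.Walk a b → S a → S b := by
    intro a b p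
    induction p with
    | nil => exact id
    | cons hadj _ ih => exact fun ha => ih (h _ _ hadj ha)
  exact key (T.path x y) hx

end UnrootedTree

/-! ### Linked lists -/

/-- The number of a pair of nodes, under which data about it are stored in arrays. -/
def pairIdx {n : ℕ} (p : Fin n × Fin n) : ℕ := finProdFinEquiv p

section pairIdx

variable {n : ℕ}

theorem pairIdx_mk (x y : Fin n) : pairIdx (x, y) = y + n * x := rfl

theorem pairIdx_injective : Function.Injective (pairIdx (n := n)) :=
  Fin.val_injective.comp finProdFinEquiv.injective

theorem pairIdx_lt (p : Fin n × Fin n) : pairIdx p < n * n :=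
  (finProdFinEquiv p).isLt

theorem pairIdx_div (p : Fin n × Fin n) : pairIdx p / n = p.1 :=
  congrArg (fun q : Fin n × Fin n => q.1.val) (finProdFinEquiv.symm_apply_apply p)

theorem pairIdx_mod (p : Fin n × Fin n) : pairIdx p % n = p.2 :=
  congrArg (fun q : Fin n × Fin n => q.2.val) (finProdFinEquiv.symm_apply_apply p)

end pairIdx

/-- The linked list with successor pointers `next` that starts with the pointer `h` has the cells
`l`. A pointer to the cell `a` is stored as `a + 1`, and `0` is the end of the list. -/
def IsLinked (next : ℕ → ℕ) : ℕ → List ℕ → Prop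
  | h, [] => h = 0
  | h, a :: l => h = a + 1 ∧ IsLinked next (next a) l

theorem IsLinked.congr {next next' : ℕ → ℕ} {h : ℕ} {l : List ℕ} (hl : IsLinked next h l)
    (hnext : ∀ a ∈ l, next' a = next a) : IsLinked next' h l := by
  induction l generalizing h with
  | nil => exact hl
  | cons a l ih =>
    rw [List.forall_mem_cons] at hnext
    exact ⟨hl.1, hnext.1.symm ▸ ih hl.2 hnext.2⟩

theorem IsLinked.update {next : ℕ → ℕ} {a v h : ℕ} {l : List ℕ} (hl : IsLinked next h l)
    (ha : a ∉ l) : IsLinked (Function.update next a v) h l :=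
  hl.congr fun _ hb => Function.update_of_ne (ne_of_mem_of_not_mem hb ha) _ _

/-- The linked lists that start at the pointers `head c` partition the cells by their owners. The
owner `c` of a cell is stored as `c + 1`, and `0` means that the cell is in no list. -/
def Buckets (owner next head : ℕ → ℕ) : Prop :=
  ∀ c, ∃ l : List ℕ, l.Nodup ∧ IsLinked next (head c) l ∧ ∀ a, a ∈ l ↔ owner a = c + 1

theorem Buckets.empty (next : ℕ → ℕ) : Buckets 0 next 0 :=
  fun _ => ⟨[], List.nodup_nil, rfl, by simp⟩

theorem Buckets.push {owner next head : ℕ → ℕ} (h : Buckets owner next head) {a : ℕ}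
    (ha : owner a = 0) (c : ℕ) :
    Buckets (Function.update owner a (c + 1)) (Function.update next a (head c))
      (Function.update head c (a + 1)) := by
  intro d
  obtain ⟨l, hnodup, hlinked, hmem⟩ := h d
  have hal : a ∉ l := by simp [hmem, ha]
  by_cases hdc : d = c
  · subst hdc
    refine ⟨a :: l, hnodup.cons hal, ⟨by simp, ?_⟩, fun b => ?_⟩
    · simpa using hlinked.update hal
    · by_cases hb : b = a <;> simp [hb, hmem]
  · refine ⟨l, hnodup, ?_, fun b => ?_⟩
    · simpa [hdc] using hlinked.update hal
    · by_cases hb : b = a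
      · simp [hb, hal, Ne.symm hdc]
      · simp [hb, hmem]

theorem Buckets.owner_head {owner next head : ℕ → ℕ} (h : Buckets owner next head) {c a : ℕ}
    (ha : owner a = c + 1) : head c ≠ 0 ∧ owner (head c - 1) = c + 1 := by
  obtain ⟨l, -, hlinked, hmem⟩ := h c
  rcases l with _ | ⟨b, l⟩
  · simp [← hmem] at ha
  · simpa [hlinked.1] using (hmem b).1 (by simp)

namespace WordRAM

theorem Cmd.wp_linked {Γ : Ctx} {q : Var} {p : Cmd} {Q : Env → Prop} {s : Env} {A : Arr}
    {l : List ℕ} (I : List ℕ → Env → Prop) (hΓ : 0 < Γ.bound) (h0 : I l s)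
    (hlinked : ∀ l s, I l s → IsLinked (s.arr A) (s.var q) l)
    (hbody : ∀ a l s, I (a :: l) s → p.wp Γ (I l) (s.tick 3)) (hexit : ∀ s, I [] s → Q (s.tick 3)) :
    (loop .ne (.var q) (.lit 0) p).wp Γ Q s := by
  refine loop_wp (fun r s => ∃ l : List ℕ, r = l.length ∧ I l s) ⟨l, rfl, h0⟩ ?_
  rintro _ s ⟨l, rfl, hI⟩
  have hl := hlinked l s hI
  refine ⟨trivial, hΓ, fun hc => ?_, fun hc => ?_⟩ <;> rcases l with _ | ⟨a, l⟩
  · exact absurd hl hc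
  · exact wp_mono (fun s' hs' => ⟨_, Nat.lt_succ_self _, l, rfl, hs'⟩) (hbody a l s hI)
  · exact hexit s hI
  · simp [hl.1] at hc

end WordRAM

/-! ### Tries of words -/

/-- `b` is the smallest number with its letter, among the numbers below `N`. -/
structure IsRank (lam : ℕ → ℕ) (N b : ℕ) : Prop where
  lt : b < N
  ne : ∀ j < b, lam j ≠ lam b

theorem IsRank.eq {lam : ℕ → ℕ} {N b c : ℕ} (h : IsRank lam N b) (h' : IsRank lam N c)
    (e : lam b = lam c) : b = c := by
  rcases lt_trichotomy b c with hlt | rfl | hlt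
  · exact absurd e (h'.ne b hlt)
  · rfl
  · exact absurd e.symm (h.ne c hlt)

/-- The numbers below `start v` are the nodes of a trie in breadth-first order; the node `k` stands
for the word `W k`. The children of each node `c < v` are the nodes from `start c` to
`start (c + 1)`, and `letter` gives the ranks of their last letters. -/
structure IsTrie (lam : ℕ → ℕ) (N : ℕ) (start letter : ℕ → ℕ) (v : ℕ) (W : ℕ → List ℕ) :
    Prop where
  start_zero : start 0 = 1
  start_le : ∀ c < v, start c ≤ start (c + 1)
  lt_start : ∀ c < v, c < start c
  root : W 0 = []
  child : ∀ c < v, ∀ k, start c ≤ k → k < start (c + 1) →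
    W k = W c ++ [lam (letter k)] ∧ IsRank lam N (letter k)
  injOn : Set.InjOn W (Set.Iio (start v))

namespace IsTrie

variable {lam : ℕ → ℕ} {N : ℕ} {start letter : ℕ → ℕ} {v : ℕ} {W : ℕ → List ℕ}

theorem singleton (hstart : start 0 = 1) (hW : W 0 = []) : IsTrie lam N start letter 0 W where
  start_zero := hstart
  start_le := nofun
  lt_start := nofun
  root := hW
  child := nofun
  injOn k hk l hl _ := by
    simp only [hstart, Set.mem_Iio] at hk hl
    omega

theorem start_mono (h : IsTrie lam N start letter v W) {c d : ℕ} (hcd : c ≤ d) (hd : d ≤ v) :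
    start c ≤ start d := by
  induction d, hcd using Nat.le_induction with
  | base => exact le_rfl
  | succ d _ ih => exact (ih (by omega)).trans (h.start_le d hd)

theorem le_start (h : IsTrie lam N start letter v W) : v ≤ start v := by
  obtain _ | v := v
  · exact Nat.zero_le _
  · exact (h.lt_start v v.lt_succ_self).trans_le (h.start_le v v.lt_succ_self)

theorem exists_parent (h : IsTrie lam N start letter v W) {k : ℕ} (hk0 : k ≠ 0)
    (hk : k < start v) : ∃ c < v, start c ≤ k ∧ k < start (c + 1) := by
  have hex : ∃ d, k < start d := ⟨v, hk⟩
  obtain ⟨c, hc⟩ := Nat.exists_eq_succ_of_ne_zero (n := Nat.find hex) fun h0 => by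
    have := Nat.find_spec hex
    rw [h0, h.start_zero] at this
    omega
  have hle : Nat.find hex ≤ v := Nat.find_min' hex hk
  refine ⟨c, by omega, not_lt.1 (Nat.find_min hex (by omega)), ?_⟩
  rw [← Nat.succ_eq_add_one, ← hc]
  exact Nat.find_spec hex

theorem letter_injOn (h : IsTrie lam N start letter v W) {c : ℕ} (hc : c < v) :
    Set.InjOn letter (Set.Ico (start c) (start (c + 1))) := by
  intro k hk l hl e
  have hle := h.start_mono (Nat.succ_le_of_lt hc) le_rfl
  refine h.injOn (hk.2.trans_le hle) (hl.2.trans_le hle) ?_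
  rw [(h.child c hc k hk.1 hk.2).1, (h.child c hc l hl.1 hl.2).1, e]

theorem extend (h : IsTrie lam N start letter v W) (hv : v < start v) {start' letter' : ℕ → ℕ}
    {W' : ℕ → List ℕ} (hstart : ∀ c ≤ v, start' c = start c) (hle : start v ≤ start' (v + 1))
    (hagree : ∀ k < start v, letter' k = letter k ∧ W' k = W k)
    (hchild : ∀ k, start v ≤ k → k < start' (v + 1) →
      W' k = W v ++ [lam (letter' k)] ∧ IsRank lam N (letter' k))
    (hinj : Set.InjOn W' (Set.Iio (start' (v + 1)))) : IsTrie lam N start' letter' (v + 1) W' where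
  start_zero := by rw [hstart 0 v.zero_le, h.start_zero]
  start_le c hc := by
    rw [hstart c (by omega)]
    obtain hcv | rfl := Nat.lt_succ_iff_lt_or_eq.1 hc
    · rw [hstart (c + 1) hcv]
      exact h.start_le c hcv
    · exact hle
  lt_start c hc := by
    rw [hstart c (by omega)]
    obtain hcv | rfl := Nat.lt_succ_iff_lt_or_eq.1 hc
    exacts [h.lt_start c hcv, hv]
  root := by rw [(hagree 0 (by omega)).2, h.root]
  child c hc k hk hk' := by
    rw [hstart c (by omega)] at hk
    obtain hcv | rfl := Nat.lt_succ_iff_lt_or_eq.1 hc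
    · rw [hstart (c + 1) hcv] at hk'
      have hlt : start (c + 1) ≤ start v := h.start_mono hcv le_rfl
      rw [(hagree k (by omega)).1, (hagree k (by omega)).2, (hagree c (by omega)).2]
      exact h.child c hcv k hk hk'
    · rw [(hagree c hv).2]
      exact hchild k hk hk'
  injOn := hinj

theorem expand (h : IsTrie lam N start letter v W) (hv : v < start v) :
    IsTrie lam N (Function.update start (v + 1) (start v)) letter (v + 1) W := by
  refine h.extend hv (fun c hc => Function.update_of_ne (by omega) _ _) (by simp)
    (fun _ _ => ⟨rfl, rfl⟩) (fun k hk hk' => ?_) ?_ <;> rw [Function.update_self] at *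
  · omega
  · exact h.injOn

theorem of_succ (h : IsTrie lam N start letter (v + 1) W) : IsTrie lam N start letter v W where
  start_zero := h.start_zero
  start_le c hc := h.start_le c (hc.trans v.lt_succ_self)
  lt_start c hc := h.lt_start c (hc.trans v.lt_succ_self)
  root := h.root
  child c hc := h.child c (hc.trans v.lt_succ_self)
  injOn := h.injOn.mono (Set.Iio_subset_Iio (h.start_le v v.lt_succ_self))

theorem ne_append_of_fresh (h : IsTrie lam N start letter (v + 1) W) {b : ℕ} (hb : IsRank lam N b)
    (hfresh : ∀ k, start v ≤ k → k < start (v + 1) → letter k ≠ b) {k : ℕ}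
    (hk : k < start (v + 1)) : W k ≠ W v ++ [lam b] := by
  intro e
  obtain rfl | hk0 := eq_or_ne k 0
  · simp [h.root] at e
  obtain ⟨c, hc, hck, hkc⟩ := h.exists_parent hk0 hk
  obtain ⟨hword, hrank⟩ := h.child c hc k hck hkc
  obtain ⟨hWc, hlam⟩ := List.append_inj' (hword.symm.trans e) rfl
  have hvs : ∀ d < v + 1, d < start (v + 1) := fun d hd =>
    (h.lt_start d hd).trans_le (h.start_mono hd.le le_rfl)
  obtain rfl := h.injOn (hvs c hc) (hvs v v.lt_succ_self) hWc
  exact hfresh k hck hkc (hrank.eq hb (by simpa using hlam))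

theorem addChild (h : IsTrie lam N start letter (v + 1) W) {b : ℕ} (hb : IsRank lam N b)
    (hfresh : ∀ k, start v ≤ k → k < start (v + 1) → letter k ≠ b) :
    IsTrie lam N (Function.update start (v + 1) (start (v + 1) + 1))
      (Function.update letter (start (v + 1)) b) (v + 1)
      (Function.update W (start (v + 1)) (W v ++ [lam b])) := by
  have hle := h.start_le v v.lt_succ_self
  refine h.of_succ.extend (h.lt_start v v.lt_succ_self)
    (fun c hc => Function.update_of_ne (by omega) _ _) (by rw [Function.update_self]; omega)
    (fun k hk => ?_) (fun k hk hk' => ?_) ?_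
  · rw [Function.update_of_ne (by omega), Function.update_of_ne (by omega)]
    exact ⟨rfl, rfl⟩
  · rw [Function.update_self] at hk'
    obtain hkm | rfl := Nat.lt_succ_iff_lt_or_eq.1 hk'
    · rw [Function.update_of_ne hkm.ne, Function.update_of_ne hkm.ne]
      exact h.child v v.lt_succ_self k hk hkm
    · simpa using hb
  · have hcongr : Set.EqOn (Function.update W (start (v + 1)) (W v ++ [lam b])) W
        (Set.Iio (start (v + 1))) := fun k hk => Function.update_of_ne (ne_of_lt hk) _ _
    rw [Function.update_self, ← Order.succ_eq_add_one (start (v + 1)), Order.Iio_succ_eq_insert,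
      Set.injOn_insert (by simp), hcongr.injOn_iff, hcongr.image_eq, Function.update_self]
    exact ⟨h.injOn, fun ⟨k, hk, e⟩ => h.ne_append_of_fresh hb hfresh hk e⟩

end IsTrie

/-- For the children of the trie node `v`, `child` is inverse to `letter`. Entries below `start v`
are left over from earlier nodes and count as undefined, so the table needs no initialization. -/
structure IsChildTable (start letter child : ℕ → ℕ) (v : ℕ) : Prop where
  letter_child : ∀ b, start v ≤ child b → letter (child b) = b
  child_letter : ∀ k, start v ≤ k → k < start (v + 1) → child (letter k) = k

namespace IsChildTable

variable {start letter child : ℕ → ℕ} {v : ℕ}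

theorem expand (h : ∀ b, child b < start v) :
    IsChildTable (Function.update start (v + 1) (start v)) letter child v where
  letter_child b hb := by
    rw [Function.update_of_ne (by omega)] at hb
    exact absurd (h b) (not_lt.2 hb)
  child_letter k hk hk' := by
    rw [Function.update_of_ne (by omega)] at hk
    rw [Function.update_self] at hk'
    omega

theorem addChild (h : IsChildTable start letter child v) (hlt : ∀ b, child b < start (v + 1))
    {b : ℕ} (hb : child b < start v) :
    IsChildTable (Function.update start (v + 1) (start (v + 1) + 1))
      (Function.update letter (start (v + 1)) b) (Function.update child b (start (v + 1))) v := by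
  have hstart : Function.update start (v + 1) (start (v + 1) + 1) v = start v :=
    Function.update_of_ne (by omega) _ _
  refine ⟨fun a ha => ?_, fun k hk hk' => ?_⟩
  · rw [hstart] at ha
    obtain rfl | hab := eq_or_ne a b
    · rw [Function.update_self, Function.update_self]
    · rw [Function.update_of_ne hab] at ha ⊢
      rw [Function.update_of_ne (hlt a).ne, h.letter_child a ha]
  · rw [hstart] at hk
    rw [Function.update_self] at hk'
    obtain hkm | rfl := Nat.lt_succ_iff_lt_or_eq.1 hk'
    · have hchild := h.child_letter k hk hkm
      rw [Function.update_of_ne hkm.ne, Function.update_of_ne (by rintro rfl; omega), hchild]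
    · rw [Function.update_self, Function.update_self]

end IsChildTable

/-! ### Adjacency lists -/

/-- The cells below `k` form adjacency lists of a tree, one list for each node, with at least the
pairs `E` of adjacent nodes. A cell of the list of `y` has a neighbour of `y` and the rank of the
letter between the two. -/
structure AdjLists {n σ : ℕ} (T : UnrootedTree n σ) (lam : ℕ → ℕ) (E : Set (Fin n × Fin n)) (k : ℕ)
    (owner head next node rank : ℕ → ℕ) : Prop where
  buckets : Buckets owner next head
  lt : ∀ d, owner d ≠ 0 → d < k
  cell : ∀ d (y : Fin n), owner d = y + 1 → ∃ z : Fin n, node d = z ∧ T.graph.Adj y z ∧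
    lam (rank d) = T.natLabel y z ∧ IsRank lam (n - 1) (rank d)
  cover : ∀ y z, (y, z) ∈ E → ∃ d, owner d = y + 1 ∧ node d = z

namespace AdjLists

variable {n σ : ℕ} {T : UnrootedTree n σ} {lam : ℕ → ℕ} {E E' : Set (Fin n × Fin n)} {k : ℕ}
  {owner head next node rank : ℕ → ℕ}

theorem empty (next node rank : ℕ → ℕ) : AdjLists T lam ∅ 0 0 0 next node rank where
  buckets := .empty next
  lt _ h := absurd rfl h
  cell _ _ h := absurd h (Nat.succ_ne_zero _).symm
  cover _ _ h := absurd h (Set.notMem_empty _)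

theorem mono (h : AdjLists T lam E k owner head next node rank) (hE : E' ⊆ E) :
    AdjLists T lam E' k owner head next node rank where
  buckets := h.buckets
  lt := h.lt
  cell := h.cell
  cover y z hyz := h.cover y z (hE hyz)

theorem push (h : AdjLists T lam E k owner head next node rank) {y z : Fin n} {b : ℕ}
    (hyz : T.graph.Adj y z) (hlam : lam b = T.natLabel y z) (hb : IsRank lam (n - 1) b) :
    AdjLists T lam (insert (y, z) E) (k + 1) (Function.update owner k (y + 1))
      (Function.update head y (k + 1)) (Function.update next k (head y))
      (Function.update node k z) (Function.update rank k b) := by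
  have hk : owner k = 0 := not_not.1 fun hk => (h.lt k hk).false
  have hne : ∀ {d}, owner d ≠ 0 → d ≠ k := fun hd => (h.lt _ hd).ne
  refine ⟨h.buckets.push hk y, fun d hd => ?_, fun d y' hd => ?_, fun y' z' hE => ?_⟩
  · obtain rfl | hdk := eq_or_ne d k
    · exact d.lt_succ_self
    · rw [Function.update_of_ne hdk] at hd
      exact (h.lt d hd).trans k.lt_succ_self
  · obtain rfl | hdk := eq_or_ne d k
    · obtain rfl : y = y' := by simpa [Fin.ext_iff] using hd
      exact ⟨z, by simp, hyz, by simpa using hlam, by simpa using hb⟩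
    · rw [Function.update_of_ne hdk] at hd ⊢
      rw [Function.update_of_ne hdk]
      exact h.cell d y' hd
  · obtain e | hE := hE
    · obtain ⟨rfl, rfl⟩ := Prod.mk.inj e
      exact ⟨k, by simp, by simp⟩
    · obtain ⟨d, hd, hnode⟩ := h.cover y' z' hE
      have hdk := hne (d := d) (by omega)
      exact ⟨d, by rw [Function.update_of_ne hdk, hd], by rw [Function.update_of_ne hdk, hnode]⟩

end AdjLists

namespace WordRAM

infixr:60 " ;; " => Cmd.seq

/-- Insert the cell `a` at the front of the list `c`, where the array `B` has the first cells of the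
lists and `A` the successors of the cells. -/
def pushCell (A B : Arr) (a c : Var) : Cmd :=
  .put A (.var a) (.get B (.var c)) ;;
  .put B (.var c) (.bin .add (.var a) (.lit 1))

/-- The letter of the edge whose number is given by an expression. -/
def edgeLetter (e : Expr) : Expr :=
  .inp (.bin .add (.bin .mul (.lit 3) e) (.lit 3))

/-- Find the first edge with the same letter as the current edge. -/
def findRank : Cmd :=
  .set .rank (.lit 0) ;;
  .loop .ne (edgeLetter (.var .rank)) (edgeLetter (.var .edge))
    (.set .rank (.bin .add (.var .rank) (.lit 1)))

/-- Insert one of the two darts of the current edge into the adjacency lists, namely the one with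
number `r` from the end at position `a` to the end at position `b` of the edge in the input. -/
def insertDart (r a b : ℕ) : Cmd :=
  .set .dart (.bin .add (.bin .mul (.lit 2) (.var .edge)) (.lit r)) ;;
  .set .src (.inp (.bin .add (.bin .mul (.lit 3) (.var .edge)) (.lit a))) ;;
  .set .nbr (.inp (.bin .add (.bin .mul (.lit 3) (.var .edge)) (.lit b))) ;;
  pushCell .adjNext .adjHead .dart .src ;;
  .put .adjNode (.var .dart) (.var .nbr) ;;
  .put .adjRank (.var .dart) (.var .rank)

/-- Insert the current edge into the adjacency lists. -/
def insertEdge : Cmd :=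
  findRank ;;
  insertDart 0 1 2 ;;
  insertDart 1 2 1 ;;
  .set .edge (.bin .add (.var .edge) (.lit 1))

/-- Build the adjacency lists. -/
def buildAdjacency : Cmd :=
  .set .nodes (.inp (.lit 0)) ;;
  .set .edge (.lit 0) ;;
  .loop .lt (.var .edge) (.bin .sub (.var .nodes) (.lit 1)) insertEdge

/-- The letter of the edge with number `b`. -/
def Ctx.lam (Γ : Ctx) (b : ℕ) : ℕ := Γ.inp (3 * b + 3)

/-- The input and the sizes that belong to a tree with edge list `es`. -/
structure Ctx.Encodes {n σ : ℕ} (Γ : Ctx) (T : UnrootedTree n σ) (es : List T.graph.Dart) :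
    Prop where
  length : es.length + 1 = n
  nodes : Γ.inp 0 = n
  fst : ∀ (i : ℕ) (h : i < es.length), Γ.inp (3 * i + 1) = es[i].fst
  snd : ∀ (i : ℕ) (h : i < es.length), Γ.inp (3 * i + 2) = es[i].snd
  lam : ∀ (i : ℕ) (h : i < es.length), Γ.lam i = T.natLabel es[i].fst es[i].snd
  base : Γ.base = 3 * n
  len : Γ.len = n * n + 2 * n + 1
  bound : Γ.bound = n * n + 3 * n + 20

/-- The machine holds the number of nodes and adjacency lists of a tree. -/
structure HasAdj {n σ : ℕ} (Γ : Ctx) (T : UnrootedTree n σ) (E : Set (Fin n × Fin n)) (k : ℕ)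
    (owner : ℕ → ℕ) (s : Env) : Prop where
  nodes : s.var .nodes = n
  lists : AdjLists T Γ.lam E k owner (s.arr .adjHead) (s.arr .adjNext) (s.arr .adjNode)
    (s.arr .adjRank)

section

variable {n σ : ℕ} {Γ : Ctx} {T : UnrootedTree n σ} {es : List T.graph.Dart} {s s' : Env}
  {E : Set (Fin n × Fin n)} {k : ℕ} {owner : ℕ → ℕ}

theorem HasAdj.of_frame (h : HasAdj Γ T E k owner s) {p : Cmd} (hp : p.Frame s s')
    (hvar : p.assigns .nodes = false := by decide)
    (harr : (∀ A ∈ [Arr.adjHead, .adjNext, .adjNode, .adjRank], p.writes A = false) := by decide) :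
    HasAdj Γ T E k owner s' where
  nodes := (hp.var _ hvar).trans h.nodes
  lists := by
    rw [hp.arr _ (harr .adjHead (by simp)), hp.arr _ (harr .adjNext (by simp)),
      hp.arr _ (harr .adjNode (by simp)), hp.arr _ (harr .adjRank (by simp))]
    exact h.lists

theorem findRank_wp (hΓ : Γ.Encodes T es) {i : ℕ} (hi : i < es.length) (hs : s.var .edge = i) :
    findRank.wp Γ (fun s' => IsRank Γ.lam (n - 1) (s'.var .rank) ∧
      Γ.lam (s'.var .rank) = Γ.lam i ∧ s'.time ≤ s.time + 17 * n + 20) s := by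
  have hlength := hΓ.length
  have hbase := hΓ.base
  have hb := hΓ.bound
  simp only [findRank, Cmd.wp_seq, Cmd.wp_set]
  refine ⟨by simp [hb], Cmd.loop_wp (fun r s' => ∃ b ≤ i, r = i - b ∧ s'.var .rank = b ∧
    s'.var .edge = i ∧ (∀ j < b, Γ.lam j ≠ Γ.lam i) ∧ s'.time = s.time + 2 + 17 * b)
    (k := i) ⟨0, by simp [hs]⟩ ?_⟩
  rintro _ s' ⟨b, hbi, rfl, hrank, hedge, hne, ht⟩
  refine ⟨?_, ?_, fun hc => ?_, fun hc => ?_⟩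
  · simp [edgeLetter, hrank]
    omega
  · simp [edgeLetter, hedge]
    omega
  · replace hc : Γ.lam b ≠ Γ.lam i := by simpa [edgeLetter, Ctx.lam, hrank, hedge] using hc
    have hlt : b < i := hbi.lt_of_ne (by rintro rfl; exact hc rfl)
    simp only [Cmd.wp_set]
    refine ⟨by simp [hrank]; omega, i - (b + 1), by omega, b + 1, hlt, rfl, by simp [hrank],
      by simp [hedge], fun j hj => ?_, by simp [ht, edgeLetter]; omega⟩
    obtain hj | rfl := Nat.lt_succ_iff_lt_or_eq.1 hj
    exacts [hne j hj, hc]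
  · replace hc : Γ.lam b = Γ.lam i := by simpa [edgeLetter, Ctx.lam, hrank, hedge] using hc
    simp only [Env.tick_var, hrank, hc, Env.tick_time, ht, edgeLetter, Expr.cost]
    exact ⟨⟨by omega, by rwa [hc]⟩, trivial, by omega⟩

theorem insertDart_wp (hΓ : Γ.Encodes T es) {i r a b : ℕ} {y z : Fin n}
    (h : HasAdj Γ T E (2 * i + r) owner s) (hi : i < es.length) (hr : r < 2) (ha : a < 3)
    (hb : b < 3) (hedge : s.var .edge = i) (hy : Γ.inp (3 * i + a) = y)
    (hz : Γ.inp (3 * i + b) = z) (hyz : T.graph.Adj y z)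
    (hlam : Γ.lam (s.var .rank) = T.natLabel y z) (hrank : IsRank Γ.lam (n - 1) (s.var .rank)) :
    (insertDart r a b).wp Γ (fun s' => (∃ owner', HasAdj Γ T (insert (y, z) E) (2 * i + r + 1)
      owner' s') ∧ s'.time = s.time + 60) s := by
  have hlength := hΓ.length
  have hbase := hΓ.base
  have hlen := hΓ.len
  have hbound := hΓ.bound
  simp only [insertDart, pushCell, Cmd.wp_seq, Cmd.wp_set, Cmd.wp_put, Expr.Ok, NatOp.Safe,
    Expr.eval, hedge, true_and, NatOp.eval, Expr.cost, Nat.reduceAdd, Env.tick_var, Env.set_var,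
    ne_eq, reduceCtorEq, not_false_eq_true, Function.update_of_ne, hy, hz, Function.update_self,
    Env.tick_arr, Env.set_arr, Env.put_var, Env.tick_time, Env.put_time, Env.set_time, and_true,
    and_self_left]
  exact ⟨by omega, by omega, by omega, by omega, by omega, by omega, by omega,
    Function.update owner (2 * i + r) (y + 1), by simpa using h.nodes,
    by simpa using h.lists.push hyz hlam hrank⟩

/-- The pairs of the ends of the first `i` edges of a list, in both orders. -/
def edgePairs (es : List T.graph.Dart) (i : ℕ) : Set (Fin n × Fin n) :=
  {p | ∃ (j : ℕ) (h : j < es.length), j < i ∧ (p = es[j].toProd ∨ p = es[j].toProd.swap)}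

theorem edgePairs_zero (es : List T.graph.Dart) : edgePairs es 0 = ∅ := by
  simp [edgePairs]

theorem edgePairs_succ_subset {i : ℕ} (hi : i < es.length) :
    edgePairs es (i + 1) ⊆
      insert (es[i].snd, es[i].fst) (insert (es[i].fst, es[i].snd) (edgePairs es i)) := by
  rintro p ⟨j, hj, hji, hp⟩
  obtain hji | rfl := Nat.lt_succ_iff_lt_or_eq.1 hji
  exacts [.inr (.inr ⟨j, hj, hji, hp⟩), hp.elim (fun e => .inr (.inl e)) .inl]

theorem mem_edgePairs (hes : T.IsEdgeList es) {y z : Fin n} (h : T.graph.Adj y z) :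
    (y, z) ∈ edgePairs es es.length := by
  obtain ⟨d, hd, e⟩ := List.mem_map.1 (hes.2 s(y, z) h)
  obtain ⟨j, hj, rfl⟩ := List.mem_iff_getElem.1 hd
  exact ⟨j, hj, hj, (SimpleGraph.dart_edge_eq_mk'_iff.1 e).imp Eq.symm (fun e => by simp [e])⟩

theorem insertEdge_wp (hΓ : Γ.Encodes T es) {i : ℕ} (hi : i < es.length)
    (h : HasAdj Γ T (edgePairs es i) (2 * i) owner s) (hedge : s.var .edge = i) :
    insertEdge.wp Γ (fun s' =>
      (∃ owner', HasAdj Γ T (edgePairs es (i + 1)) (2 * (i + 1)) owner' s') ∧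
      s'.var .edge = i + 1 ∧ s'.time ≤ s.time + 17 * n + 144) s := by
  have hlength := hΓ.length
  have hbound := hΓ.bound
  have hlam := hΓ.lam i hi
  have hadj := es[i].adj
  refine Cmd.wp_then (findRank_wp hΓ hi hedge) fun s₁ f₁ ⟨hrank₁, hlam₁, _⟩ => ?_
  have hedge₁ : s₁.var .edge = i := (f₁.var _ rfl).trans hedge
  refine Cmd.wp_then (insertDart_wp hΓ (r := 0) (h.of_frame f₁) hi two_pos (by norm_num)
    (by norm_num) hedge₁ (hΓ.fst i hi) (hΓ.snd i hi) hadj (hlam₁.trans hlam) hrank₁)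
    fun s₂ f₂ ⟨⟨owner₂, h₂⟩, _⟩ => ?_
  have hrank₂ : s₂.var .rank = s₁.var .rank := f₂.var _ rfl
  have hedge₂ : s₂.var .edge = i := (f₂.var _ rfl).trans hedge₁
  refine Cmd.wp_then (insertDart_wp hΓ (r := 1) h₂ hi one_lt_two (by norm_num) (by norm_num)
    hedge₂ (hΓ.snd i hi) (hΓ.fst i hi) hadj.symm
    (by rw [hrank₂, hlam₁, hlam, T.natLabel_comm]) (by rwa [hrank₂]))
    fun s₃ f₃ ⟨⟨owner₃, h₃⟩, _⟩ => ?_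
  have hedge₃ : s₃.var .edge = i := (f₃.var _ rfl).trans hedge₂
  refine ⟨by simp [hedge₃]; omega, ⟨owner₃, ⟨by simpa using h₃.nodes, ?_⟩⟩, by simp [hedge₃],
    by simp; omega⟩
  exact h₃.lists.mono (edgePairs_succ_subset hi)

theorem buildAdjacency_wp (hΓ : Γ.Encodes T es) (hes : T.IsEdgeList es)
    (hhead : s.arr .adjHead = 0) :
    buildAdjacency.wp Γ (fun s' =>
      (∃ owner, HasAdj Γ T {p | T.graph.Adj p.1 p.2} (2 * n) owner s') ∧
      s'.time ≤ s.time + n * (17 * n + 149) + 10) s := by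
  have hn := hΓ.length
  have hbase := hΓ.base
  have hb := hΓ.bound
  simp only [buildAdjacency, Cmd.wp_seq, Cmd.wp_set]
  refine ⟨by simp [hbase, hb]; omega, by simp [hb],
    Cmd.wp_for (fun i s' => (∃ owner, HasAdj Γ T (edgePairs es i) (2 * i) owner s') ∧
      s'.var .edge = i ∧ s'.time ≤ s.time + 5 + i * (17 * n + 149)) (lo := 0) (hi := n - 1)
      (Nat.zero_le _) ⟨⟨0, ⟨by simp [hΓ.nodes], ?_⟩⟩, by simp, by simp⟩ ?_ ?_ ?_⟩
  · rw [edgePairs_zero]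
    simpa [hhead] using AdjLists.empty _ _ _
  · rintro i s' - ⟨⟨owner, h⟩, hedge, -⟩ -
    simp [h.nodes, hedge, hb]
    omega
  · rintro i s' - ⟨⟨owner, h⟩, hedge, ht⟩ hi
    refine Cmd.wp_mono (fun s₁ ⟨h₁, hedge₁, ht₁⟩ => ⟨h₁, hedge₁, ?_⟩)
      (insertEdge_wp hΓ (i := i) (by omega) (s := s'.tick _) ⟨h.nodes, h.lists⟩
        (by simpa using hedge))
    simp only [Env.tick_time, Expr.cost] at ht₁
    rw [add_one_mul]
    omega
  · rintro s' - ⟨⟨owner, h⟩, -, ht⟩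
    refine ⟨⟨owner, by simpa using h.nodes, ?_⟩, ?_⟩
    · rw [show n - 1 = es.length by omega] at h
      exact ⟨h.lists.buckets, fun d hd => (h.lists.lt d hd).trans (by omega), h.lists.cell,
        fun y z hyz => h.lists.cover y z (mem_edgePairs hes hyz)⟩
    · have : (n - 1) * (17 * n + 149) ≤ n * (17 * n + 149) := by gcongr; omega
      simp only [Env.tick_time, Expr.cost]
      omega

end

end WordRAM

/-! ### Classification of the paths by their words -/

/-- The trie with the words `W'` and `m'` nodes results from the one with the words `W` and `m`
nodes by adding the word `u` unless it is present. The node of `u` is `c`. -/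
structure AddsWord (W : ℕ → List ℕ) (m : ℕ) (W' : ℕ → List ℕ) (m' c : ℕ) (u : List ℕ) : Prop where
  le : m ≤ m'
  lt : c < m'
  eq : ∀ k < m, W' k = W k
  word : W' c = u
  cover : ∀ k < m', k < m ∨ k = c

theorem AddsWord.of_lt {W : ℕ → List ℕ} {m c : ℕ} (hc : c < m) : AddsWord W m W m c (W c) :=
  ⟨le_rfl, hc, fun _ _ => rfl, rfl, fun _ => .inl⟩

theorem AddsWord.update (W : ℕ → List ℕ) (m : ℕ) (u : List ℕ) :
    AddsWord W m (Function.update W m u) (m + 1) m u :=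
  ⟨m.le_succ, m.lt_succ_self, fun _ hk => Function.update_of_ne hk.ne _ _,
    Function.update_self m u W, fun _ => Nat.lt_succ_iff_lt_or_eq.1⟩

theorem AddsWord.word_le {W W' : ℕ → List ℕ} {m m' c : ℕ} {u : List ℕ}
    (h : AddsWord W m W' m' c u) : c ≤ m := by
  by_contra! hc
  exact (h.cover m (hc.trans h.lt)).elim (lt_irrefl m) hc.ne

/-- The paths with nonzero entry in `cls` are classified by their words: the entry of a path is
`c + 1`, where `c < m` is the number of its word in the list `W`. For a path of positive length
`first` has the first node after its start. -/
structure IsClassTable {n σ : ℕ} (T : UnrootedTree n σ) (m : ℕ) (W : ℕ → List ℕ)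
    (cls first : ℕ → ℕ) : Prop where
  pair : ∀ a, cls a ≠ 0 → ∃ p : Fin n × Fin n, pairIdx p = a
  word : ∀ (p : Fin n × Fin n) c, cls (pairIdx p) = c + 1 → c < m ∧ W c = T.natWord p.1 p.2
  diag : ∀ x : Fin n, cls (pairIdx (x, x)) = 1
  first : ∀ x y : Fin n, x ≠ y → cls (pairIdx (x, y)) ≠ 0 →
    ∃ f : Fin n, first (pairIdx (x, y)) = f ∧ T.FirstStep x y f
  prefix_closed : ∀ x y z, T.Extends x y z → cls (pairIdx (x, z)) ≠ 0 → cls (pairIdx (x, y)) ≠ 0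
  surj : ∀ c < m, ∃ p : Fin n × Fin n, cls (pairIdx p) = c + 1

namespace IsClassTable

variable {n σ : ℕ} {T : UnrootedTree n σ} {m : ℕ} {W : ℕ → List ℕ} {cls first : ℕ → ℕ}

theorem le_mul (h : IsClassTable T m W cls first) : m ≤ n * n := by
  have hsub : Finset.range m ⊆ Finset.univ.image fun p : Fin n × Fin n => cls (pairIdx p) - 1 :=
    fun c hc => by
      obtain ⟨p, hp⟩ := h.surj c (Finset.mem_range.1 hc)
      exact Finset.mem_image.2 ⟨p, Finset.mem_univ p, by omega⟩
  simpa using (Finset.card_le_card hsub).trans Finset.card_image_le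

theorem diagonal (hn : 0 < n) (hW : W 0 = []) (first : ℕ → ℕ)
    (hcls : ∀ a, cls a = if ∃ x : Fin n, pairIdx (x, x) = a then 1 else 0) :
    IsClassTable T 1 W cls first := by
  have hpair : ∀ x y : Fin n, cls (pairIdx (x, y)) = if x = y then 1 else 0 := by
    intro x y
    simp [hcls, pairIdx_injective.eq_iff, eq_comm]
  refine ⟨fun a ha => ?_, fun ⟨x, y⟩ c hc => ?_, fun x => ?_, fun x y hxy hc => ?_,
    fun x y z hxyz hc => ?_, fun c hc => ⟨(⟨0, hn⟩, ⟨0, hn⟩), ?_⟩⟩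
  · rw [hcls, ite_ne_right_iff] at ha
    exact ha.1.imp' (fun x => (x, x)) fun _ => id
  · rw [hpair] at hc
    split_ifs at hc with hxy
    obtain rfl : c = 0 := by omega
    rw [hxy, T.natWord_self]
    exact ⟨one_pos, hW⟩
  · rw [hpair, if_pos rfl]
  · exact absurd (hpair x y ▸ hc) (by simp [hxy])
  · exact absurd (hpair x z ▸ hc) (by simp [hxyz.ne])
  · rw [hpair, if_pos rfl]
    omega

theorem insert (h : IsClassTable T m W cls first) {x y z f : Fin n} {v c m' : ℕ}
    {W' : ℕ → List ℕ} (hxyz : T.Extends x y z) (hy : cls (pairIdx (x, y)) = v + 1)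
    (hz : cls (pairIdx (x, z)) = 0) (hf : T.FirstStep x z f)
    (hW : AddsWord W m W' m' c (W v ++ [T.natLabel y z])) :
    IsClassTable T m' W' (Function.update cls (pairIdx (x, z)) (c + 1))
      (Function.update first (pairIdx (x, z)) f) := by
  have hne : ∀ p : Fin n × Fin n, cls (pairIdx p) ≠ 0 → pairIdx p ≠ pairIdx (x, z) := fun p hp e =>
    hp (e ▸ hz)
  have hold : ∀ p : Fin n × Fin n, cls (pairIdx p) ≠ 0 →
      Function.update cls (pairIdx (x, z)) (c + 1) (pairIdx p) = cls (pairIdx p) :=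
    fun p hp => Function.update_of_ne (hne p hp) _ _
  refine ⟨fun a ha => ?_, fun p d hd => ?_, fun x' => ?_, fun x' y' hxy hd => ?_,
    fun x' y' z' h' hd => ?_, fun d hd => ?_⟩
  · obtain rfl | haz := eq_or_ne a (pairIdx (x, z))
    · exact ⟨_, rfl⟩
    · rw [Function.update_of_ne haz] at ha
      exact h.pair a ha
  · obtain rfl | hp := eq_or_ne p (x, z)
    · obtain rfl : c = d := by simpa using hd
      rw [hW.word, hxyz.natWord, (h.word _ _ hy).2]
      exact ⟨hW.lt, rfl⟩
    · rw [Function.update_of_ne (pairIdx_injective.ne hp)] at hd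
      obtain ⟨hdm, hword⟩ := h.word p d hd
      exact ⟨hdm.trans_le hW.le, by rw [hW.eq d hdm, hword]⟩
  · rw [hold _ (by simp [h.diag]), h.diag]
  · by_cases hp : (x', y') = (x, z)
    · obtain ⟨rfl, rfl⟩ := Prod.mk.inj hp
      exact ⟨f, by simp, hf⟩
    · rw [Function.update_of_ne (pairIdx_injective.ne hp)] at hd ⊢
      exact h.first x' y' hxy hd
  · suffices hcls : cls (pairIdx (x', y')) ≠ 0 by rwa [hold _ hcls]
    by_cases hp : (x', z') = (x, z)
    · obtain ⟨rfl, rfl⟩ := Prod.mk.inj hp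
      rw [h'.left_unique hxyz, hy]
      exact Nat.succ_ne_zero v
    · rw [Function.update_of_ne (pairIdx_injective.ne hp)] at hd
      exact h.prefix_closed x' y' z' h' hd
  · obtain hdm | rfl := hW.cover d hd
    · obtain ⟨p, hp⟩ := h.surj d hdm
      exact ⟨p, by rw [hold p (by omega), hp]⟩
    · exact ⟨(x, z), by simp⟩

end IsClassTable

/-! ### Construction of the trie -/

namespace WordRAM

/-- Create a child of the current trie node whose letter has the current rank. -/
def addChild : Cmd :=
  .put .child (.var .rank) (.var .size) ;;
  .put .letter (.var .size) (.var .rank) ;;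
  .set .size (.bin .add (.var .size) (.lit 1)) ;;
  .put .start (.bin .add (.var .node) (.lit 1)) (.var .size)

/-- Find or create the child of the current trie node whose letter has the current rank. -/
def findChild : Cmd :=
  .ite .lt (.get .child (.var .rank)) (.get .start (.var .node)) addChild .skip ;;
  .set .child (.get .child (.var .rank))

/-- Put the path `pair`, which extends the path `pairPtr` to the node `nbr`, into the class of the
trie node `child`. -/
def classifyPair : Cmd :=
  .put .cls (.var .pair) (.bin .add (.var .child) (.lit 1)) ;;
  pushCell .next .head .pair .child ;;
  .ite .eq (.var .src) (.var .dst)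
    (.put .first (.var .pair) (.var .nbr))
    (.put .first (.var .pair) (.get .first (.bin .sub (.var .pairPtr) (.lit 1))))

/-- Classify the path `pair`, which extends the path `pairPtr` by the edge `dart`. -/
def insertPair : Cmd :=
  .set .rank (.get .adjRank (.bin .sub (.var .dart) (.lit 1))) ;;
  findChild ;;
  classifyPair

/-- Classify the path `pair`, which extends the path `pairPtr` by the edge `dart` or is obtained
from it by deleting the last edge, unless this has been done. -/
def insertNewPair : Cmd :=
  .ite .eq (.get .cls (.var .pair)) (.lit 0) insertPair .skip

/-- Classify the extension of the path `pairPtr` by the edge `dart`, if there is one, and go to the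
next edge. -/
def visitEdge : Cmd :=
  .set .nbr (.get .adjNode (.bin .sub (.var .dart) (.lit 1))) ;;
  .set .pair (.bin .add (.var .nbr) (.bin .mul (.var .nodes) (.var .src))) ;;
  insertNewPair ;;
  .set .dart (.get .adjNext (.bin .sub (.var .dart) (.lit 1)))

/-- Classify the extensions of the path `pairPtr` and go to the next path of its class. -/
def visitPair : Cmd :=
  .set .src (.bin .div (.bin .sub (.var .pairPtr) (.lit 1)) (.var .nodes)) ;;
  .set .dst (.bin .mod (.bin .sub (.var .pairPtr) (.lit 1)) (.var .nodes)) ;;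
  .set .dart (.get .adjHead (.var .dst)) ;;
  .loop .ne (.var .dart) (.lit 0) visitEdge ;;
  .set .pairPtr (.get .next (.bin .sub (.var .pairPtr) (.lit 1)))

/-- Classify the extensions of all paths in the class of the current trie node. -/
def visitNode : Cmd :=
  .put .start (.bin .add (.var .node) (.lit 1)) (.var .size) ;;
  .set .pairPtr (.get .head (.var .node)) ;;
  .loop .ne (.var .pairPtr) (.lit 0) visitPair ;;
  .set .node (.bin .add (.var .node) (.lit 1))

/-- Put the path of length zero at the current node into the class of the root of the trie. -/
def classifyEmpty : Cmd :=
  .set .pair (.bin .add (.var .index) (.bin .mul (.var .nodes) (.var .index))) ;;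
  .put .cls (.var .pair) (.lit 1) ;;
  pushCell .next .head .pair .child ;;
  .set .index (.bin .add (.var .index) (.lit 1))

/-- Make the root of the trie, which is the class of the paths of length zero. -/
def makeRoot : Cmd :=
  .put .start (.lit 0) (.lit 1) ;;
  .set .size (.lit 1) ;;
  .set .child (.lit 0) ;;
  .set .index (.lit 0) ;;
  .loop .lt (.var .index) (.var .nodes) classifyEmpty

/-- Build the trie of all words along paths in breadth-first order. -/
def buildTrie : Cmd :=
  makeRoot ;;
  .set .node (.lit 0) ;;
  .loop .lt (.var .node) (.var .size) visitNode

/-- The machine holds a trie with the words `W`, of which the nodes below `v` are complete. -/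
structure HasTrie (Γ : Ctx) (n v : ℕ) (W : ℕ → List ℕ) (s : Env) : Prop where
  size : s.var .size = s.arr .start v
  trie : IsTrie Γ.lam (n - 1) (s.arr .start) (s.arr .letter) v W
  child_lt : ∀ b, s.arr .child b < s.arr .start v

/-- The machine holds a classification of paths by their words, with lists of the paths in the
classes. -/
structure HasClasses {n σ : ℕ} (T : UnrootedTree n σ) (m : ℕ) (W : ℕ → List ℕ) (s : Env) :
    Prop where
  table : IsClassTable T m W (s.arr .cls) (s.arr .first)
  buckets : Buckets (s.arr .cls) (s.arr .next) (s.arr .head)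

/-- The invariant of the construction of the trie before the expansion of the node `v`. -/
structure TrieInv {n σ : ℕ} (Γ : Ctx) (T : UnrootedTree n σ) (owner : ℕ → ℕ) (v : ℕ)
    (W : ℕ → List ℕ) (s : Env) : Prop where
  adj : HasAdj Γ T {p | T.graph.Adj p.1 p.2} (2 * n) owner s
  trie : HasTrie Γ n v W s
  classes : HasClasses T (s.arr .start v) W s

/-- The invariant of the construction of the trie during the expansion of the node `v`. -/
structure Expanding {n σ : ℕ} (Γ : Ctx) (T : UnrootedTree n σ) (owner : ℕ → ℕ) (v : ℕ)
    (W : ℕ → List ℕ) (s : Env) : Prop where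
  inv : TrieInv Γ T owner (v + 1) W s
  table : IsChildTable (s.arr .start) (s.arr .letter) (s.arr .child) v
  node : s.var .node = v

/-- The current path is the one from `x` to `y`, and it is in the class of the trie node `v`. -/
structure AtPair {n : ℕ} (x y : Fin n) (v : ℕ) (s : Env) : Prop where
  src : s.var .src = x
  dst : s.var .dst = y
  ptr : s.var .pairPtr = pairIdx (x, y) + 1
  cls : s.arr .cls (pairIdx (x, y)) = v + 1

/-- New paths have been added to classes above `v`, and the rest of the classification and of the
lists has been retained. -/
structure Grows (v : ℕ) (s s' : Env) : Prop where
  cls : ∀ a, s.arr .cls a ≠ 0 → s'.arr .cls a = s.arr .cls a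
  next : ∀ a, s.arr .cls a ≠ 0 → s'.arr .next a = s.arr .next a
  new : ∀ a, s.arr .cls a = 0 → s'.arr .cls a ≠ 0 → v + 1 < s'.arr .cls a

section

variable {n σ v : ℕ} {Γ : Ctx} {T : UnrootedTree n σ} {es : List T.graph.Dart} {s s' s₁ : Env}
  {owner : ℕ → ℕ} {W W' : ℕ → List ℕ}

theorem Grows.refl (v : ℕ) (s : Env) : Grows v s s :=
  ⟨fun _ _ => rfl, fun _ _ => rfl, fun _ h h' => absurd h h'⟩

theorem Grows.trans (h : Grows v s s₁) (h' : Grows v s₁ s') : Grows v s s' where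
  cls a ha := by
    have e := h.cls a ha
    rw [h'.cls a (by rwa [e]), e]
  next a ha := by rw [h'.next a (by rwa [h.cls a ha]), h.next a ha]
  new a ha ha' := by
    by_cases h₁ : s₁.arr .cls a = 0
    · exact h'.new a h₁ ha'
    · rw [h'.cls a h₁]
      exact h.new a ha h₁

theorem Grows.ne_zero (h : Grows v s s') {a : ℕ} (ha : s.arr .cls a ≠ 0) :
    s'.arr .cls a ≠ 0 := by
  rwa [h.cls a ha]

theorem addChild_wp (hΓ : Γ.Encodes T es) (h : HasTrie Γ n (v + 1) W s)
    (htable : IsChildTable (s.arr .start) (s.arr .letter) (s.arr .child) v)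
    (hnode : s.var .node = v) (hrank : IsRank Γ.lam (n - 1) (s.var .rank))
    (hle : s.arr .start (v + 1) ≤ n * n) (hnew : s.arr .child (s.var .rank) < s.arr .start v) :
    addChild.wp Γ (fun s' => ∃ W', HasTrie Γ n (v + 1) W' s' ∧
      IsChildTable (s'.arr .start) (s'.arr .letter) (s'.arr .child) v ∧
      s'.arr .child (s.var .rank) = s.arr .start (v + 1) ∧
      AddsWord W (s.arr .start (v + 1)) W' (s'.arr .start (v + 1)) (s.arr .start (v + 1))
        (W v ++ [Γ.lam (s.var .rank)]) ∧
      s'.time ≤ s.time + 35) s := by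
  have hlen := hΓ.len
  have hb := hΓ.bound
  have hrlt := hrank.lt
  have hsize := h.size
  have hvs := h.trie.lt_start v v.lt_succ_self
  have hss := h.trie.start_le v v.lt_succ_self
  have hfresh : ∀ k, s.arr .start v ≤ k → k < s.arr .start (v + 1) →
      s.arr .letter k ≠ s.var .rank := fun k hk hk' e => by
    rw [← e, htable.child_letter k hk hk'] at hnew
    omega
  simp only [addChild, Expr.cost, Nat.reduceAdd, Cmd.wp_put, Expr.Ok, Expr.eval, Env.tick_var,
    hsize, Cmd.wp_seq, Env.put_var, Cmd.wp_set, NatOp.Safe, true_and, NatOp.eval, Env.set_var,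
    ne_eq, reduceCtorEq, not_false_eq_true, Function.update_of_ne, hnode, Function.update_self,
    Env.tick_arr, Env.put_arr, Env.set_arr, Env.tick_time, Env.set_time, Env.put_time]
  refine ⟨by omega, by omega, by omega, by omega, by omega,
    Function.update W (s.arr .start (v + 1)) (W v ++ [Γ.lam (s.var .rank)]),
    ⟨by simp, by simpa using h.trie.addChild hrank hfresh, fun b => ?_⟩,
    by simpa using htable.addChild h.child_lt hnew, .update _ _ _, by omega⟩
  obtain rfl | hb := eq_or_ne b (s.var .rank)
  · simp
  · simpa [hb] using (h.child_lt b).trans (Nat.lt_succ_self _)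

theorem findChild_wp (hΓ : Γ.Encodes T es) (h : HasTrie Γ n (v + 1) W s)
    (htable : IsChildTable (s.arr .start) (s.arr .letter) (s.arr .child) v)
    (hnode : s.var .node = v) (hrank : IsRank Γ.lam (n - 1) (s.var .rank))
    (hle : s.arr .start (v + 1) ≤ n * n) :
    findChild.wp Γ (fun s' => ∃ W', HasTrie Γ n (v + 1) W' s' ∧
      IsChildTable (s'.arr .start) (s'.arr .letter) (s'.arr .child) v ∧
      v < s'.var .child ∧
      AddsWord W (s.arr .start (v + 1)) W' (s'.arr .start (v + 1)) (s'.var .child)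
        (W v ++ [Γ.lam (s.var .rank)]) ∧
      s'.time ≤ s.time + 60) s := by
  have hlen := hΓ.len
  have hrlt := hrank.lt
  have hvs := h.trie.lt_start v v.lt_succ_self
  have hss := h.trie.start_le v v.lt_succ_self
  refine Cmd.wp_then (Q := fun s' => ∃ W', HasTrie Γ n (v + 1) W' s' ∧
    IsChildTable (s'.arr .start) (s'.arr .letter) (s'.arr .child) v ∧
    v < s'.arr .child (s.var .rank) ∧
    AddsWord W (s.arr .start (v + 1)) W' (s'.arr .start (v + 1)) (s'.arr .child (s.var .rank))
      (W v ++ [Γ.lam (s.var .rank)]) ∧ s'.time ≤ s.time + 50) ?_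
    fun s₁ f₁ ⟨W', h', htable', hv, hW, _⟩ => ?_
  · rw [Cmd.wp_ite]
    refine ⟨by simp; omega, by simp [hnode]; omega, fun hc => ?_, fun hc => ?_⟩
    · have hnew : s.arr .child (s.var .rank) < s.arr .start v := by simpa [hnode] using hc
      have hadd := addChild_wp hΓ (s := s.tick 15) ⟨h.size, h.trie, h.child_lt⟩ htable hnode hrank
        hle hnew
      refine Cmd.wp_mono (fun s' ⟨W', h', htable', hchild, hW, ht⟩ =>
        ⟨W', h', htable', ?_, ?_, ?_⟩) hadd
      · exact hchild ▸ hvs.trans_le hss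
      · exact hchild ▸ hW
      · exact ht.trans (by simp)
    · have hold : s.arr .start v ≤ s.arr .child (s.var .rank) := by simpa [hnode] using hc
      have hlt := h.child_lt (s.var .rank)
      obtain ⟨hword, -⟩ := h.trie.child v v.lt_succ_self _ hold hlt
      rw [htable.letter_child _ hold] at hword
      exact ⟨W, ⟨h.size, h.trie, h.child_lt⟩, htable, by simpa using by omega,
        hword ▸ .of_lt hlt, by simp⟩
  · have hrank₁ : s₁.var .rank = s.var .rank := f₁.var _ rfl
    exact ⟨by simp [hrank₁]; omega, W', ⟨by simpa using h'.size, h'.trie, h'.child_lt⟩, htable',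
      by simpa [hrank₁] using hv, by simpa [hrank₁] using hW, by simp; omega⟩

theorem HasClasses.of_frame {m : ℕ} (h : HasClasses T m W s) {p : Cmd} (hp : p.Frame s s')
    (harr : (∀ A ∈ [Arr.cls, .first, .next, .head], p.writes A = false) := by decide) :
    HasClasses T m W s' := by
  refine ⟨?_, ?_⟩ <;> rw [hp.arr _ (harr .cls (by simp))]
  · rw [hp.arr _ (harr .first (by simp))]
    exact h.table
  · rw [hp.arr _ (harr .next (by simp)), hp.arr _ (harr .head (by simp))]
    exact h.buckets

theorem HasTrie.of_frame (h : HasTrie Γ n v W s) {p : Cmd} (hp : p.Frame s s')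
    (hvar : p.assigns .size = false := by decide)
    (harr : (∀ A ∈ [Arr.start, .letter, .child], p.writes A = false) := by decide) :
    HasTrie Γ n v W s' := by
  refine ⟨?_, ?_, ?_⟩ <;> rw [hp.arr _ (harr .start (by simp))]
  · rw [hp.var _ hvar, h.size]
  · rw [hp.arr _ (harr .letter (by simp))]
    exact h.trie
  · rw [hp.arr _ (harr .child (by simp))]
    exact h.child_lt

theorem TrieInv.of_frame (h : TrieInv Γ T owner v W s) {p : Cmd} (hp : p.Frame s s')
    (hvar : (∀ a ∈ [Var.nodes, .size], p.assigns a = false) := by decide)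
    (harr : (∀ A, p.writes A = false) := by exact fun _ => rfl) : TrieInv Γ T owner v W s' where
  adj := h.adj.of_frame hp (hvar .nodes (by simp)) fun A _ => harr A
  trie := h.trie.of_frame hp (hvar .size (by simp)) fun A _ => harr A
  classes := by
    rw [hp.arr _ (harr .start)]
    exact h.classes.of_frame hp fun A _ => harr A

theorem Expanding.of_frame (h : Expanding Γ T owner v W s) {p : Cmd} (hp : p.Frame s s')
    (hvar : (∀ a ∈ [Var.nodes, .size, .node], p.assigns a = false) := by decide)
    (harr : (∀ A, p.writes A = false) := by exact fun _ => rfl) : Expanding Γ T owner v W s' where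
  inv := h.inv.of_frame hp (fun a ha => hvar a (List.mem_append_left [Var.node] ha)) harr
  table := by
    rw [hp.arr _ (harr .start), hp.arr _ (harr .letter), hp.arr _ (harr .child)]
    exact h.table
  node := (hp.var _ (hvar .node (by simp))).trans h.node

theorem Grows.of_frame {p : Cmd} (hp : p.Frame s s') (hcls : p.writes .cls = false := by decide)
    (hnext : p.writes .next = false := by decide) : Grows v s s' where
  cls _ _ := by rw [hp.arr _ hcls]
  next _ _ := by rw [hp.arr _ hnext]
  new a ha ha' := by
    rw [hp.arr _ hcls] at ha'
    exact absurd ha ha'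

theorem AtPair.of_grows {x y : Fin n} (h : AtPair x y v s) (hs : Grows v s s') {p : Cmd}
    (hp : p.Frame s s')
    (hvar : (∀ a ∈ [Var.src, .dst, .pairPtr], p.assigns a = false) := by decide) :
    AtPair x y v s' where
  src := (hp.var _ (hvar .src (by simp))).trans h.src
  dst := (hp.var _ (hvar .dst (by simp))).trans h.dst
  ptr := (hp.var _ (hvar .pairPtr (by simp))).trans h.ptr
  cls := by rw [hs.cls _ (by rw [h.cls]; exact v.succ_ne_zero), h.cls]

theorem HasClasses.insert {m m' c : ℕ} {x y z f : Fin n} (h : HasClasses T m W s)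
    (hxyz : T.Extends x y z) (hy : s.arr .cls (pairIdx (x, y)) = v + 1)
    (hz : s.arr .cls (pairIdx (x, z)) = 0) (hf : T.FirstStep x z f) (hv : v < c)
    (hW : AddsWord W m W' m' c (W v ++ [T.natLabel y z]))
    (hcls : s'.arr .cls = Function.update (s.arr .cls) (pairIdx (x, z)) (c + 1))
    (hnext : s'.arr .next = Function.update (s.arr .next) (pairIdx (x, z)) (s.arr .head c))
    (hhead : s'.arr .head = Function.update (s.arr .head) c (pairIdx (x, z) + 1))
    (hfirst : s'.arr .first = Function.update (s.arr .first) (pairIdx (x, z)) f) :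
    HasClasses T m' W' s' ∧ Grows v s s' ∧ s'.arr .cls (pairIdx (x, z)) ≠ 0 := by
  have hne : ∀ a, s.arr .cls a ≠ 0 → a ≠ pairIdx (x, z) := fun a ha e => ha (e ▸ hz)
  refine ⟨⟨?_, ?_⟩, ⟨fun a ha => ?_, fun a ha => ?_, fun a ha ha' => ?_⟩, by simp [hcls]⟩
  · rw [hcls, hfirst]
    exact h.table.insert hxyz hy hz hf hW
  · rw [hcls, hnext, hhead]
    exact h.buckets.push hz c
  · rw [hcls, Function.update_of_ne (hne a ha)]
  · rw [hnext, Function.update_of_ne (hne a ha)]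
  · obtain rfl | hne := eq_or_ne a (pairIdx (x, z))
    · simpa [hcls] using hv
    · simp [hcls, hne, ha] at ha'

theorem classifyPair_wp (hΓ : Γ.Encodes T es) {m m' : ℕ} {x y z : Fin n}
    (h : HasClasses T m W s) (hxy : AtPair x y v s) (hnbr : s.var .nbr = z)
    (hpair : s.var .pair = pairIdx (x, z)) (hxyz : T.Extends x y z)
    (hz : s.arr .cls (pairIdx (x, z)) = 0) (hv : v < s.var .child)
    (hW : AddsWord W m W' m' (s.var .child) (W v ++ [T.natLabel y z])) :
    classifyPair.wp Γ (fun s' => (HasClasses T m' W' s' ∧ Grows v s s' ∧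
      s'.arr .cls (pairIdx (x, z)) ≠ 0) ∧ s'.time ≤ s.time + 53) s := by
  have hlen := hΓ.len
  have hb := hΓ.bound
  have hm := h.table.le_mul
  have hc := hW.word_le
  have hxz := pairIdx_lt (x, z)
  have hxy_lt := pairIdx_lt (x, y)
  simp only [classifyPair, pushCell, Cmd.wp_seq, Cmd.wp_put, Cmd.wp_ite]
  refine ⟨trivial, by simp [hpair]; omega, by simp; omega, trivial, by simp [hpair]; omega,
    by simp; omega, trivial, by simp; omega, by simp [hpair]; omega, trivial, trivial,
    fun he => ⟨trivial, by simp [hpair]; omega, trivial, ?_, by simp⟩,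
    fun hne => ⟨trivial, by simp [hpair]; omega, by simp [hxy.ptr]; omega, ?_, by simp⟩⟩
  · obtain rfl : x = y := by simpa [hxy.src, hxy.dst, Fin.ext_iff] using he
    exact h.insert hxyz hxy.cls hz (.of_adj hxyz.1) hv hW (by simp [hpair]) (by simp [hpair])
      (by simp [hpair]) (by simp [hpair, hnbr])
  · replace hne : x ≠ y := by simpa [hxy.src, hxy.dst, Fin.ext_iff] using hne
    obtain ⟨f, hfirst, hf⟩ := h.table.first x y hne (by rw [hxy.cls]; exact v.succ_ne_zero)
    exact h.insert hxyz hxy.cls hz (hf.extend hxyz) hv hW (by simp [hpair]) (by simp [hpair])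
      (by simp [hpair]) (by simp [hpair, hxy.ptr, hfirst])

theorem insertPair_wp (hΓ : Γ.Encodes T es) (h : Expanding Γ T owner v W s) {x y z : Fin n} {d : ℕ}
    (hxy : AtPair x y v s) (hdart : s.var .dart = d + 1) (hd : owner d = y + 1)
    (hz : s.arr .adjNode d = z) (hnbr : s.var .nbr = z) (hpair : s.var .pair = pairIdx (x, z))
    (hxyz : T.Extends x y z) (hcls : s.arr .cls (pairIdx (x, z)) = 0) :
    insertPair.wp Γ (fun s' => (∃ W', Expanding Γ T owner v W' s') ∧ Grows v s s' ∧
      s'.arr .cls (pairIdx (x, z)) ≠ 0 ∧ s'.time ≤ s.time + 123) s := by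
  have hlen := hΓ.len
  have hb := hΓ.bound
  have hdlt := h.inv.adj.lists.lt d (by omega)
  obtain ⟨z', hz', -, hlam, hrank⟩ := h.inv.adj.lists.cell d y hd
  obtain rfl : z' = z := Fin.ext (hz'.symm.trans hz)
  refine Cmd.wp_then (Q := fun s' => s'.var .rank = s.arr .adjRank d ∧ s'.time = s.time + 10)
    ⟨by simp [hdart]; omega, by simp [hdart], by simp⟩ fun s₁ f₁ ⟨hrank₁, ht₁⟩ => ?_
  have hstart : s₁.arr .start = s.arr .start := f₁.arr _ rfl
  rw [← hrank₁] at hlam hrank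
  refine Cmd.wp_then (findChild_wp hΓ (h.inv.trie.of_frame f₁) ?_ ((f₁.var _ rfl).trans h.node)
    hrank ?_) fun s₂ f₂ ⟨W', htrie, htable, hv, hW, ht₂⟩ => ?_
  · rw [hstart, f₁.arr _ rfl, f₁.arr _ rfl]
    exact h.table
  · rw [hstart]
    exact h.inv.classes.table.le_mul
  have hcls₂ : s₂.arr .cls = s.arr .cls := (f₂.arr _ rfl).trans (f₁.arr _ rfl)
  rw [hlam, hstart] at hW
  refine Cmd.wp_conseq (classifyPair_wp hΓ ((h.inv.classes.of_frame f₁).of_frame f₂)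
    ((hxy.of_grows (.of_frame f₁) f₁).of_grows (.of_frame f₂) f₂)
    (((f₂.var _ rfl).trans (f₁.var _ rfl)).trans hnbr)
    (((f₂.var _ rfl).trans (f₁.var _ rfl)).trans hpair) hxyz (by rw [hcls₂, hcls]) hv hW)
    fun s₃ f₃ ⟨⟨hclasses, hgrows, hne⟩, _⟩ => ?_
  have hstart₃ : s₃.arr .start = s₂.arr .start := f₃.arr _ rfl
  refine ⟨⟨W', ⟨((h.inv.adj.of_frame f₁).of_frame f₂).of_frame f₃, htrie.of_frame f₃, ?_⟩, ?_, ?_⟩,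
    (Grows.of_frame f₁).trans ((Grows.of_frame f₂).trans hgrows), hne, by omega⟩
  · rw [hstart₃]
    exact hclasses
  · rw [hstart₃, f₃.arr _ rfl, f₃.arr _ rfl]
    exact htable
  · rw [f₃.var _ rfl, f₂.var _ rfl, f₁.var _ rfl, h.node]

theorem insertNewPair_wp (hΓ : Γ.Encodes T es) (h : Expanding Γ T owner v W s) {x y z : Fin n}
    {d : ℕ} (hxy : AtPair x y v s) (hdart : s.var .dart = d + 1) (hd : owner d = y + 1)
    (hz : s.arr .adjNode d = z) (hnbr : s.var .nbr = z) (hpair : s.var .pair = pairIdx (x, z))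
    (hyz : T.graph.Adj y z) :
    insertNewPair.wp Γ (fun s' => (∃ W', Expanding Γ T owner v W' s') ∧ Grows v s s' ∧
      s'.arr .cls (pairIdx (x, z)) ≠ 0 ∧ s'.time ≤ s.time + 132) s := by
  have hlen := hΓ.len
  have hb := hΓ.bound
  have hxz := pairIdx_lt (x, z)
  refine ⟨by simp [hpair]; omega, by simp; omega, fun hc => ?_, fun hc => ?_⟩
  · replace hc : s.arr .cls (pairIdx (x, z)) = 0 := by simpa [hpair] using hc
    have hxyz : T.Extends x y z := (T.extends_or_extends x hyz).resolve_right fun hxzy =>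
      h.inv.classes.table.prefix_closed x z y hxzy (by rw [hxy.cls]; exact v.succ_ne_zero) hc
    have f := Cmd.Frame.tick s 9
    exact Cmd.wp_mono (fun s' ⟨h', hgrows, hne, ht⟩ =>
        ⟨h', .trans (.of_frame f) hgrows, hne, by rwa [Env.tick_time, add_assoc] at ht⟩)
      (insertPair_wp hΓ (h.of_frame f) (hxy.of_grows (.of_frame f) f) hdart hd hz hnbr hpair
        hxyz hc)
  · replace hc : s.arr .cls (pairIdx (x, z)) ≠ 0 := by simpa [hpair] using hc
    have f := Cmd.Frame.tick s 10
    exact ⟨⟨W, h.of_frame f⟩, .of_frame f, hc, by simp⟩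

theorem visitEdge_wp (hΓ : Γ.Encodes T es) (h : Expanding Γ T owner v W s) {x y : Fin n} {d : ℕ}
    (hxy : AtPair x y v s) (hdart : s.var .dart = d + 1) (hd : owner d = y + 1) :
    visitEdge.wp Γ (fun s' => (∃ W', Expanding Γ T owner v W' s') ∧ Grows v s s' ∧
      (∀ z : Fin n, s.arr .adjNode d = z → s'.arr .cls (pairIdx (x, z)) ≠ 0) ∧
      s'.var .dart = s.arr .adjNext d ∧ s'.time ≤ s.time + 158) s := by
  have hlen := hΓ.len
  have hb := hΓ.bound
  have hdlt := h.inv.adj.lists.lt d (by omega)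
  obtain ⟨z, hz, hyz, -⟩ := h.inv.adj.lists.cell d y hd
  have hxz := pairIdx_lt (x, z)
  have hpair := pairIdx_mk x z
  refine Cmd.wp_then (Q := fun s' => s'.var .nbr = z ∧ s'.time = s.time + 10)
    ⟨by simp [hdart]; omega, by simp [hdart, hz], by simp⟩ fun s₁ f₁ ⟨hnbr₁, ht₁⟩ => ?_
  refine Cmd.wp_then (Q := fun s' => s'.var .pair = pairIdx (x, z) ∧ s'.time = s.time + 16)
    ⟨by simp [hnbr₁, f₁.var .nodes rfl, f₁.var .src rfl, h.inv.adj.nodes, hxy.src]; omega,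
      by simp [hnbr₁, f₁.var .nodes rfl, f₁.var .src rfl, h.inv.adj.nodes, hxy.src, hpair],
      by simp [ht₁]⟩ fun s₂ f₂ ⟨hpair₂, _⟩ => ?_
  refine Cmd.wp_then (insertNewPair_wp hΓ ((h.of_frame f₁).of_frame f₂)
    ((hxy.of_grows (.of_frame f₁) f₁).of_grows (.of_frame f₂) f₂)
    (by rw [f₂.var _ rfl, f₁.var _ rfl, hdart]) hd (by rw [f₂.arr _ rfl, f₁.arr _ rfl, hz])
    (by rw [f₂.var _ rfl, hnbr₁]) hpair₂ hyz) fun s₃ f₃ ⟨h₃, hgrows, hne, _⟩ => ?_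
  have hdart₃ : s₃.var .dart = d + 1 := by
    rw [f₃.var _ rfl, f₂.var _ rfl, f₁.var _ rfl, hdart]
  have hnext₃ : s₃.arr .adjNext = s.arr .adjNext := by
    rw [f₃.arr _ rfl, f₂.arr _ rfl, f₁.arr _ rfl]
  refine Cmd.wp_conseq (Q := fun s' => s'.var .dart = s.arr .adjNext d ∧ s'.time = s₃.time + 10)
    ⟨by simp [hdart₃]; omega, by simp [hdart₃, hnext₃], by simp⟩ fun s₄ f₄ ⟨hdart₄, _⟩ => ?_
  have hcls₄ : s₄.arr .cls = s₃.arr .cls := f₄.arr _ rfl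
  refine ⟨h₃.imp fun _ h => h.of_frame f₄, ?_, fun z' hz' => ?_, hdart₄, by omega⟩
  · exact (Grows.of_frame f₁).trans ((Grows.of_frame f₂).trans (hgrows.trans (.of_frame f₄)))
  · obtain rfl : z = z' := Fin.ext (hz.symm.trans hz')
    rwa [hcls₄]

theorem visitEdges_wp (hΓ : Γ.Encodes T es) (h : Expanding Γ T owner v W s) {x y : Fin n}
    (hxy : AtPair x y v s) {l : List ℕ} (hl : IsLinked (s.arr .adjNext) (s.var .dart) l)
    (hmem : ∀ d, d ∈ l ↔ owner d = y + 1) :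
    (Cmd.loop .ne (.var .dart) (.lit 0) visitEdge).wp Γ (fun s' =>
      (∃ W', Expanding Γ T owner v W' s') ∧ Grows v s s' ∧
      (∀ z, T.graph.Adj y z → s'.arr .cls (pairIdx (x, z)) ≠ 0) ∧
      s'.time ≤ s.time + 161 * l.length + 3) s := by
  have hb := hΓ.bound
  refine Cmd.wp_linked (A := .adjNext) (l := l) (fun r s' => (∃ W', Expanding Γ T owner v W' s') ∧
    Grows v s s' ∧ visitEdge.Frame s s' ∧ IsLinked (s'.arr .adjNext) (s'.var .dart) r ∧
    (∀ d ∈ r, owner d = y + 1) ∧ (∀ d ∉ r, owner d = y + 1 → ∀ z : Fin n, s.arr .adjNode d = z →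
      s'.arr .cls (pairIdx (x, z)) ≠ 0) ∧
    s'.time + 161 * r.length ≤ s.time + 161 * l.length) (by omega)
    ⟨⟨W, h⟩, .refl v s, ⟨fun _ _ => rfl, fun _ _ => rfl, fun _ => rfl⟩, hl,
      fun d hd => (hmem d).1 hd, fun d hd hd' => absurd ((hmem d).2 hd') hd, le_rfl⟩
    (fun r s' hI => hI.2.2.2.1) ?_ ?_
  · rintro d r s₁ ⟨⟨W₁, h₁⟩, hgrows₁, f₁, ⟨hdart, hlink⟩, howner, hdone, _⟩
    have f := Cmd.Frame.tick s₁ 3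
    refine Cmd.wp_conseq (visitEdge_wp hΓ (h₁.of_frame f)
      ((hxy.of_grows hgrows₁ f₁).of_grows (.of_frame f) f) hdart (howner d (by simp)))
      fun s₂ f₂ ⟨h₂, hgrows₂, hne, hdart₂, _⟩ => ?_
    replace f₂ := f₂.mono (fun _ => id) (fun _ => id) id
    replace hgrows₂ := Grows.trans (.of_frame f) hgrows₂
    refine ⟨h₂, hgrows₁.trans hgrows₂, f₁.trans f₂, ?_, fun e he => howner e (by simp [he]),
      fun e he hey z hz => ?_, ?_⟩
    · rwa [f₂.arr _ rfl, hdart₂]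
    · obtain rfl | hed := eq_or_ne e d
      · exact hne z (by rw [f.arr _ rfl, f₁.arr _ rfl, hz])
      · exact hgrows₂.ne_zero (hdone e (by simp [hed, he]) hey z hz)
    · simp only [Env.tick_time, List.length_cons] at *
      omega
  · rintro s₁ ⟨h₁, hgrows, -, -, -, hdone, ht⟩
    have f := Cmd.Frame.tick s₁ 3
    refine ⟨h₁.imp fun _ h => h.of_frame f, hgrows.trans (.of_frame f), fun z hyz => ?_,
      Nat.add_le_add_right ht 3⟩
    obtain ⟨d, hd, hz⟩ := h.inv.adj.lists.cover y z hyz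
    exact hdone d (by simp) hd z hz

/-- The number of cells in the adjacency list of a node. -/
def listDegree (n : ℕ) (owner : ℕ → ℕ) (y : ℕ) : ℕ :=
  ((Finset.range (2 * n)).filter (owner · = y + 1)).card

theorem HasAdj.exists_list {E : Set (Fin n × Fin n)} (h : HasAdj Γ T E (2 * n) owner s) (y : ℕ) :
    ∃ l : List ℕ, l.length = listDegree n owner y ∧
      IsLinked (s.arr .adjNext) (s.arr .adjHead y) l ∧ ∀ d, d ∈ l ↔ owner d = y + 1 := by
  obtain ⟨l, hnodup, hl, hmem⟩ := h.lists.buckets y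
  refine ⟨l, ?_, hl, hmem⟩
  rw [← List.toFinset_card_of_nodup hnodup, listDegree]
  congr 1
  ext d
  have hlt := h.lists.lt d
  simp only [List.mem_toFinset, hmem, Finset.mem_filter, Finset.mem_range]
  omega

theorem visitPair_wp (hΓ : Γ.Encodes T es) (h : Expanding Γ T owner v W s) {x y : Fin n}
    (hptr : s.var .pairPtr = pairIdx (x, y) + 1) (hcls : s.arr .cls (pairIdx (x, y)) = v + 1) :
    visitPair.wp Γ (fun s' => (∃ W', Expanding Γ T owner v W' s') ∧ Grows v s s' ∧
      (∀ z, T.graph.Adj y z → s'.arr .cls (pairIdx (x, z)) ≠ 0) ∧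
      s'.var .pairPtr = s.arr .next (pairIdx (x, y)) ∧
      s'.time ≤ s.time + 161 * listDegree n owner y + 33) s := by
  have hlen := hΓ.len
  have hb := hΓ.bound
  have hxy := pairIdx_lt (x, y)
  have hnodes := h.inv.adj.nodes
  have hcls₀ : s.arr .cls (pairIdx (x, y)) ≠ 0 := by rw [hcls]; exact v.succ_ne_zero
  obtain ⟨l, hlength, hl, hmem⟩ := h.inv.adj.exists_list y
  refine Cmd.wp_then (Q := fun s' => s'.var .src = x ∧ s'.time = s.time + 6)
    ⟨by simp [hptr]; omega, by simp [hptr, hnodes, pairIdx_div], by simp⟩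
    fun s₁ f₁ ⟨hsrc, ht₁⟩ => ?_
  refine Cmd.wp_then (Q := fun s' => s'.var .dst = y ∧ s'.time = s.time + 12)
    ⟨by simp [f₁.var .pairPtr rfl, hptr]; omega,
      by simp [f₁.var .pairPtr rfl, f₁.var .nodes rfl, hptr, hnodes, pairIdx_mod], by simp [ht₁]⟩
    fun s₂ f₂ ⟨hdst, ht₂⟩ => ?_
  refine Cmd.wp_then (Q := fun s' => s'.var .dart = s.arr .adjHead y ∧ s'.time = s.time + 20)
    ⟨by simp [hdst]; omega, by simp [hdst, f₂.arr .adjHead rfl, f₁.arr .adjHead rfl],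
      by simp [ht₂]⟩ fun s₃ f₃ ⟨hdart, _⟩ => ?_
  have hptr₃ : s₃.var .pairPtr = pairIdx (x, y) + 1 := by
    rw [f₃.var _ rfl, f₂.var _ rfl, f₁.var _ rfl, hptr]
  refine Cmd.wp_then (visitEdges_wp hΓ (((h.of_frame f₁).of_frame f₂).of_frame f₃)
    ⟨by rw [f₃.var _ rfl, f₂.var _ rfl, hsrc], by rw [f₃.var _ rfl, hdst], hptr₃,
      by rw [f₃.arr _ rfl, f₂.arr _ rfl, f₁.arr _ rfl, hcls]⟩ (l := l) ?_ hmem)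
    fun s₄ f₄ ⟨h₄, hgrows, hne, _⟩ => ?_
  · rwa [hdart, f₃.arr _ rfl, f₂.arr _ rfl, f₁.arr _ rfl]
  replace hgrows : Grows v s s₄ :=
    .trans (.of_frame f₁) (.trans (.of_frame f₂) (.trans (.of_frame f₃) hgrows))
  have hptr₄ : s₄.var .pairPtr = pairIdx (x, y) + 1 := by rw [f₄.var _ rfl, hptr₃]
  refine Cmd.wp_conseq (Q := fun s' => s'.var .pairPtr = s.arr .next (pairIdx (x, y)) ∧
    s'.time = s₄.time + 10) ⟨by simp [hptr₄]; omega, by simp [hptr₄, hgrows.next _ hcls₀], by simp⟩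
    fun s₅ f₅ ⟨hptr₅, _⟩ => ⟨h₄.imp fun _ h => h.of_frame f₅, hgrows.trans (.of_frame f₅), ?_,
      hptr₅, by omega⟩
  rwa [f₅.arr _ rfl]

/-- A bound for the time spent on the extensions of a path with the end `y`. -/
def pairCost (n : ℕ) (owner : ℕ → ℕ) (y : ℕ) : ℕ :=
  161 * listDegree n owner y + 36

theorem visitPairs_wp (hΓ : Γ.Encodes T es) (h : Expanding Γ T owner v W s) {l : List ℕ}
    (hl : IsLinked (s.arr .next) (s.var .pairPtr) l) (hmem : ∀ a, a ∈ l ↔ s.arr .cls a = v + 1) :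
    (Cmd.loop .ne (.var .pairPtr) (.lit 0) visitPair).wp Γ (fun s' =>
      (∃ W', Expanding Γ T owner v W' s') ∧ Grows v s s' ∧
      (∀ x y z, s.arr .cls (pairIdx (x, y)) = v + 1 → T.graph.Adj y z →
        s'.arr .cls (pairIdx (x, z)) ≠ 0) ∧
      s'.time ≤ s.time + (l.map fun a => pairCost n owner (a % n)).sum + 3) s := by
  have hb := hΓ.bound
  refine Cmd.wp_linked (A := .next) (l := l) (fun r s' => (∃ W', Expanding Γ T owner v W' s') ∧
    Grows v s s' ∧ IsLinked (s'.arr .next) (s'.var .pairPtr) r ∧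
    (∀ a ∈ r, s.arr .cls a = v + 1) ∧ (∀ x y z, s.arr .cls (pairIdx (x, y)) = v + 1 →
      pairIdx (x, y) ∉ r → T.graph.Adj y z → s'.arr .cls (pairIdx (x, z)) ≠ 0) ∧
    s'.time + (r.map fun a => pairCost n owner (a % n)).sum ≤
      s.time + (l.map fun a => pairCost n owner (a % n)).sum) (by omega)
    ⟨⟨W, h⟩, .refl v s, hl, fun a ha => (hmem a).1 ha,
      fun x y z ha ha' => absurd ((hmem _).2 ha) ha', le_rfl⟩ (fun r s' hI => hI.2.2.1) ?_ ?_
  · rintro a r s₁ ⟨⟨W₁, h₁⟩, hgrows₁, ⟨hptr, hlink⟩, hcls, hdone, _⟩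
    have f := Cmd.Frame.tick s₁ 3
    have hne : ∀ b ∈ a :: r, s.arr .cls b ≠ 0 := fun b hb => by simp [hcls b hb]
    have hcls₁ : ∀ b ∈ a :: r, s₁.arr .cls b = v + 1 := fun b hb => by
      rw [hgrows₁.cls b (hne b hb), hcls b hb]
    obtain ⟨⟨x, y⟩, rfl⟩ := h.inv.classes.table.pair a (hne a (by simp))
    refine Cmd.wp_mono (fun s₂ ⟨h₂, hgrows₂, hnew, hptr₂, ht⟩ => ?_)
      (visitPair_wp hΓ (h₁.of_frame f) hptr (hcls₁ _ (by simp)))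
    replace hgrows₂ : Grows v s₁ s₂ := .trans (.of_frame f) hgrows₂
    refine ⟨h₂, hgrows₁.trans hgrows₂, ?_, fun b hb => hcls b (by simp [hb]),
      fun x' y' z hx' hy' hz => ?_, ?_⟩
    · rw [hptr₂]
      exact hlink.congr fun b hb => hgrows₂.next b (by simp [hcls₁ b (by simp [hb])])
    · by_cases hxy : (x', y') = (x, y)
      · obtain ⟨rfl, rfl⟩ := Prod.mk.inj hxy
        exact hnew z hz
      · exact hgrows₂.ne_zero (hdone x' y' z hx'
          (List.not_mem_cons_of_ne_of_not_mem (pairIdx_injective.ne hxy) hy') hz)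
    · simp only [Env.tick_time, List.map_cons, List.sum_cons, pairIdx_mod, pairCost] at *
      omega
  · rintro s₁ ⟨h₁, hgrows, -, -, hdone, ht⟩
    have f := Cmd.Frame.tick s₁ 3
    exact ⟨h₁.imp fun _ h => h.of_frame f, hgrows.trans (.of_frame f),
      fun x y z hxy hyz => hdone x y z hxy (by simp) hyz, Nat.add_le_add_right ht 3⟩

/-- A bound for the time spent on the extensions of the paths in a set of classes. -/
def classCost (n : ℕ) (owner cls : ℕ → ℕ) (C : ℕ → Prop) [DecidablePred C] : ℕ :=
  ∑ p : Fin n × Fin n with C (cls (pairIdx p)), pairCost n owner p.2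

theorem HasClasses.exists_list {m : ℕ} (h : HasClasses T m W s) (owner : ℕ → ℕ) (v : ℕ) :
    ∃ l : List ℕ, IsLinked (s.arr .next) (s.arr .head v) l ∧
      (∀ a, a ∈ l ↔ s.arr .cls a = v + 1) ∧
      (l.map fun a => pairCost n owner (a % n)).sum =
        classCost n owner (s.arr .cls) (· = v + 1) := by
  obtain ⟨l, hnodup, hl, hmem⟩ := h.buckets v
  refine ⟨l, hl, hmem, ?_⟩
  have himage : l.toFinset = (Finset.univ.filter fun p : Fin n × Fin n =>
      s.arr .cls (pairIdx p) = v + 1).image pairIdx := by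
    ext a
    simp only [List.mem_toFinset, hmem, Finset.mem_image, Finset.mem_filter, Finset.mem_univ,
      true_and]
    refine ⟨fun ha => ?_, by rintro ⟨p, hp, rfl⟩; exact hp⟩
    obtain ⟨p, rfl⟩ := h.table.pair a (by simp [ha])
    exact ⟨p, ha, rfl⟩
  rw [← List.sum_toFinset _ hnodup, himage, Finset.sum_image fun p _ q _ => (pairIdx_injective ·)]
  exact Finset.sum_congr rfl fun p _ => by rw [pairIdx_mod]

theorem TrieInv.expand (h : TrieInv Γ T owner v W s) (hnode : s.var .node = v)
    (hv : v < s.arr .start v)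
    (hstart : s'.arr .start = Function.update (s.arr .start) (v + 1) (s.arr .start v))
    (hvar : s'.var = s.var) (harr : ∀ A, A ≠ .start → s'.arr A = s.arr A) :
    Expanding Γ T owner v W s' := by
  have hsv : s'.arr .start (v + 1) = s.arr .start v := by rw [hstart, Function.update_self]
  refine ⟨⟨⟨?_, ?_⟩, ⟨?_, ?_, fun b => ?_⟩, ⟨?_, ?_⟩⟩, ?_, by rw [hvar, hnode]⟩
  · rw [hvar, h.adj.nodes]
  · simp only [harr _, ne_eq, reduceCtorEq, not_false_eq_true]
    exact h.adj.lists
  · rw [hvar, hsv, h.trie.size]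
  · rw [hstart, harr _ (by decide)]
    exact h.trie.trie.expand hv
  · rw [hsv, harr _ (by decide)]
    exact h.trie.child_lt b
  · rw [hsv, harr _ (by decide), harr _ (by decide)]
    exact h.classes.table
  · simp only [harr _, ne_eq, reduceCtorEq, not_false_eq_true]
    exact h.classes.buckets
  · rw [hstart, harr _ (by decide), harr _ (by decide)]
    exact .expand h.trie.child_lt

theorem visitNode_wp (hΓ : Γ.Encodes T es) (h : TrieInv Γ T owner v W s)
    (hnode : s.var .node = v) (hv : v < s.arr .start v) :
    visitNode.wp Γ (fun s' => (∃ W', TrieInv Γ T owner (v + 1) W' s') ∧ Grows v s s' ∧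
      s'.var .node = v + 1 ∧ (∀ x y z, s.arr .cls (pairIdx (x, y)) = v + 1 → T.graph.Adj y z →
        s'.arr .cls (pairIdx (x, z)) ≠ 0) ∧
      s'.time ≤ s.time + classCost n owner (s.arr .cls) (· = v + 1) + 25) s := by
  have hlen := hΓ.len
  have hb := hΓ.bound
  have hle := h.classes.table.le_mul
  obtain ⟨l, hl, hmem, hsum⟩ := h.classes.exists_list owner v
  refine Cmd.wp_then (Q := fun s' => Expanding Γ T owner v W s' ∧ s'.time = s.time + 10)
    ⟨by simp [hnode]; omega, by simp [hnode]; omega, trivial,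
      h.expand hnode hv (by simp [hnode, h.trie.size]) rfl (fun A hA => by simp [hA]),
      by simp⟩ fun s₁ f₁ ⟨h₁, ht₁⟩ => ?_
  refine Cmd.wp_then (Q := fun s' => s'.var .pairPtr = s.arr .head v ∧ s'.time = s.time + 18)
    ⟨by simp [h₁.node]; omega, by simp [h₁.node, f₁.arr .head rfl], by simp [ht₁]⟩
    fun s₂ f₂ ⟨hptr, _⟩ => ?_
  have hcls₂ : s₂.arr .cls = s.arr .cls := by rw [f₂.arr _ rfl, f₁.arr _ rfl]
  refine Cmd.wp_then (visitPairs_wp hΓ (h₁.of_frame f₂) (l := l)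
    (by rwa [hptr, f₂.arr _ rfl, f₁.arr _ rfl]) (by rwa [hcls₂]))
    fun s₃ _ ⟨⟨W', h₃⟩, hgrows, hnew, _⟩ => ?_
  refine Cmd.wp_conseq (Q := fun s' => s'.var .node = v + 1 ∧ s'.time = s₃.time + 4)
    ⟨by simp [h₃.node]; omega, by simp [h₃.node], by simp⟩ fun s₄ f₄ ⟨hnode₄, _⟩ =>
      ⟨⟨W', h₃.inv.of_frame f₄⟩,
        (Grows.of_frame f₁).trans ((Grows.of_frame f₂).trans (hgrows.trans (.of_frame f₄))),
        hnode₄, fun x y z hxy hyz => ?_, by omega⟩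
  rw [f₄.arr _ rfl]
  exact hnew x y z (by rw [hcls₂, hxy]) hyz

theorem classifyEmpty_wp (hΓ : Γ.Encodes T es) {x : Fin n} (hnodes : s.var .nodes = n)
    (hx : s.var .index = x) (hchild : s.var .child = 0)
    (h : Buckets (s.arr .cls) (s.arr .next) (s.arr .head))
    (hcls : s.arr .cls (pairIdx (x, x)) = 0) :
    classifyEmpty.wp Γ (fun s' => s'.var .index = x + 1 ∧
      s'.arr .cls = Function.update (s.arr .cls) (pairIdx (x, x)) 1 ∧
      Buckets (s'.arr .cls) (s'.arr .next) (s'.arr .head) ∧ s'.time = s.time + 42) s := by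
  have hlt := pairIdx_lt (x, x)
  have hpair := pairIdx_mk x x
  have hlen := hΓ.len
  have hb := hΓ.bound
  simp only [classifyEmpty, pushCell, Cmd.wp_seq, Cmd.wp_set, Cmd.wp_put, Expr.Ok, NatOp.Safe,
    Expr.eval, hx, true_and, hnodes, NatOp.eval, Expr.cost, Nat.reduceAdd, Env.tick_var,
    Env.set_var, Function.update_self, ← hpair, ne_eq, reduceCtorEq, not_false_eq_true,
    Function.update_of_ne, hchild, Env.tick_arr, Env.put_arr, Env.set_arr, Env.put_var,
    Env.tick_time, Env.set_time, Env.put_time, and_true]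
  exact ⟨by omega, by omega, by omega, by omega, by omega, by omega, by omega,
    ⟨by omega, by omega⟩, by simpa using h.push hcls 0⟩

theorem makeRoot_wp (hΓ : Γ.Encodes T es) (h : HasAdj Γ T {p | T.graph.Adj p.1 p.2} (2 * n) owner s)
    (hcls : s.arr .cls = 0) (hhead : s.arr .head = 0) (hchild : s.arr .child = 0) :
    makeRoot.wp Γ (fun s' => TrieInv Γ T owner 0 (fun _ => []) s' ∧
      s'.time ≤ s.time + 45 * n + 17) s := by
  have hn := hΓ.length
  have hlen := hΓ.len
  have hb := hΓ.bound
  refine Cmd.wp_conseq (Q := fun s' => s'.arr .start 0 = 1 ∧ s'.var .size = 1 ∧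
    (∀ a, s'.arr .cls a = if ∃ x : Fin n, pairIdx (x, x) = a then 1 else 0) ∧
    Buckets (s'.arr .cls) (s'.arr .next) (s'.arr .head) ∧ s'.time ≤ s.time + 45 * n + 17) ?_
    fun s' f ⟨hstart, hsize, hdiag, hbuckets, ht⟩ => ⟨⟨h.of_frame f, ⟨by rw [hsize, hstart],
      .singleton hstart rfl, fun b => by rw [f.arr _ rfl, hchild, hstart]; exact one_pos⟩,
      ⟨by rw [hstart]; exact .diagonal (by omega) rfl _ hdiag, hbuckets⟩⟩, ht⟩
  simp only [makeRoot, Cmd.wp_seq, Cmd.wp_put, Cmd.wp_set]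
  refine ⟨by simp [hb], by simp; omega, by simp [hb], by simp [hb], by simp [hb], by simp [hb],
    Cmd.wp_for (fun k s' => s'.var .index = k ∧
      (∀ a, s'.arr .cls a = if ∃ x : Fin n, x < k ∧ pairIdx (x, x) = a then 1 else 0) ∧
      Buckets (s'.arr .cls) (s'.arr .next) (s'.arr .head) ∧ s'.time ≤ s.time + 45 * k + 14)
      (lo := 0) (hi := n) n.zero_le ?_ ?_ ?_ ?_⟩
  · simpa [hcls, hhead] using Buckets.empty _
  · rintro k s' f ⟨hk, -⟩ _
    simpa [hk] using (f.var .nodes rfl).trans h.nodes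
  · rintro k s' f ⟨hk, hdiag, hbuckets, ht⟩ hk'
    obtain ⟨x, rfl⟩ : ∃ x : Fin n, x = k := ⟨⟨k, hk'⟩, rfl⟩
    have hlt : ∀ y : Fin n, y < x.val + 1 ↔ y = x ∨ y < x.val := fun y => by omega
    refine Cmd.wp_mono (fun s₁ ⟨hk₁, hcls₁, hbuckets₁, ht₁⟩ =>
      ⟨hk₁, fun a => ?_, hbuckets₁, by simp only [Env.tick_time, Expr.cost] at ht₁; omega⟩)
      (classifyEmpty_wp hΓ (x := x) ((f.var .nodes rfl).trans h.nodes) hk (f.var .child rfl)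
        hbuckets (by simp [hdiag, pairIdx_injective.eq_iff]))
    obtain rfl | ha := eq_or_ne a (pairIdx (x, x))
    · simp [hcls₁, pairIdx_injective.eq_iff]
    · simp [hcls₁, ha, hdiag, hlt, or_and_right, exists_or, ha.symm]
  · rintro s' f ⟨-, hdiag, hbuckets, ht⟩
    exact ⟨congrFun (f.arr .start rfl) 0, f.var .size rfl, fun a => by simp [hdiag], hbuckets,
      by simp; omega⟩

/-- A complete trie of the words of all paths, whose `m` nodes are the classes of the paths. -/
structure HasSuffixTrie {n σ : ℕ} (Γ : Ctx) (T : UnrootedTree n σ) (m : ℕ) (W : ℕ → List ℕ)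
    (s : Env) : Prop where
  nodes : s.var .nodes = n
  size : s.var .size = m
  start_self : s.arr .start m = m
  trie : IsTrie Γ.lam (n - 1) (s.arr .start) (s.arr .letter) m W
  classes : HasClasses T m W s
  cls_ne_zero : ∀ p : Fin n × Fin n, s.arr .cls (pairIdx p) ≠ 0

theorem sum_listDegree_le (n : ℕ) (owner : ℕ → ℕ) :
    ∑ y : Fin n, listDegree n owner y ≤ 2 * n := by
  have hinj : Set.InjOn (fun y : Fin n => y.val + 1) (Finset.univ : Finset (Fin n)) :=
    fun x _ y _ e => Fin.ext (Nat.succ_injective e)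
  simp only [listDegree]
  rw [← Finset.sum_image
    (f := fun c => (Finset.filter (owner · = c) (Finset.range (2 * n))).card) hinj,
    Finset.sum_card_fiberwise_eq_card_filter]
  exact (Finset.card_filter_le _ _).trans (Finset.card_range _).le

theorem classCost_le (n : ℕ) (owner cls : ℕ → ℕ) (C : ℕ → Prop) [DecidablePred C] :
    classCost n owner cls C ≤ 358 * (n * n) := by
  calc classCost n owner cls C ≤ ∑ p : Fin n × Fin n, pairCost n owner p.2 :=
        Finset.sum_le_sum_of_subset (Finset.filter_subset _ _)
    _ = n * (161 * ∑ y : Fin n, listDegree n owner y + 36 * n) := by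
        simp [Fintype.sum_prod_type, pairCost, Finset.sum_add_distrib, ← Finset.mul_sum]
        ring
    _ ≤ n * (161 * (2 * n) + 36 * n) := by gcongr; exact sum_listDegree_le n owner
    _ = 358 * (n * n) := by ring

theorem Grows.classCost_succ (h : Grows v s s') (owner : ℕ → ℕ) :
    classCost n owner (s'.arr .cls) (fun c => c ≠ 0 ∧ c ≤ v + 1) =
      classCost n owner (s.arr .cls) (fun c => c ≠ 0 ∧ c ≤ v) +
        classCost n owner (s.arr .cls) (· = v + 1) := by
  simp only [classCost, Finset.sum_filter, ← Finset.sum_add_distrib]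
  refine Finset.sum_congr rfl fun p _ => ?_
  by_cases hp : s.arr .cls (pairIdx p) = 0
  · have hnew := h.new _ hp
    rw [if_neg (by omega), if_neg (by omega), if_neg (by omega),
      add_zero]
  · rw [h.cls _ hp]
    split_ifs <;> omega

/-- All paths that extend a path in a class below `v` by an edge are classified. -/
def IsClosedBelow {n σ : ℕ} (T : UnrootedTree n σ) (v : ℕ) (s : Env) : Prop :=
  ∀ x y z, s.arr .cls (pairIdx (x, y)) ≠ 0 → s.arr .cls (pairIdx (x, y)) ≤ v →
    T.graph.Adj y z → s.arr .cls (pairIdx (x, z)) ≠ 0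

theorem IsClosedBelow.succ (h : IsClosedBelow T v s) (hs : Grows v s s')
    (hnew : ∀ x y z, s.arr .cls (pairIdx (x, y)) = v + 1 → T.graph.Adj y z →
      s'.arr .cls (pairIdx (x, z)) ≠ 0) : IsClosedBelow T (v + 1) s' := by
  intro x y z hxy hle hyz
  have hxy' : s.arr .cls (pairIdx (x, y)) ≠ 0 := fun h0 => (hs.new _ h0 hxy).not_ge hle
  rw [hs.cls _ hxy'] at hle
  obtain hle | heq := Nat.le_succ_iff.1 hle
  exacts [hs.ne_zero (h x y z hxy' hle hyz), hnew x y z heq hyz]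

theorem TrieInv.hasSuffixTrie (h : TrieInv Γ T owner v W s) (hv : s.arr .start v ≤ v)
    (hclosed : IsClosedBelow T v s) : HasSuffixTrie Γ T v W s := by
  have hstart : s.arr .start v = v := hv.antisymm h.trie.trie.le_start
  have hclasses := h.classes
  rw [hstart] at hclasses
  refine ⟨h.adj.nodes, by rw [h.trie.size, hstart], hstart, h.trie.trie, hclasses, fun (x, y) => ?_⟩
  refine T.of_adj_closed (S := fun y => s.arr .cls (pairIdx (x, y)) ≠ 0) x
    (by simp [hclasses.table.diag]) (fun y z hyz hy => ?_) y
  obtain ⟨c, hc⟩ := Nat.exists_eq_succ_of_ne_zero hy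
  exact hclosed x y z hy (hc ▸ (hclasses.table.word _ c hc).1) hyz

theorem buildTrie_wp (hΓ : Γ.Encodes T es)
    (h : HasAdj Γ T {p | T.graph.Adj p.1 p.2} (2 * n) owner s)
    (hcls : s.arr .cls = 0) (hhead : s.arr .head = 0) (hchild : s.arr .child = 0) :
    buildTrie.wp Γ (fun s' => (∃ m W, HasSuffixTrie Γ T m W s') ∧
      s'.time ≤ s.time + 386 * (n * n) + 45 * n + 22) s := by
  have hb := hΓ.bound
  refine Cmd.wp_then (makeRoot_wp hΓ h hcls hhead hchild) fun s₁ _ ⟨h₁, _⟩ => ?_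
  refine Cmd.wp_then (Q := fun s' => s'.var .node = 0 ∧ s'.time = s₁.time + 2)
    ⟨by simp [hb], by simp, by simp⟩ fun s₂ f₂ ⟨hnode, _⟩ => ?_
  refine Cmd.loop_wp (fun r s' => ∃ v W, r = n * n - v ∧ TrieInv Γ T owner v W s' ∧
    s'.var .node = v ∧ IsClosedBelow T v s' ∧
    s'.time ≤ s₂.time + 28 * v + classCost n owner (s'.arr .cls) (fun c => c ≠ 0 ∧ c ≤ v))
    (k := n * n) ⟨0, _, rfl, h₁.of_frame f₂, hnode,
      fun x y z hxy hxy' => absurd (Nat.le_zero.1 hxy') hxy, by omega⟩ ?_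
  rintro _ s₃ ⟨v, W, rfl, h₃, hnode₃, hclosed, ht₃⟩
  have f := Cmd.Frame.tick s₃ 3
  have hle := h₃.classes.table.le_mul
  refine ⟨trivial, trivial, fun hc => ?_, fun hc => ?_⟩ <;>
    simp only [Expr.eval, hnode₃, h₃.trie.size, Cmp.Test, not_lt] at hc
  · refine Cmd.wp_mono (fun s₄ ⟨⟨W', h₄⟩, hgrows, hnode₄, hnew, ht₄⟩ =>
      ⟨_, by omega, v + 1, W', rfl, h₄, hnode₄,
        hclosed.succ (.trans (.of_frame f) hgrows) hnew, ?_⟩)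
      (visitNode_wp hΓ (h₃.of_frame f) hnode₃ hc)
    rw [hgrows.classCost_succ]
    simp only [Env.tick_time, Env.tick_arr, Expr.cost] at ht₄ ⊢
    omega
  · refine ⟨⟨v, W, (h₃.of_frame f).hasSuffixTrie hc hclosed⟩, ?_⟩
    have hv := h₃.trie.trie.le_start
    have hcost := classCost_le n owner (s₃.arr .cls) (fun c => c ≠ 0 ∧ c ≤ v)
    simp only [Env.tick_time, Expr.cost]
    omega

end

end WordRAM

/-! ### Minimal absent words in a suffix trie -/

theorem minimalAbsentWords_map {α β : Type*} {f : α → β} (hf : Function.Injective f)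
    (L : Language α) :
    minimalAbsentWords (Language.map f L) = List.map f '' minimalAbsentWords L := by
  have hmem : ∀ z, List.map f z ∈ Language.map f L ↔ z ∈ L :=
    fun z => (List.map_injective_iff.2 hf).mem_set_image
  ext z
  constructor
  · rintro ⟨a, u, b, rfl, habsent, ⟨v, hv, hav⟩, hub⟩
    obtain ⟨a, u, rfl, rfl, rfl⟩ := List.map_eq_cons_iff.1 hav
    obtain ⟨w, hw, hwub⟩ := hub
    obtain ⟨u', l, rfl, hu, hl⟩ := List.map_eq_append_iff.1 hwub
    obtain rfl := List.map_injective_iff.2 hf hu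
    obtain ⟨b, rfl, rfl⟩ := List.map_eq_singleton_iff.1 hl
    refine ⟨_, ⟨a, u', b, rfl, fun h => habsent ?_, hv, hw⟩, by simp⟩
    simpa using (hmem _).2 h
  · rintro ⟨_, ⟨a, u, b, rfl, habsent, hau, hub⟩, rfl⟩
    refine ⟨f a, u.map f, f b, by simp, ?_, ?_, ?_⟩
    · simpa using mt (hmem (a :: (u ++ [b]))).1 habsent
    · simpa using (hmem (a :: u)).2 hau
    · simpa using (hmem (u ++ [b])).2 hub

/-- The words of a tree, over the natural numbers. -/
def UnrootedTree.natLanguage {n σ : ℕ} (T : UnrootedTree n σ) : Language ℕ :=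
  Language.map Fin.val T.language

theorem UnrootedTree.mem_natLanguage_iff {n σ : ℕ} (T : UnrootedTree n σ) {z : List ℕ} :
    z ∈ T.natLanguage ↔ ∃ x y, T.natWord x y = z := by
  constructor
  · rintro ⟨_, ⟨x, y, p, hp, rfl⟩, rfl⟩
    exact ⟨x, y, by rw [natWord, T.eq_path hp]⟩
  · rintro ⟨x, y, rfl⟩
    exact ⟨_, ⟨x, y, T.path x y, T.path_isPath x y, rfl⟩, rfl⟩

/-- The children of the trie node `u` whose letters are not letters of children of the trie
node `v`. -/
def missingChildren (start letter : ℕ → ℕ) (u v : ℕ) : List ℕ :=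
  (List.Ico (start u) (start (u + 1))).filter
    (letter · ∉ (Finset.Ico (start v) (start (v + 1))).image letter)

/-- The word of the trie node `link v` is that of the trie node `v` without its first letter. -/
def IsSuffixLink (m : ℕ) (W : ℕ → List ℕ) (link : ℕ → ℕ) : Prop :=
  ∀ v < m, v ≠ 0 → link v < m ∧ ∃ a, W v = a :: W (link v)

/-- The minimal absent words whose longest proper prefix belongs to the trie node `v`, as they are
found by means of suffix links. -/
def absentExtensions (lam start letter : ℕ → ℕ) (W : ℕ → List ℕ) (link : ℕ → ℕ) (v : ℕ) :
    List (List ℕ) :=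
  (missingChildren start letter (link v) v).map fun k => W v ++ [lam (letter k)]

namespace IsTrie

variable {lam : ℕ → ℕ} {N : ℕ} {start letter : ℕ → ℕ} {m u v : ℕ} {W : ℕ → List ℕ} {link : ℕ → ℕ}

theorem lt_of_child (h : IsTrie lam N start letter m W) (hv : v < m) {k : ℕ}
    (hk : k < start (v + 1)) : k < start m :=
  hk.trans_le (h.start_mono hv le_rfl)

theorem eq_append_iff (h : IsTrie lam N start letter m W) (hv : v < m) {k : ℕ} (hk : k < start m)
    {b : ℕ} : W k = W v ++ [b] ↔
      (start v ≤ k ∧ k < start (v + 1)) ∧ lam (letter k) = b := by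
  constructor
  · intro e
    have hk0 : k ≠ 0 := by
      rintro rfl
      simp [h.root] at e
    obtain ⟨c, hc, hck, hkc⟩ := h.exists_parent hk0 hk
    obtain ⟨hcv, hb⟩ := List.append_inj' ((h.child c hc k hck hkc).1.symm.trans e) rfl
    obtain rfl := h.injOn (hc.trans_le h.le_start) (hv.trans_le h.le_start) hcv
    exact ⟨⟨hck, hkc⟩, by simpa using hb⟩
  · rintro ⟨⟨hvk, hkv⟩, rfl⟩
    exact (h.child v hv k hvk hkv).1

theorem exists_missingChild_iff (h : IsTrie lam N start letter m W) (hu : u < m) (hv : v < m)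
    {b : ℕ} : (∃ k ∈ missingChildren start letter u v, lam (letter k) = b) ↔
      (∃ k < start m, W k = W u ++ [b]) ∧ ∀ k < start m, W k ≠ W v ++ [b] := by
  simp only [missingChildren, List.mem_filter, List.Ico.mem, Finset.mem_image, Finset.mem_Ico,
    decide_eq_true_eq, not_exists, not_and]
  constructor
  · rintro ⟨k, ⟨hk, hmissing⟩, rfl⟩
    refine ⟨⟨k, h.lt_of_child hu hk.2, (h.child u hu k hk.1 hk.2).1⟩, fun l hl e => ?_⟩
    obtain ⟨hl', e'⟩ := (h.eq_append_iff hv hl).1 e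
    exact hmissing l hl' ((h.child v hv l hl'.1 hl'.2).2.eq (h.child u hu k hk.1 hk.2).2 e')
  · rintro ⟨⟨k, hk, e⟩, habsent⟩
    obtain ⟨hk', rfl⟩ := (h.eq_append_iff hu hk).1 e
    refine ⟨k, ⟨hk', fun l hl e' => ?_⟩, rfl⟩
    have hl' := h.lt_of_child hv hl.2
    exact habsent l hl' ((h.eq_append_iff hv hl').2 ⟨hl, by rw [e']⟩)

theorem sub_le_length_missingChildren (h : IsTrie lam N start letter m W) (hu : u < m) (v : ℕ) :
    start (u + 1) - start u ≤
      (missingChildren start letter u v).length + (start (v + 1) - start v) := by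
  set A := (Finset.Ico (start v) (start (v + 1))).image letter
  calc start (u + 1) - start u = ((Finset.Ico (start u) (start (u + 1))).image letter).card := by
        rw [Finset.card_image_of_injOn (by simpa using h.letter_injOn hu), Nat.card_Ico]
    _ ≤ (((missingChildren start letter u v).map letter).toFinset ∪ A).card := by
        refine Finset.card_le_card fun b hb => ?_
        obtain ⟨k, hk, rfl⟩ := Finset.mem_image.1 hb
        rw [Finset.mem_union, or_iff_not_imp_right]
        exact fun hA => List.mem_toFinset.2 (List.mem_map_of_mem
          (List.mem_filter.2 ⟨List.Ico.mem.2 (Finset.mem_Ico.1 hk), decide_eq_true hA⟩))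
    _ ≤ (missingChildren start letter u v).length + (start (v + 1) - start v) := by
        refine (Finset.card_union_le _ _).trans (add_le_add ?_ ?_)
        · exact (List.toFinset_card_le _).trans (List.length_map _).le
        · exact Finset.card_image_le.trans (Nat.card_Ico _ _).le

theorem nodup_flatMap_absentExtensions (h : IsTrie lam N start letter m W)
    (hlink : IsSuffixLink m W link) :
    ((List.Ico 1 m).flatMap (absentExtensions lam start letter W link)).Nodup := by
  refine List.nodup_flatMap.2 ⟨fun v hv => ?_, (List.Ico.nodup 1 m).pairwise_of_forall_ne ?_⟩
  · rw [List.Ico.mem] at hv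
    obtain ⟨hu, -⟩ := hlink v hv.2 (by omega)
    refine List.Nodup.map_on (fun k hk l hl e => ?_) ((List.Ico.nodup _ _).filter _)
    replace hk := List.Ico.mem.1 (List.mem_of_mem_filter hk)
    replace hl := List.Ico.mem.1 (List.mem_of_mem_filter hl)
    refine h.letter_injOn hu hk hl ((h.child _ hu k hk.1 hk.2).2.eq (h.child _ hu l hl.1 hl.2).2 ?_)
    simpa using e
  · intro v hv v' hv' hne z hz hz'
    obtain ⟨k, -, rfl⟩ := List.mem_map.1 hz
    obtain ⟨k', -, e⟩ := List.mem_map.1 hz'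
    exact hne (h.injOn ((List.Ico.mem.1 hv).2.trans_le h.le_start)
      ((List.Ico.mem.1 hv').2.trans_le h.le_start) (List.append_inj' e rfl).1.symm)

theorem mem_flatMap_absentExtensions_iff (h : IsTrie lam N start letter m W) (hm : start m = m)
    (hlink : IsSuffixLink m W link) {L : Language ℕ} (hL : ∀ z, z ∈ L ↔ ∃ k < m, W k = z)
    {z : List ℕ} :
    z ∈ (List.Ico 1 m).flatMap (absentExtensions lam start letter W link) ↔
      z ∈ minimalAbsentWords L := by
  have key : ∀ v < m, v ≠ 0 → ∀ b,
      (∃ k ∈ missingChildren start letter (link v) v, lam (letter k) = b) ↔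
        W (link v) ++ [b] ∈ L ∧ W v ++ [b] ∉ L := fun v hv hv0 b => by
    simp [h.exists_missingChild_iff (hlink v hv hv0).1 hv, hm, hL]
  simp only [List.mem_flatMap, List.Ico.mem, absentExtensions, List.mem_map]
  constructor
  · rintro ⟨v, ⟨hv1, hv⟩, k, hk, rfl⟩
    obtain ⟨-, a, ha⟩ := hlink v hv (by omega)
    obtain ⟨hsuffix, habsent⟩ := (key v hv (by omega) _).1 ⟨k, hk, rfl⟩
    rw [ha] at habsent ⊢
    exact ⟨a, _, _, rfl, habsent, (hL _).2 ⟨v, hv, ha⟩, hsuffix⟩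
  · rintro ⟨a, u, b, rfl, habsent, hau, hub⟩
    obtain ⟨v, hv, hav⟩ := (hL _).1 hau
    have hv0 : v ≠ 0 := by
      rintro rfl
      simp [h.root] at hav
    obtain ⟨-, a', ha'⟩ := hlink v hv hv0
    obtain ⟨rfl, rfl⟩ := List.cons_eq_cons.1 (hav.symm.trans ha')
    obtain ⟨k, hk, rfl⟩ := (key v hv hv0 b).2 ⟨hub, by rwa [hav]⟩
    exact ⟨v, ⟨by omega, hv⟩, k, hk, by rw [hav, List.cons_append]⟩

end IsTrie

/-! ### Reporting the minimal absent words -/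

namespace WordRAM

/-- Mark the letters of the children of the current trie node. -/
def markChildren : Cmd :=
  .set .index (.get .start (.var .node)) ;;
  .loop .lt (.var .index) (.get .start (.bin .add (.var .node) (.lit 1)))
    (.put .mark (.get .letter (.var .index)) (.var .node) ;;
      .set .index (.bin .add (.var .index) (.lit 1)))

/-- Output the path from `src` to `dst` with the letter of the trie node `index`, unless this letter
is marked, and go to the next trie node. -/
def reportChild : Cmd :=
  .ite .ne (.get .mark (.get .letter (.var .index))) (.var .node)
    (.emit (.var .src) ;; .emit (.var .dst) ;; .emit (edgeLetter (.get .letter (.var .index))))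
    .skip ;;
  .set .index (.bin .add (.var .index) (.lit 1))

/-- Output the path from `src` to `dst` with the unmarked letters of the children of the trie node
`child`. -/
def reportChildren : Cmd :=
  .set .index (.get .start (.var .child)) ;;
  .loop .lt (.var .index) (.get .start (.bin .add (.var .child) (.lit 1))) reportChild

/-- Load the first path in the class of the current trie node and follow the suffix link, which is
the class of the same path without its first edge. -/
def followLink : Cmd :=
  .set .pair (.bin .sub (.get .head (.var .node)) (.lit 1)) ;;
  .set .src (.bin .div (.var .pair) (.var .nodes)) ;;
  .set .dst (.bin .mod (.var .pair) (.var .nodes)) ;;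
  .set .child (.bin .sub
    (.get .cls (.bin .add (.var .dst) (.bin .mul (.var .nodes) (.get .first (.var .pair)))))
    (.lit 1))

/-- Output the minimal absent words whose longest proper prefix belongs to the current trie node,
and go to the next trie node. -/
def reportNode : Cmd :=
  followLink ;;
  markChildren ;;
  reportChildren ;;
  .set .node (.bin .add (.var .node) (.lit 1))

/-- Output all minimal absent words. -/
def report : Cmd :=
  .set .node (.lit 1) ;;
  .loop .lt (.var .node) (.var .size) reportNode

/-- The numbers that are output for two nodes and a letter. -/
def tripleOut {n : ℕ} (t : (Fin n × Fin n) × ℕ) : List ℕ :=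
  [t.1.1, t.1.2, t.2]

/-- The triples that are output for the minimal absent words whose longest proper prefix belongs to
the trie node `v`. -/
def absentTriples {n : ℕ} (lam start letter : ℕ → ℕ) (path : ℕ → Fin n × Fin n) (link : ℕ → ℕ)
    (v : ℕ) : List ((Fin n × Fin n) × ℕ) :=
  (missingChildren start letter (link v) v).map fun k => (path v, lam (letter k))

/-- The machine holds, for every trie node `v` except the root, the path `path v` in its class and
the class `link v` of the path without its first edge. -/
structure HasLinks {n σ : ℕ} (T : UnrootedTree n σ) (m : ℕ) (W : ℕ → List ℕ)
    (path : ℕ → Fin n × Fin n) (link : ℕ → ℕ) (s : Env) : Prop where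
  isSuffixLink : IsSuffixLink m W link
  word : ∀ v < m, W v = T.natWord (path v).1 (path v).2
  head : ∀ v < m, s.arr .head v = pairIdx (path v) + 1
  first : ∀ v < m, v ≠ 0 → ∃ f : Fin n, s.arr .first (pairIdx (path v)) = f ∧
    s.arr .cls (pairIdx (f, (path v).2)) = link v + 1

section

variable {n σ m v : ℕ} {Γ : Ctx} {T : UnrootedTree n σ} {es : List T.graph.Dart} {s s' : Env}
  {W : ℕ → List ℕ} {path : ℕ → Fin n × Fin n} {link : ℕ → ℕ}

theorem HasSuffixTrie.exists_path (h : HasSuffixTrie Γ T m W s) (hv : v < m) :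
    ∃ p : Fin n × Fin n, W v = T.natWord p.1 p.2 ∧ s.arr .head v = pairIdx p + 1 := by
  obtain ⟨q, hq⟩ := h.classes.table.surj v hv
  obtain ⟨hhead, howner⟩ := h.classes.buckets.owner_head hq
  obtain ⟨p, hp⟩ := h.classes.table.pair _ (by rw [howner]; exact v.succ_ne_zero)
  rw [← hp] at howner
  exact ⟨p, (h.classes.table.word p v howner).2, by omega⟩

theorem HasSuffixTrie.exists_link (h : HasSuffixTrie Γ T m W s) (hv : v < m) (hv0 : v ≠ 0)
    {x y : Fin n} (hW : W v = T.natWord x y) :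
    ∃ u < m, (∃ a, W v = a :: W u) ∧
      ∃ f : Fin n, s.arr .first (pairIdx (x, y)) = f ∧ s.arr .cls (pairIdx (f, y)) = u + 1 := by
  have hxy : x ≠ y := by
    rintro rfl
    rw [T.natWord_self, ← h.trie.root] at hW
    have hlt : ∀ c < m, c < s.arr .start m := fun c hc => by rwa [h.start_self]
    exact hv0 (h.trie.injOn (hlt v hv) (hlt 0 (by omega)) hW)
  obtain ⟨f, hf, hfirst⟩ := h.classes.table.first x y hxy (h.cls_ne_zero _)
  obtain ⟨u, hu⟩ := Nat.exists_eq_succ_of_ne_zero (h.cls_ne_zero (f, y))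
  obtain ⟨hum, hWu⟩ := h.classes.table.word _ u hu
  exact ⟨u, hum, ⟨_, by rw [hW, hfirst.natWord, hWu]⟩, f, hf, hu⟩

theorem HasSuffixTrie.exists_hasLinks (h : HasSuffixTrie Γ T m W s) :
    ∃ path link, HasLinks T m W path link s := by
  have hm : 0 < m := Nat.pos_of_ne_zero fun hm => by
    simpa [hm, h.trie.start_zero] using h.start_self
  have : Nonempty (Fin n × Fin n) := (h.exists_path hm).nonempty
  choose! path hword hhead using fun v (hv : v < m) => h.exists_path hv
  choose! link hlt hcons hfirst using fun v (hv : v < m) (hv0 : v ≠ 0) =>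
    h.exists_link hv hv0 (hword v hv)
  exact ⟨path, link, fun v hv hv0 => ⟨hlt v hv hv0, hcons v hv hv0⟩, hword, hhead, hfirst⟩

theorem HasSuffixTrie.of_frame (h : HasSuffixTrie Γ T m W s) {p : Cmd} (hp : p.Frame s s')
    (hvar : (∀ a ∈ [Var.nodes, .size], p.assigns a = false) := by decide)
    (harr : (∀ A ∈ [Arr.cls, .first, .next, .head, .start, .letter], p.writes A = false) := by
      decide) :
    HasSuffixTrie Γ T m W s' where
  nodes := (hp.var _ (hvar .nodes (by simp))).trans h.nodes
  size := (hp.var _ (hvar .size (by simp))).trans h.size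
  start_self := by rw [hp.arr _ (harr .start (by simp)), h.start_self]
  trie := by
    rw [hp.arr _ (harr .start (by simp)), hp.arr _ (harr .letter (by simp))]
    exact h.trie
  classes := h.classes.of_frame hp fun A hA => harr A (List.mem_append_left [_, _] hA)
  cls_ne_zero := by
    rw [hp.arr _ (harr .cls (by simp))]
    exact h.cls_ne_zero

theorem HasLinks.of_frame (h : HasLinks T m W path link s) {p : Cmd} (hp : p.Frame s s')
    (harr : (∀ A ∈ [Arr.cls, .first, .head], p.writes A = false) := by decide) :
    HasLinks T m W path link s' where
  isSuffixLink := h.isSuffixLink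
  word := h.word
  head := by
    rw [hp.arr _ (harr .head (by simp))]
    exact h.head
  first := by
    rw [hp.arr _ (harr .first (by simp)), hp.arr _ (harr .cls (by simp))]
    exact h.first

theorem followLink_wp (hΓ : Γ.Encodes T es) (h : HasSuffixTrie Γ T m W s)
    (hl : HasLinks T m W path link s) (hv : v < m) (hv0 : v ≠ 0) (hnode : s.var .node = v) :
    followLink.wp Γ (fun s' => s'.var .src = (path v).1 ∧ s'.var .dst = (path v).2 ∧
      s'.var .child = link v ∧ s'.time = s.time + 38) s := by
  obtain ⟨f, hfirst, hcls⟩ := hl.first v hv hv0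
  have hlen := hΓ.len
  have hb := hΓ.bound
  have hle := h.classes.table.le_mul
  have hlt := pairIdx_lt (path v)
  have hlt' := pairIdx_lt (f, (path v).2)
  have hmk := pairIdx_mk f (path v).2
  have hmul : n * (f : ℕ) < n * n := by omega
  simp [followLink, hnode, hl.head v hv, h.nodes, hfirst, pairIdx_div, pairIdx_mod, ← hmk, hcls]
  omega

theorem mem_image_Ico_succ {f : ℕ → ℕ} {a b k : ℕ} (hak : a ≤ k) :
    b ∈ (Finset.Ico a (k + 1)).image f ↔ f k = b ∨ b ∈ (Finset.Ico a k).image f := by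
  rw [← Finset.insert_Ico_right_eq_Ico_add_one hak, Finset.image_insert, Finset.mem_insert, eq_comm]

theorem markChildren_wp (hΓ : Γ.Encodes T es) (h : HasSuffixTrie Γ T m W s) (hv : v < m)
    (hnode : s.var .node = v) (hmark : ∀ b, s.arr .mark b < v) :
    markChildren.wp Γ (fun s' => (∀ b, s'.arr .mark b < v + 1) ∧
      (∀ b, s'.arr .mark b = v ↔
        b ∈ (Finset.Ico (s.arr .start v) (s.arr .start (v + 1))).image (s.arr .letter)) ∧
      s'.time ≤ s.time + 19 + 29 * (s.arr .start (v + 1) - s.arr .start v)) s := by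
  have hlen := hΓ.len
  have hb := hΓ.bound
  have hle := h.classes.table.le_mul
  have hstart : s.arr .start v ≤ s.arr .start (v + 1) := h.trie.start_le v hv
  refine Cmd.wp_then (Q := fun s' => s'.var .index = s.arr .start v ∧ s'.time = s.time + 8)
    ⟨by simp [hnode]; omega, by simp [hnode], by simp⟩ fun s₁ f₁ ⟨hindex, _⟩ => ?_
  refine Cmd.wp_for (fun k s' => s'.var .index = k ∧ s.arr .start v ≤ k ∧
    (∀ b, s'.arr .mark b < v + 1) ∧
    (∀ b, s'.arr .mark b = v ↔ b ∈ (Finset.Ico (s.arr .start v) k).image (s.arr .letter)) ∧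
    s'.time ≤ s₁.time + 29 * (k - s.arr .start v)) hstart ?_ ?_ ?_ ?_
  · simp [hindex, f₁.arr .mark rfl, fun b => (hmark b).ne, fun b => (hmark b).le]
  · rintro k s₂ f₂ ⟨hk, -⟩ -
    simp [hk, f₂.var .node rfl, f₁.var .node rfl, f₂.arr .start rfl, f₁.arr .start rfl, hnode]
    omega
  · rintro k s₂ f₂ ⟨hk, hvk, hlt, hiff, ht⟩ hkv
    have hletter := (h.trie.child v hv k hvk hkv).2.lt
    have hk' := h.trie.lt_of_child hv hkv
    rw [h.start_self] at hk'
    have hnode₂ : s₂.var .node = v := by rw [f₂.var _ rfl, f₁.var _ rfl, hnode]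
    have hletter₂ : s₂.arr .letter = s.arr .letter := by rw [f₂.arr _ rfl, f₁.arr _ rfl]
    simp only [Cmd.wp_seq, Cmd.wp_put, Cmd.wp_set]
    refine ⟨by simp [hk]; omega, by simp [hk, hletter₂]; omega, by simp, by simp [hk]; omega,
      by simp [hk], hvk.trans k.le_succ, fun b => ?_, fun b => ?_, ?_⟩
    · obtain rfl | hb := eq_or_ne b (s.arr .letter k)
      · simp [hk, hletter₂, hnode₂]
      · simpa [hk, hletter₂, hb] using hlt b
    · rw [mem_image_Ico_succ hvk]
      obtain rfl | hb := eq_or_ne b (s.arr .letter k)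
      · simp [hk, hletter₂, hnode₂]
      · simpa [hk, hletter₂, hb, hb.symm] using hiff b
    · simp
      omega
  · rintro s₂ - ⟨-, -, hlt, hiff, ht⟩
    exact ⟨hlt, hiff, by simp; omega⟩

theorem reportChild_wp (hΓ : Γ.Encodes T es) {x y : Fin n} {k b : ℕ} (hsrc : s.var .src = x)
    (hdst : s.var .dst = y) (hnode : s.var .node = v) (hk : s.var .index = k) (hkn : k < n * n)
    (hb : s.arr .letter k = b) (hbn : b < n - 1) :
    reportChild.wp Γ (fun s' => s'.var .index = k + 1 ∧
      s'.out = s.out ++ (if s.arr .mark b = v then [] else tripleOut ((x, y), Γ.lam b)) ∧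
      s'.time ≤ s.time + 36) s := by
  have hbase := hΓ.base
  have hlen := hΓ.len
  have hbound := hΓ.bound
  simp only [reportChild, Cmd.wp_seq, Cmd.wp_ite]
  refine ⟨by simp [hk, hb]; omega, by simp, fun hc => ?_, fun hc => ?_⟩ <;>
    simp only [Expr.eval, hk, hb, hnode, Cmp.Test, ne_eq, not_not] at hc
  · simp [edgeLetter, hk, hb, hc, hsrc, hdst, tripleOut, Ctx.lam]
    omega
  · simp [hk, hc]
    omega

theorem reportChildren_wp (hΓ : Γ.Encodes T es) (h : HasSuffixTrie Γ T m W s)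
    (hu : link v < m) (hsrc : s.var .src = (path v).1) (hdst : s.var .dst = (path v).2)
    (hchild : s.var .child = link v) (hnode : s.var .node = v)
    (hmark : ∀ b, s.arr .mark b = v ↔
      b ∈ (Finset.Ico (s.arr .start v) (s.arr .start (v + 1))).image (s.arr .letter)) :
    reportChildren.wp Γ (fun s' =>
      s'.out = s.out ++
        (absentTriples Γ.lam (s.arr .start) (s.arr .letter) path link v).flatMap tripleOut ∧
      s'.time ≤ s.time + 19 + 47 * (s.arr .start (link v + 1) - s.arr .start (link v))) s := by
  have hlen := hΓ.len
  have hb := hΓ.bound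
  have hle := h.classes.table.le_mul
  have hstart : s.arr .start (link v) ≤ s.arr .start (link v + 1) := h.trie.start_le _ hu
  set A := (Finset.Ico (s.arr .start v) (s.arr .start (v + 1))).image (s.arr .letter)
  refine Cmd.wp_then (Q := fun s' => s'.var .index = s.arr .start (link v) ∧ s'.time = s.time + 8)
    ⟨by simp [hchild]; omega, by simp [hchild], by simp⟩ fun s₁ f₁ ⟨hindex, _⟩ => ?_
  refine Cmd.wp_for (fun k s' => s'.var .index = k ∧ s.arr .start (link v) ≤ k ∧
    s'.out = s.out ++ (((List.Ico (s.arr .start (link v)) k).filter (s.arr .letter · ∉ A)).map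
      fun l => (path v, Γ.lam (s.arr .letter l))).flatMap tripleOut ∧
    s'.time ≤ s₁.time + 47 * (k - s.arr .start (link v))) hstart ?_ ?_ ?_ ?_
  · simp [hindex, f₁.out rfl]
  · rintro k s₂ f₂ ⟨hk, -⟩ -
    simp [hk, f₂.var .child rfl, f₁.var .child rfl, f₂.arr .start rfl, f₁.arr .start rfl, hchild]
    omega
  · rintro k s₂ f₂ ⟨hk, huk, hout, ht⟩ hku
    have hletter := (h.trie.child _ hu k huk hku).2.lt
    have hk' := h.trie.lt_of_child hu hku
    rw [h.start_self] at hk'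
    refine Cmd.wp_mono (fun s₃ ⟨hk₃, hout₃, ht₃⟩ => ⟨hk₃, huk.trans k.le_succ, ?_, ?_⟩)
      (reportChild_wp (b := s.arr .letter k) hΓ
        ((f₂.var .src rfl).trans ((f₁.var _ rfl).trans hsrc))
        ((f₂.var .dst rfl).trans ((f₁.var _ rfl).trans hdst))
        ((f₂.var .node rfl).trans ((f₁.var _ rfl).trans hnode)) hk (by omega)
        (congrFun ((f₂.arr .letter rfl).trans (f₁.arr _ rfl)) k) hletter)
    · rw [hout₃, Env.tick_out, Env.tick_arr, f₂.arr .mark rfl, f₁.arr .mark rfl, hout,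
        List.Ico.succ_top huk]
      by_cases hmk : s.arr .mark (s.arr .letter k) = v
      · simp [List.filter_append, List.filter_cons_of_neg, (hmark _).1 hmk, hmk]
      · simp [List.filter_append, List.filter_cons_of_pos, mt (hmark _).2 hmk, hmk]
    · simp only [Env.tick_time, Expr.cost] at ht₃ ⊢
      omega
  · rintro s₂ - ⟨-, -, hout, ht⟩
    exact ⟨hout, by simp; omega⟩

theorem reportNode_wp (hΓ : Γ.Encodes T es) (h : HasSuffixTrie Γ T m W s)
    (hl : HasLinks T m W path link s) (hv : v < m) (hv0 : v ≠ 0) (hnode : s.var .node = v)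
    (hmark : ∀ b, s.arr .mark b < v) :
    reportNode.wp Γ (fun s' => s'.var .node = v + 1 ∧ (∀ b, s'.arr .mark b < v + 1) ∧
      s'.out = s.out ++
        (absentTriples Γ.lam (s.arr .start) (s.arr .letter) path link v).flatMap tripleOut ∧
      s'.time ≤ s.time + 90 + 76 * (s.arr .start (v + 1) - s.arr .start v) +
        47 * (absentTriples Γ.lam (s.arr .start) (s.arr .letter) path link v).length) s := by
  have hu := (hl.isSuffixLink v hv hv0).1
  have hmissing := h.trie.sub_le_length_missingChildren hu v
  have hm := h.classes.table.le_mul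
  have hlen := hΓ.len
  have hb := hΓ.bound
  refine Cmd.wp_then (followLink_wp hΓ h hl hv hv0 hnode) fun s₁ f₁ ⟨hsrc, hdst, hchild, _⟩ => ?_
  have hnode₁ : s₁.var .node = v := (f₁.var _ rfl).trans hnode
  refine Cmd.wp_then (markChildren_wp hΓ (h.of_frame f₁) hv hnode₁
    (by rwa [f₁.arr _ rfl])) fun s₂ f₂ ⟨hlt, hiff, ht₂⟩ => ?_
  have hstart₁ : s₁.arr .start = s.arr .start := f₁.arr _ rfl
  have hstart₂ : s₂.arr .start = s.arr .start := (f₂.arr _ rfl).trans hstart₁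
  have hletter₂ : s₂.arr .letter = s.arr .letter := (f₂.arr _ rfl).trans (f₁.arr _ rfl)
  refine Cmd.wp_then (reportChildren_wp hΓ ((h.of_frame f₁).of_frame f₂) hu
    ((f₂.var _ rfl).trans hsrc) ((f₂.var _ rfl).trans hdst) ((f₂.var _ rfl).trans hchild)
    ((f₂.var _ rfl).trans hnode₁) (by rwa [f₂.arr .start rfl, f₂.arr .letter rfl]))
    fun s₃ f₃ ⟨hout, ht₃⟩ => ?_
  simp only [hstart₁, hstart₂, hletter₂, f₂.out rfl, f₁.out rfl] at hout ht₂ ht₃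
  have hnode₃ : s₃.var .node = v := ((f₃.var _ rfl).trans (f₂.var _ rfl)).trans hnode₁
  have hmark₃ : s₃.arr .mark = s₂.arr .mark := f₃.arr _ rfl
  refine ⟨by simp [hnode₃]; omega, by simp [hnode₃], by simpa [hmark₃] using hlt, hout, ?_⟩
  simp [absentTriples]
  omega

theorem report_wp (hΓ : Γ.Encodes T es) (h : HasSuffixTrie Γ T m W s)
    (hl : HasLinks T m W path link s) (hmark : s.arr .mark = 0) :
    report.wp Γ (fun s' => s'.out = s.out ++ ((List.Ico 1 m).flatMap
        (absentTriples Γ.lam (s.arr .start) (s.arr .letter) path link)).flatMap tripleOut ∧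
      s'.time ≤ s.time + 200 * (n * n) + 47 * ((List.Ico 1 m).flatMap
        (absentTriples Γ.lam (s.arr .start) (s.arr .letter) path link)).length) s := by
  have hlen := hΓ.len
  have hb := hΓ.bound
  have hle := h.classes.table.le_mul
  have hm : 1 ≤ m := Nat.pos_of_ne_zero fun hm => by
    simpa [hm, h.trie.start_zero] using h.start_self
  set triples := absentTriples Γ.lam (s.arr .start) (s.arr .letter) path link
  refine Cmd.wp_then (Q := fun s' => s'.var .node = 1 ∧ s'.time = s.time + 2)
    ⟨by simp; omega, by simp⟩ fun s₁ f₁ ⟨hnode, _⟩ => ?_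
  refine Cmd.wp_for (fun v s' => s'.var .node = v ∧ 1 ≤ v ∧ (∀ b, s'.arr .mark b < v) ∧
    s'.out = s.out ++ ((List.Ico 1 v).flatMap triples).flatMap tripleOut ∧
    s'.time ≤ s₁.time + 93 * (v - 1) + 76 * s.arr .start v +
      47 * ((List.Ico 1 v).flatMap triples).length) hm ?_ ?_ ?_ ?_
  · simp [hnode, f₁.arr .mark rfl, hmark, f₁.out rfl]
  · rintro v s₂ f₂ ⟨hv, -⟩ -
    simp [hv, f₂.var .size rfl, f₁.var .size rfl, h.size]
  · rintro v s₂ f₂ ⟨hv, hv1, hlt, hout, ht⟩ hvm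
    have hstart : s.arr .start v ≤ s.arr .start (v + 1) := h.trie.start_le v hvm
    have hstart₂ : s₂.arr .start = s.arr .start := (f₂.arr _ rfl).trans (f₁.arr _ rfl)
    have hletter₂ : s₂.arr .letter = s.arr .letter := (f₂.arr _ rfl).trans (f₁.arr _ rfl)
    have f := Cmd.Frame.tick s₂ 3
    refine Cmd.wp_mono (fun s₃ ⟨hv₃, hlt₃, hout₃, ht₃⟩ => ⟨hv₃, by omega, hlt₃, ?_, ?_⟩)
      (reportNode_wp hΓ (((h.of_frame f₁).of_frame f₂).of_frame f)
        (((hl.of_frame f₁).of_frame f₂).of_frame f) hvm (by omega) hv hlt)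
    · rw [hout₃, List.Ico.succ_top hv1]
      simp [hstart₂, hletter₂, hout, triples]
    · simp only [Env.tick_time, Expr.cost, Env.tick_arr, hstart₂, hletter₂] at ht₃
      rw [List.Ico.succ_top hv1, List.flatMap_append, List.length_append, List.flatMap_singleton,
        show triples v = absentTriples _ _ _ path link v from rfl]
      omega
  · rintro s₂ - ⟨-, -, -, hout, ht⟩
    rw [h.start_self] at ht
    exact ⟨hout, by simp only [Env.tick_time, Expr.cost]; omega⟩

end

end WordRAM

/-! ### The algorithm -/

/-- The word that is described by two nodes and a letter, over the natural numbers. -/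
noncomputable def UnrootedTree.natTriple {n σ : ℕ} (T : UnrootedTree n σ)
    (t : (Fin n × Fin n) × ℕ) : List ℕ :=
  T.natWord t.1.1 t.1.2 ++ [t.2]

theorem UnrootedTree.length_edgeList_add_one {n σ : ℕ} {T : UnrootedTree n σ}
    {es : List T.graph.Dart} (h : T.IsEdgeList es) : es.length + 1 = n := by
  classical
  have hedges : (es.map SimpleGraph.Dart.edge).toFinset = T.graph.edgeFinset := by
    ext e
    rw [List.mem_toFinset, SimpleGraph.mem_edgeFinset]
    refine ⟨fun he => ?_, h.2 e⟩
    obtain ⟨d, -, rfl⟩ := List.mem_map.1 he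
    exact d.edge_mem
  have hcard := T.isTree.card_edgeFinset
  rwa [← hedges, List.toFinset_card_of_nodup h.1, List.length_map, Fintype.card_fin] at hcard

theorem UnrootedTree.length_encode {n σ : ℕ} {T : UnrootedTree n σ} (es : List T.graph.Dart) :
    (T.encode es).length = 3 * es.length + 1 := by
  simp [encode, List.length_flatMap, mul_comm]

theorem UnrootedTree.lt_of_mem_encode {n σ N : ℕ} {T : UnrootedTree n σ} {es : List T.graph.Dart}
    (hn : n < N) (hσ : σ ≤ N) {a : ℕ} (ha : a ∈ T.encode es) : a < N := by
  obtain rfl | ha := List.mem_cons.1 ha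
  · exact hn
  · obtain ⟨d, -, hd⟩ := List.mem_flatMap.1 ha
    simp only [List.mem_cons, List.not_mem_nil, or_false] at hd
    omega

theorem getD_flatMap_three {α : Type*} (a b c : α → ℕ) (l : List α) (i : ℕ) (hi : i < l.length) :
    (l.flatMap fun d => [a d, b d, c d]).getD (3 * i) 0 = a l[i] ∧
    (l.flatMap fun d => [a d, b d, c d]).getD (3 * i + 1) 0 = b l[i] ∧
    (l.flatMap fun d => [a d, b d, c d]).getD (3 * i + 2) 0 = c l[i] := by
  induction l generalizing i with
  | nil => simp at hi
  | cons d l ih =>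
    cases i with
    | zero => simp
    | succ i => simpa [List.flatMap_cons, mul_add] using ih i (by simpa using hi)

theorem eval_lt_two_pow (q : Polynomial ℕ) {n w : ℕ} (hn : n ≠ 0)
    (hw : (q.eval 1 + q.natDegree) * (Nat.log 2 n + 1) ≤ w) : q.eval n < 2 ^ w := by
  set L := Nat.log 2 n + 1
  calc q.eval n ≤ q.eval 1 * n ^ q.natDegree := by
        simp only [Polynomial.eval_eq_sum_range, one_pow, mul_one, Finset.sum_mul]
        gcongr with i hi
        · omega
        · exact Nat.lt_succ_iff.1 (Finset.mem_range.1 hi)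
    _ ≤ q.eval 1 * (2 ^ L) ^ q.natDegree := by
        gcongr
        exact (Nat.lt_pow_succ_log_self one_lt_two n).le
    _ < 2 ^ (q.eval 1 * L) * (2 ^ L) ^ q.natDegree := by
        gcongr
        exact Nat.lt_two_pow_self.trans_le
          (Nat.pow_le_pow_right two_pos (Nat.le_mul_of_pos_right _ (Nat.succ_pos _)))
    _ = 2 ^ ((q.eval 1 + q.natDegree) * L) := by ring
    _ ≤ 2 ^ w := Nat.pow_le_pow_right two_pos hw

namespace WordRAM

/-- Output the minimal absent words of a tree. -/
def solve : Cmd :=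
  buildAdjacency ;; buildTrie ;; report

/-- Set register 1 to the length of the input. -/
def prologue : Prog :=
  .seq (.const 1 0) (.seq (.load 1 1) (.seq (.const 3 3) (.op .mul 1 1 3)))

/-- The constant data that belong to an input. -/
def inputCtx (n : ℕ) (input : List ℕ) : Ctx where
  inp i := input.getD i 0
  base := 3 * n
  len := n * n + 2 * n + 1
  bound := n * n + 3 * n + 20

section

variable {n σ w : ℕ} {T : UnrootedTree n σ} {es : List T.graph.Dart}

theorem inputCtx_size_le (hn : 1 ≤ n) (input : List ℕ) :
    (inputCtx n input).base + 16 * (inputCtx n input).len ≤ 100 * n ^ 2 := by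
  have hmul := Nat.mul_le_mul_left n hn
  simp only [inputCtx]
  nlinarith

theorem inputCtx_fits (hn : 1 ≤ n) (hw : 100 * n ^ 2 < 2 ^ w) (input : List ℕ) :
    (inputCtx n input).Fits w where
  len := (inputCtx_size_le hn input).trans_lt hw
  bound := by
    have hmul := Nat.mul_le_mul_left n hn
    simp only [inputCtx]
    nlinarith

theorem inputCtx_encodes (h : T.IsEdgeList es) : (inputCtx n (T.encode es)).Encodes T es := by
  have key := getD_flatMap_three (fun d : T.graph.Dart => (d.fst : ℕ)) (fun d => (d.snd : ℕ))
    (fun d => (T.label ⟨d.edge, d.edge_mem⟩ : ℕ)) es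
  exact {
    length := T.length_edgeList_add_one h
    nodes := rfl
    fst := fun i hi => (key i hi).1
    snd := fun i hi => (key i hi).2.1
    lam := fun i hi => (key i hi).2.2.trans (T.natLabel_of_adj es[i].adj).symm
    base := rfl
    len := rfl
    bound := rfl }

theorem prologue_exec {S : ℕ} (h : T.IsEdgeList es) (hS : 0 < S) (hn : 3 * n < 2 ^ w)
    (hσ : σ ≤ 2 ^ w) :
    ∃ σ' : State w, Exec S prologue (State.init w (T.encode es)) 4 σ' ∧
      Rep (inputCtx n (T.encode es)) σ' ⟨0, 0, [], 4⟩ := by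
  have hentry : ∀ i, (T.encode es).getD i 0 < 2 ^ w := fun i => by
    rw [List.getD_eq_getElem?_getD]
    by_cases hi : i < (T.encode es).length
    · simpa [hi] using T.lt_of_mem_encode (by omega) hσ (List.getElem_mem hi)
    · simp [hi]
  have hlen : (T.encode es).length ≤ 3 * n := by
    have hedges := T.length_edgeList_add_one h
    have hencode := T.length_encode es
    omega
  refine ⟨_, .seq (t₁ := 1) (t₂ := 3) (.const _ _ _) (.seq (t₁ := 1) (t₂ := 2) (.load _ _ _ ?_)
    (.seq (t₁ := 1) (t₂ := 1) (.const _ _ _) (.op _ _ _ _ _))), ?_, fun a => ?_, fun i _ => ?_,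
    fun A i _ => ?_, ?_⟩
  · simpa using hS
  · have hhead : (T.encode es)[0]?.getD 0 = n := by simp [UnrootedTree.encode]
    simp [Op.eval, State.init, inputCtx, hhead, mul_comm n 3, Nat.mod_eq_of_lt hn]
  · simp [State.init, show 2 * a.idx ≠ 1 by omega, show 2 * a.idx ≠ 3 by omega]
  · simp only [State.init, inputCtx, BitVec.toNat_ofNat]
    exact Nat.mod_eq_of_lt (hentry i)
  · simp [State.init, inputCtx, show (T.encode es).length ≤ 16 * i + A.idx + 3 * n by omega]
  · simp [State.init]

theorem HasSuffixTrie.mem_natLanguage_iff {Γ : Ctx} {m : ℕ} {W : ℕ → List ℕ} {s : Env}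
    (h : HasSuffixTrie Γ T m W s) {z : List ℕ} : z ∈ T.natLanguage ↔ ∃ v < m, W v = z := by
  rw [T.mem_natLanguage_iff]
  constructor
  · rintro ⟨x, y, rfl⟩
    obtain ⟨v, hv⟩ := Nat.exists_eq_succ_of_ne_zero (h.cls_ne_zero (x, y))
    exact ⟨v, h.classes.table.word _ v hv⟩
  · rintro ⟨v, hv, rfl⟩
    obtain ⟨p, hp, -⟩ := h.exists_path hv
    exact ⟨p.1, p.2, hp.symm⟩

/-- The list `ts` describes every minimal absent word of the tree exactly once, and nothing
else. -/
def ListsAbsent (T : UnrootedTree n σ) (ts : List ((Fin n × Fin n) × ℕ)) : Prop :=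
  (ts.map T.natTriple).Nodup ∧ ∀ z, z ∈ ts.map T.natTriple ↔ z ∈ minimalAbsentWords T.natLanguage

theorem HasLinks.listsAbsent {Γ : Ctx} {m : ℕ} {W : ℕ → List ℕ} {path : ℕ → Fin n × Fin n}
    {link : ℕ → ℕ} {s : Env} (hl : HasLinks T m W path link s) (h : HasSuffixTrie Γ T m W s) :
    ListsAbsent T ((List.Ico 1 m).flatMap
      (absentTriples Γ.lam (s.arr .start) (s.arr .letter) path link)) := by
  have hmap : ((List.Ico 1 m).flatMap
      (absentTriples Γ.lam (s.arr .start) (s.arr .letter) path link)).map T.natTriple =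
      (List.Ico 1 m).flatMap (absentExtensions Γ.lam (s.arr .start) (s.arr .letter) W link) := by
    rw [List.map_flatMap]
    refine List.flatMap_congr fun v hv => ?_
    simp [absentTriples, absentExtensions, UnrootedTree.natTriple,
      ← hl.word v (List.Ico.mem.1 hv).2]
  rw [ListsAbsent, hmap]
  exact ⟨h.trie.nodup_flatMap_absentExtensions hl.isSuffixLink, fun z =>
    h.trie.mem_flatMap_absentExtensions_iff h.start_self hl.isSuffixLink
      fun _ => h.mem_natLanguage_iff⟩

theorem solve_wp (h : T.IsEdgeList es) :
    solve.wp (inputCtx n (T.encode es)) (fun s' => ∃ ts, ListsAbsent T ts ∧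
      s'.out = ts.flatMap tripleOut ∧ s'.time ≤ 1000 * (n ^ 2 + ts.length)) ⟨0, 0, [], 4⟩ := by
  have hΓ := inputCtx_encodes h
  have hn : 1 ≤ n := T.length_edgeList_add_one h ▸ Nat.le_add_left _ _
  have hnn := Nat.mul_le_mul_left n hn
  refine Cmd.wp_then (buildAdjacency_wp hΓ h rfl) fun s₁ f₁ ⟨⟨owner, hadj⟩, ht₁⟩ => ?_
  refine Cmd.wp_then (buildTrie_wp hΓ hadj (f₁.arr _ rfl) (f₁.arr _ rfl) (f₁.arr _ rfl))
    fun s₂ f₂ ⟨⟨m, W, htrie⟩, _⟩ => ?_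
  obtain ⟨path, link, hl⟩ := htrie.exists_hasLinks
  refine Cmd.wp_mono (fun s₃ ⟨hout, _⟩ => ⟨_, hl.listsAbsent htrie, ?_, ?_⟩)
    (report_wp hΓ htrie hl ((f₂.arr .mark rfl).trans (f₁.arr _ rfl)))
  · rw [hout, f₂.out rfl, f₁.out rfl, List.nil_append]
  · dsimp only at ht₁
    nlinarith

theorem ListsAbsent.exists_map_eq {ts : List ((Fin n × Fin n) × ℕ)} (h : ListsAbsent T ts) :
    ∃ ts' : List (Fin n × Fin n × Fin σ), ts'.map (fun t => ((t.1, t.2.1), t.2.2.val)) = ts := by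
  rw [← Set.mem_range, Set.range_list_map]
  intro t ht
  have hmaw := (h.2 _).1 (List.mem_map_of_mem ht)
  rw [UnrootedTree.natLanguage, minimalAbsentWords_map Fin.val_injective] at hmaw
  obtain ⟨z, -, hz⟩ := hmaw
  have hmem : t.2 ∈ z.map Fin.val := by
    rw [hz]
    exact List.mem_append_right _ List.mem_cons_self
  obtain ⟨c, -, hc⟩ := List.mem_map.1 hmem
  exact ⟨(t.1.1, t.1.2, c), by simp [hc]⟩

theorem ListsAbsent.listsMAW {ts : List ((Fin n × Fin n) × ℕ)} (h : ListsAbsent T ts) (w : ℕ) :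
    T.ListsMAW ((ts.flatMap tripleOut).map (BitVec.ofNat w)) ∧ ts.length = T.maw.ncard := by
  classical
  obtain ⟨ts, rfl⟩ := h.exists_map_eq
  obtain ⟨hnodup, hmem⟩ := h
  have hinj : Function.Injective (List.map (Fin.val (n := σ))) :=
    List.map_injective_iff.2 Fin.val_injective
  have hword : (ts.map fun t => ((t.1, t.2.1), t.2.2.val)).map T.natTriple =
      (ts.map T.tripleWord).map (List.map Fin.val) := by
    simp [UnrootedTree.natTriple, UnrootedTree.tripleWord, UnrootedTree.natWord]
  rw [hword] at hnodup hmem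
  have hmaw : ∀ z, z ∈ ts.map T.tripleWord ↔ z ∈ T.maw := fun z => by
    rw [← List.mem_map_of_injective hinj, hmem, UnrootedTree.natLanguage,
      minimalAbsentWords_map Fin.val_injective, hinj.mem_set_image, UnrootedTree.maw]
  refine ⟨⟨ts, ?_, hnodup.of_map, hmaw⟩, ?_⟩
  · rw [List.map_flatMap, List.flatMap_map]
    rfl
  · rw [show T.maw = ((ts.map T.tripleWord).toFinset : Set (List (Fin σ))) by ext z; simp [← hmaw],
      Set.ncard_coe_finset, List.toFinset_card_of_nodup hnodup.of_map]
    simp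

theorem solve_exec (h : T.IsEdgeList es) (hw : 100 * n ^ 2 < 2 ^ w) (hσ : σ ≤ 2 ^ w) :
    ∃ (S t : ℕ) (s : State w),
      Exec S (.seq prologue solve.code) (State.init w (T.encode es)) t s ∧
      t ≤ 1000 * (n ^ 2 + T.maw.ncard) ∧ S ≤ 100 * n ^ 2 ∧ T.ListsMAW s.out := by
  have hn : 1 ≤ n := T.length_edgeList_add_one h ▸ Nat.le_add_left _ _
  obtain ⟨s₁, hexec₁, hrep₁⟩ := prologue_exec (w := w)
    (S := (inputCtx n (T.encode es)).base + 16 * (inputCtx n (T.encode es)).len) h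
    (by simp [inputCtx]) (by nlinarith) hσ
  obtain ⟨t, s₂, s, hexec₂, hrep₂, ht, ts, hts, hout, htime⟩ :=
    Cmd.simulated (inputCtx_fits hn hw _) solve hrep₁ (solve_wp h)
  obtain ⟨hmaw, hcard⟩ := hts.listsMAW w
  refine ⟨_, _, s₂, .seq hexec₁ hexec₂, ?_, inputCtx_size_le hn _, by rwa [hrep₂.out, hout]⟩
  rw [← hcard]
  exact ht.symm.trans_le htime

end

end WordRAM

theorem mainTheorem6 :
    ∃ P : WordRAM.Prog, ∀ q : Polynomial ℕ, ∃ C : ℕ,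
      ∀ (n σ : ℕ) (T : UnrootedTree n σ), σ ≤ q.eval n →
      ∀ es : List T.graph.Dart, T.IsEdgeList es →
      ∀ w : ℕ, C * (Nat.log 2 n + 1) ≤ w →
        ∃ (S t : ℕ) (s : WordRAM.State w),
          WordRAM.Exec S P (WordRAM.State.init w (T.encode es)) t s ∧
          t ≤ C * (n ^ 2 + T.maw.ncard) ∧
          S ≤ C * n ^ 2 ∧
          T.ListsMAW s.out := by
  refine ⟨.seq WordRAM.prologue WordRAM.solve.code, fun q =>
    ⟨q.eval 1 + q.natDegree + 1000, fun n σ T hσ es hes w hw => ?_⟩⟩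
  have hn : n ≠ 0 := (T.length_edgeList_add_one hes).symm.trans_ne (Nat.succ_ne_zero _)
  have hC {k : ℕ} (hk : k ≤ 1000) : k ≤ q.eval 1 + q.natDegree + 1000 :=
    hk.trans (Nat.le_add_left _ _)
  have hlogw {k : ℕ} (hk : k ≤ q.eval 1 + q.natDegree + 1000) : k * (Nat.log 2 n + 1) ≤ w :=
    (Nat.mul_le_mul_right _ hk).trans hw
  have hσw : q.eval n < 2 ^ w := eval_lt_two_pow q hn (hlogw (Nat.le_add_right _ _))
  have hnw : 100 * n ^ 2 < 2 ^ w := by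
    have h := eval_lt_two_pow (100 * .X ^ 2) hn (hlogw (hC (by simp)))
    rwa [Polynomial.eval_mul, Polynomial.eval_pow, Polynomial.eval_X, Polynomial.eval_ofNat] at h
  obtain ⟨S, t, s, hexec, ht, hS, hmaw⟩ := WordRAM.solve_exec hes hnw (hσ.trans hσw.le)
  exact ⟨S, t, s, hexec, ht.trans (Nat.mul_le_mul_right _ (hC le_rfl)),
    hS.trans (Nat.mul_le_mul_right _ (hC (by decide))), hmaw⟩
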